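/- **Conventions.** Let $G$ be a group. A *$G$-tree* is a (nonempty) $\mathbf R$-tree with a left action of $G$ by isometries; it is *minimal* if it has no proper $G$-subtree. A point $x$ of a $G$-tree is *ordinary* if there are exactly two directions at $x$ and no element of $G$ fixes $x$ and transposes them. A *vertex set* of a $G$-tree $S$ is a nonempty, $G$-invariant, closed, discrete subset $V$ that contains all non-ordinary points and such that the closure of each component of $S-V$ (an *edge*) is a closed segment with end points in $V$. A $G$-tree is *simplicial* if it has a vertex set $V$; $V$ makes $S$ a combinatorial $G$-tree, with quotient graph $G\backslash S$ and an associated graph of groups. A *morphism* from a $G$-tree $S$ to an $H$-tree $T$ is a homomorphism $\tilde\phi\colon G\to H$ together with a map $\phi\colon S\to T$ such that $\phi(gx)=\tilde\phi(g)\phi(x)$ for $g\in G$, $x\in S$, and such that each nondegenerate segment $[x,y]$ of $S$ has a nondegenerate initial segment $[x,w]$ on which $\phi$ is an isometry. A *basic fold* is a morphism $p\colon S\to S'$ of simplicial $G$-trees (with the identity homomorphism of $G$) for which there are a vertex set of $S$ and two distinct edges $[v,x]$, $[v,y]$ of the same length such that $p$ is the quotient map by the smallest $G$-invariant equivalence relation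 that identifies $[v,x]$ with $[v,y]$ isometrically, fixing $v$, and such that one of the following holds: (I) $v,x,y$ lie in three different $G$-orbits; (II) $x\notin Gv$ and $y=gx$ for some $g\in G_v$; (III) $x\notin Gv$, $y\in Gx$, but $y\notin G_vx$. A *vertex morphism* is a morphism $\theta\colon S\to T$ from a simplicial $G$-tree to a simplicial $H$-tree which, for suitable vertex sets, maps vertices to vertices and edges isometrically onto edges, induces an isomorphism of graphs $G\backslash S\to H\backslash T$, and changes the graph of groups in the label of at most one vertex: $\tilde\theta$ maps the stabilizer of each edge isomorphically onto the stabilizer of its image, and there is a vertex $u$ such that $\tilde\theta$ maps $G_w$ isomorphically onto $H_{\theta(w)}$ for every vertex $w\notin Gu$ and maps $G_u$ onto $H_{\theta(u)}$. **Theorem.** Let $S$ be a simplicial $G$-tree with $G\backslash S$ finite (for some vertex set of $S$), and let $T$ be a minimal simplicial $H$-tree all of whose edge stabilizers in $H$ are finitely generated. Let $\phi\colon S\to T$ be a morphism whose homomorphism $\tilde\phi\colon G\to H$ is surjective and restricts to an injective map on the stabilizer of each point of $S$. Then $\phi$, together with $\tilde\phi$, can be written as a product (composition) of finitely many basic folds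 and vertex morphisms, followed by an isomorphism onto $T$. -/

import Mathlib

universe u v u' v'

namespace TreeFolding

/-! ### Real trees and group actions on them -/

section RTree

variable {T : Type*} [MetricSpace T]

/-- The segment `[x, y]` of a metric space: the points lying between `x` and `y`.  In an `ℝ`-tree
this is the unique arc from `x` to `y`. -/
def seg (x y : T) : Set T := {z | dist x z + dist z y = dist x y}

variable (T) in
/-- An `ℝ`-tree: a nonempty geodesic metric space that is `0`-hyperbolic (four point condition).
Equivalently, any two points are joined by a unique arc, and this arc is isometric to a compact
interval of the real line. -/
structure IsRTree : Prop where
  nonempty : Nonempty T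
  geodesic : ∀ x y : T, ∃ γ : ℝ → T, γ 0 = x ∧ γ (dist x y) = y ∧
    ∀ s ∈ Set.Icc 0 (dist x y), ∀ t ∈ Set.Icc 0 (dist x y), dist (γ s) (γ t) = |s - t|
  hyperbolic : ∀ x y z w : T,
    dist x y + dist z w ≤ max (dist x z + dist y w) (dist x w + dist y z)

/-- For points `y, z` different from `x`: the segments `[x, y]` and `[x, z]` define the same
direction at `x`, that is, they have a nondegenerate initial segment `[x, w]` as intersection. -/
def SameDir (x y z : T) : Prop := ∃ w, w ≠ x ∧ seg x y ∩ seg x z = seg x w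

/-- There are exactly two directions at `x`, and they are those of `[x, y]` and `[x, z]`. -/
def AreTheTwoDirs (x y z : T) : Prop :=
  y ≠ x ∧ z ≠ x ∧ ¬ SameDir x y z ∧ ∀ w, w ≠ x → SameDir x w y ∨ SameDir x w z

end RTree

section GTree

variable (G : Type*) [Group G] {T : Type*} [MetricSpace T] [MulAction G T]

variable (T) in
/-- A `G`-tree: an `ℝ`-tree on which `G` acts (on the left) by isometries. -/
structure IsGTree : Prop where
  isRTree : IsRTree T
  dist_smul : ∀ (g : G) (x y : T), dist (g • x) (g • y) = dist x y

variable (T) in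
/-- A `G`-tree is minimal if it has no proper `G`-subtree: the only nonempty `G`-invariant convex
subset is the whole tree. -/
def IsMinimalTree : Prop :=
  ∀ Y : Set T, Y.Nonempty → (∀ x ∈ Y, ∀ y ∈ Y, seg x y ⊆ Y) →
    (∀ (g : G), ∀ x ∈ Y, g • x ∈ Y) → Y = Set.univ

/-- A point of reflection: there are exactly two directions at `x`, and some element of `G`
fixes `x` and transposes them. -/
def IsReflectionPoint (x : T) : Prop :=
  ∃ y z, AreTheTwoDirs x y z ∧ ∃ g : G, g • x = x ∧ SameDir x (g • y) z ∧ SameDir x (g • z) y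

/-- An ordinary point: there are exactly two directions at `x`, and `x` is not a point of
reflection. -/
def IsOrdinaryPoint (x : T) : Prop :=
  (∃ y z, AreTheTwoDirs x y z) ∧ ¬ IsReflectionPoint G x

/-- The pair `(a, b)` spans an edge (with respect to a set `V` of vertices): `a, b` are distinct
vertices and no other vertex lies on the segment `[a, b]`.  The pair carries an orientation, so
every geometric edge occurs both as `(a, b)` and as `(b, a)`. -/
def IsEdge (V : Set T) (a b : T) : Prop :=
  a ∈ V ∧ b ∈ V ∧ a ≠ b ∧ seg a b ∩ V = {a, b}

/-- `V` is the vertex set of a structure of combinatorial `G`-tree on the `G`-tree `T`: it is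
nonempty, `G`-invariant, closed and discrete, it contains every point which is not ordinary
(so `G` acts without inversions), and the closures of the components of the complement of `V` are
closed segments with end points in `V`, that is, every point outside `V` lies on an edge.
A `G`-tree is a simplicial `G`-tree if it has such a vertex set. -/
structure IsVertexSet (V : Set T) : Prop where
  nonempty : V.Nonempty
  smul_mem : ∀ (g : G), ∀ x ∈ V, g • x ∈ V
  isClosed : IsClosed V
  isDiscrete : DiscreteTopology V
  mem_of_not_ordinary : ∀ x : T, ¬ IsOrdinaryPoint G x → x ∈ V
  exists_edge : ∀ x : T, x ∉ V → ∃ a b, IsEdge V a b ∧ x ∈ seg a b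

/-- The quotient by `G` of the combinatorial tree with vertex set `V` is a finite graph: there are
finitely many orbits of vertices and of edges. -/
def HasFiniteQuotient (V : Set T) : Prop :=
  (∃ F : Set T, F.Finite ∧ ∀ x ∈ V, ∃ g : G, g • x ∈ F) ∧
  (∃ F : Set (T × T), F.Finite ∧ ∀ a b, IsEdge V a b → ∃ g : G, (g • a, g • b) ∈ F)

/-- The stabilizer of the edge spanned by `a` and `b`.  (As there are no inversions, it is
also the setwise stabilizer of `[a, b]`.) -/
def edgeStabilizer (a b : T) : Subgroup G :=
  MulAction.stabilizer G a ⊓ MulAction.stabilizer G b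

end GTree

/-! ### Morphisms -/

section Morphism

variable {G : Type*} [Group G] {S : Type*} [MetricSpace S] [MulAction G S]
variable {H : Type*} [Group H] {T : Type*} [MetricSpace T] [MulAction H T]

/-- The map `f : S → T` together with the homomorphism `fhom : G → H` is a morphism from the
`G`-tree `S` to the `H`-tree `T`: it is equivariant, and every nondegenerate segment `[x, y]` has a
nondegenerate initial segment `[x, w]` which `f` maps isometrically. -/
structure IsTreeMorphism (fhom : G →* H) (f : S → T) : Prop where
  map_smul : ∀ (g : G) (x : S), f (g • x) = fhom g • f x
  locally_isometric : ∀ x y : S, x ≠ y → ∃ w ∈ seg x y, w ≠ x ∧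
    ∀ a ∈ seg x w, ∀ b ∈ seg x w, dist (f a) (f b) = dist a b

/-- A vertex morphism: a morphism of simplicial trees for which the only change in the graph of
groups is a change in the label of one vertex.  For suitable vertex sets `V` and `W` the map sends
edges isometrically onto edges and induces an isomorphism of the quotient graphs; the homomorphism
restricts to isomorphisms on all edge stabilizers and on the stabilizers of all vertices outside
the orbit of one vertex `u`, and to a surjection from the stabilizer of `u` to that of its image. -/
structure IsVertexMorphism (fhom : G →* H) (f : S → T) : Prop where
  source : IsGTree G S
  target : IsGTree H T
  morphism : IsTreeMorphism fhom f
  exists_vertexSets : ∃ (V : Set S) (W : Set T), IsVertexSet G V ∧ IsVertexSet H W ∧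
    -- `f` is a simplicial map, isometric on edges
    (∀ a ∈ V, f a ∈ W) ∧
    (∀ a b, IsEdge V a b → IsEdge W (f a) (f b) ∧ dist (f a) (f b) = dist a b) ∧
    -- it is bijective on orbits of vertices
    (∀ w ∈ W, ∃ a ∈ V, ∃ h : H, h • f a = w) ∧
    (∀ a ∈ V, ∀ b ∈ V, (∃ h : H, h • f a = f b) → ∃ g : G, g • a = b) ∧
    -- it is bijective on orbits of (oriented) edges
    (∀ c d, IsEdge W c d → ∃ a b, IsEdge V a b ∧ ∃ h : H, h • f a = c ∧ h • f b = d) ∧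
    (∀ a b a' b', IsEdge V a b → IsEdge V a' b' →
      (∃ h : H, h • f a = f a' ∧ h • f b = f b') → ∃ g : G, g • a = a' ∧ g • b = b') ∧
    -- edge stabilizers do not change
    (∀ a b, IsEdge V a b → Set.BijOn fhom (edgeStabilizer G a b) (edgeStabilizer H (f a) (f b))) ∧
    -- at most one vertex label changes, by a surjection
    (∃ u ∈ V,
      (∀ a ∈ V, a ∉ MulAction.orbit G u →
        Set.BijOn fhom (MulAction.stabilizer G a) (MulAction.stabilizer H (f a))) ∧
      Set.SurjOn fhom (MulAction.stabilizer G u) (MulAction.stabilizer H (f u)) )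

end Morphism

/-! ### Basic folds -/

section Fold

variable (G : Type*) [Group G] {S : Type*} [MetricSpace S] [MulAction G S]

/-- The edges `[v, x]`, `[v, y]` are folded by a fold of type I: in the quotient graph, the images
of `v`, `x`, `y` are three different vertices. -/
def IsTypeI (v x y : S) : Prop :=
  x ∉ MulAction.orbit G v ∧ y ∉ MulAction.orbit G v ∧ y ∉ MulAction.orbit G x

/-- The edges `[v, x]`, `[v, y]` are folded by a fold of type II: an element of the stabilizer of
`v` carries one edge to the other, and the image of the edge in the quotient graph has different
end points. -/
def IsTypeII (v x y : S) : Prop :=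
  x ∉ MulAction.orbit G v ∧ ∃ g ∈ MulAction.stabilizer G v, g • x = y

/-- The edges `[v, x]`, `[v, y]` are folded by a fold of type III: in the quotient graph, their
images are two different edges which join the same two different vertices. -/
def IsTypeIII (v x y : S) : Prop :=
  x ∉ MulAction.orbit G v ∧ y ∈ MulAction.orbit G x ∧
    ¬ ∃ g ∈ MulAction.stabilizer G v, g • x = y

/-- The smallest `G`-invariant equivalence relation that identifies the segments
`[v, x]` and `[v, y]` (of the same length) isometrically, fixing `v`. -/
def FoldRel (v x y : S) : S → S → Prop :=
  Relation.EqvGen fun p q => ∃ g : G, ∃ a ∈ seg v x, ∃ b ∈ seg v y,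
    dist v a = dist v b ∧ p = g • a ∧ q = g • b

variable {S' : Type*} [MetricSpace S'] [MulAction G S']

/-- A basic fold (of type I, II or III): for some vertex set `V` of the simplicial `G`-tree
`S` and two different edges `[v, x]`, `[v, y]` of the same length in one of the three
configurations, the morphism `p : S → S'` of `G`-trees is the quotient map which equivariantly folds
`[v, x]` and `[v, y]` together. -/
structure IsBasicFold (p : S → S') : Prop where
  source : IsGTree G S
  target : IsGTree G S'
  morphism : IsTreeMorphism (MonoidHom.id G) p
  surjective : Function.Surjective p
  exists_edges : ∃ (V : Set S) (v x y : S), IsVertexSet G V ∧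
    IsEdge V v x ∧ IsEdge V v y ∧ x ≠ y ∧ dist v x = dist v y ∧
    (IsTypeI G v x y ∨ IsTypeII G v x y ∨ IsTypeIII G v x y) ∧
    ∀ a b, p a = p b ↔ FoldRel G v x y a b

end Fold

/-! ### Products of basic folds and vertex morphisms -/

/-- The morphism to the `H`-tree `T` is a product of finitely many basic folds and vertex
morphisms (followed by an isomorphism onto `T`). -/
inductive IsFoldVertexProduct {H : Type u'} {T : Type v'} [Group H] [MetricSpace T]
    [MulAction H T] :
    ∀ {G : Type u} {S : Type v} [Group G] [MetricSpace S] [MulAction G S],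
      (G →* H) → (S → T) → Prop
  | iso {G : Type u} {S : Type v} [Group G] [MetricSpace S] [MulAction G S]
      (e : G ≃* H) (f : S ≃ᵢ T) (hf : ∀ (g : G) (x : S), f (g • x) = e g • f x) :
      IsFoldVertexProduct (e : G →* H) (f : S → T)
  | fold {G : Type u} {S S' : Type v} [Group G] [MetricSpace S] [MulAction G S]
      [MetricSpace S'] [MulAction G S'] (p : S → S') (hp : IsBasicFold G p)
      (fhom : G →* H) (f : S' → T) (hf : IsFoldVertexProduct fhom f) :
      IsFoldVertexProduct fhom (f ∘ p)
  | vertex {G G' : Type u} {S S' : Type v} [Group G] [MetricSpace S] [MulAction G S]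
      [Group G'] [MetricSpace S'] [MulAction G' S'] (qhom : G →* G') (q : S → S')
      (hq : IsVertexMorphism qhom q)
      (fhom : G' →* H) (f : S' → T) (hf : IsFoldVertexProduct fhom f) :
      IsFoldVertexProduct (fhom.comp qhom) (f ∘ q)

end TreeFolding

/-!
A morphism `φ` from `S` to `T` is decomposed by Stallings' folding method.

*Subdivision.* `φ` is surjective because `T` is minimal, and it has finitely many orbits of folded
points, because each edge of `S` is cut by `φ` into finitely many isometric pieces.  Adding the
images of these points to the vertices of `T`, and then the midpoints of all edges, one obtains a
vertex set `W` of `T` whose preimage is a vertex set of `S`, for which `φ` is an isometry on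
edges and no edge of `T` joins two vertices of the same orbit (`exists_isSimplicialMap`).

*One step.* A simplicial map which is not an isometry maps two edges `[v, x]`, `[v, y]` of `S`
to the same edge (`IsSimplicialMap.exists_fold`).  They can be folded by a basic fold
(`IsSimplicialMap.exists_basicFold`).  This may destroy the injectivity of the homomorphism on the
stabilizer of the image of `x`.  As the two ends of an edge lie in different orbits, the
stabilizers of all edges and of all other vertices are still embedded, and a vertex morphism, the
quotient by the normal closure of the kernel on that one stabilizer, restores injectivity
(`IsSimplicialMap.exists_vertexMorphism`).

*Quotient trees.* Both quotients are instances of `IsSimplicialMap.exists_quotient`.  The quotient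
pseudometric is the infimum of the lengths of chains which may jump between related points.  To see
that it satisfies the four point condition, one approximates it from above by pseudometrics obtained
from the metric by finitely many elementary folds: at a base point `v`, the four point
condition says that the Gromov product `(p|q)` is ultrametric, and folding `x` with `y` means to
enlarge this product to the smallest ultrametric one with `(x|y) = d(v, x)`
(`IsTreeDist.exists_fold`).  A connected metric space with the four point condition is an
`ℝ`-tree (`isRTree_of_connected`).  Since fibres of `φ` are uniformly discrete near each point, no
points are identified in the quotient except related ones.

*Termination.* A fold of type I or III decreases the number of orbits of edges.  Folds of type II
are controlled by the finite generation of the edge stabilizers of `T`.  Generators are the images of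
finitely many `g` in `G` for which `φ` identifies `a` with `g • a` for the ends `a` of the edge.  If
`g • a ≠ a`, the segment `[a, g • a]` is mapped to a closed path, so it contains two consecutive
edges with the same image, and folding them shortens it.  Once all these segments are trivial, the
edge stabilizers of `S` are mapped onto those of `T`, and only folds of type I or III are left
(`IsSimplicialMap.isFoldVertexProduct`).
-/

namespace TreeFolding

/-! ### Segments and directions in `ℝ`-trees -/

section Segments

variable {T : Type*} [MetricSpace T] {a b c d m w x y z : T}

theorem mem_seg : z ∈ seg x y ↔ dist x z + dist z y = dist x y := Iff.rfl

theorem mem_seg_comm : z ∈ seg x y ↔ z ∈ seg y x := by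
  simp only [mem_seg, dist_comm y x, dist_comm y z, dist_comm z x, add_comm]

theorem left_mem_seg (x y : T) : x ∈ seg x y := by simp [mem_seg]

theorem right_mem_seg (x y : T) : y ∈ seg x y := by simp [mem_seg]

theorem seg_trans (hz : z ∈ seg x y) (hw : w ∈ seg x z) : w ∈ seg x y ∧ z ∈ seg w y := by
  simp only [mem_seg] at *
  have h1 := dist_triangle x w y
  have h2 := dist_triangle w z y
  constructor <;> linarith

theorem seg_trans_right (hz : z ∈ seg x y) (hw : w ∈ seg z y) : w ∈ seg x y ∧ z ∈ seg x w := by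
  rw [mem_seg_comm] at hz hw
  obtain ⟨h1, h2⟩ := seg_trans hz hw
  exact ⟨mem_seg_comm.1 h1, mem_seg_comm.1 h2⟩

theorem seg_antisymm (h : y ∈ seg x z) (h' : z ∈ seg x y) : y = z := by
  rw [mem_seg, dist_comm z y] at *
  exact dist_le_zero.1 (by linarith)

namespace IsRTree

variable (hT : IsRTree T)
include hT

theorem exists_mem_seg (x y : T) {t : ℝ} (h0 : 0 ≤ t) (h1 : t ≤ dist x y) :
    ∃ z ∈ seg x y, dist x z = t := by
  obtain ⟨γ, hx, hy, hγ⟩ := hT.geodesic x y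
  have ht : t ∈ Set.Icc 0 (dist x y) := ⟨h0, h1⟩
  have hl : dist (γ 0) (γ t) = t := by
    rw [hγ 0 ⟨le_rfl, dist_nonneg⟩ t ht, zero_sub, abs_neg, abs_of_nonneg h0]
  have hr : dist (γ t) (γ (dist x y)) = dist x y - t := by
    rw [hγ t ht _ ⟨dist_nonneg, le_rfl⟩, abs_sub_comm, abs_of_nonneg (by linarith)]
  rw [hx] at hl
  rw [hy] at hr
  exact ⟨γ t, by rw [mem_seg]; linarith, hl⟩

theorem dist_mem_seg (hz : z ∈ seg x y) (hw : w ∈ seg x y) :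
    dist z w = |dist x z - dist x w| := by
  rw [mem_seg] at hz hw
  have h := hT.hyperbolic x y z w
  have h1 := dist_triangle x z w
  have h2 := dist_triangle x w z
  rw [dist_comm w z] at h2
  rw [dist_comm y w, dist_comm y z] at h
  refine le_antisymm ?_ (abs_le.2 ⟨by linarith, by linarith⟩)
  rcases le_max_iff.1 h with h | h
  · linarith [le_abs_self (dist x z - dist x w)]
  · linarith [neg_abs_le (dist x z - dist x w)]

theorem eq_of_mem_seg (hz : z ∈ seg x y) (hw : w ∈ seg x y) (h : dist x z = dist x w) :
    z = w := by
  rw [← dist_eq_zero, hT.dist_mem_seg hz hw, h, sub_self, abs_zero]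

theorem mem_seg_of_dist_le (hz : z ∈ seg x y) (hw : w ∈ seg x y) (h : dist x z ≤ dist x w) :
    z ∈ seg x w := by
  rw [mem_seg, hT.dist_mem_seg hz hw, abs_sub_comm, abs_of_nonneg (by linarith)]
  ring

/-- The distance function from a point is maximal at an end of a segment, with slope one. -/
theorem dist_le_of_mem_seg (hz : z ∈ seg x y) (w : T) :
    dist z w ≤ dist x w - dist x z ∨ dist z w ≤ dist y w - dist z y := by
  rw [mem_seg] at hz
  have h := hT.hyperbolic x y z w
  rw [dist_comm y z] at h
  rcases le_max_iff.1 h with h | h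
  · right; linarith
  · left; linarith

theorem exists_center (x y z : T) : ∃ m, m ∈ seg x y ∧ m ∈ seg y z ∧ m ∈ seg x z := by
  have h1 := dist_triangle x y z
  have h2 := dist_triangle y x z
  have h3 := dist_triangle x z y
  rw [dist_comm y x] at h2
  rw [dist_comm z y] at h3
  obtain ⟨m, hm, hxm⟩ := hT.exists_mem_seg x y (t := (dist x y + dist x z - dist y z) / 2)
    (by linarith) (by linarith)
  refine ⟨m, hm, ?_⟩
  have hm' := mem_seg.1 hm
  have t1 := dist_triangle x m z
  have t2 := dist_triangle y m z
  rw [dist_comm y m] at t2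
  rw [mem_seg, mem_seg, dist_comm y m]
  rcases hT.dist_le_of_mem_seg hm z with h | h <;> constructor <;> linarith

theorem seg_concat (h1 : b ∈ seg a c) (h2 : c ∈ seg b d) (hbc : b ≠ c) :
    b ∈ seg a d ∧ c ∈ seg a d := by
  simp only [mem_seg] at *
  have h := hT.hyperbolic a c b d
  have h0 := dist_pos.2 hbc
  have t1 := dist_triangle a c d
  have t2 := dist_triangle a b d
  rw [dist_comm c b] at h
  rcases le_max_iff.1 h with h | h <;> constructor <;> linarith

theorem sameDir_iff : SameDir x y z ↔ dist y z < dist x y + dist x z := by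
  constructor
  · rintro ⟨w, hw, h⟩
    have hwm : w ∈ seg x y ∩ seg x z := h ▸ right_mem_seg x w
    have h1 := mem_seg.1 hwm.1
    have h2 := mem_seg.1 hwm.2
    have h3 := dist_triangle y w z
    have h4 := dist_pos.2 hw
    rw [dist_comm w x] at h4
    rw [dist_comm y w] at h3
    linarith
  · intro h
    obtain ⟨m, hxy, hyz, hxz⟩ := hT.exists_center x y z
    refine ⟨m, ?_, ?_⟩
    · rintro rfl
      have := mem_seg.1 hyz
      rw [dist_comm y m] at this
      linarith
    · ext p
      constructor
      · rintro ⟨hp1, hp2⟩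
        rcases le_total (dist x p) (dist x m) with hle | hle
        · exact hT.mem_seg_of_dist_le hp1 hxy hle
        · have q1 := mem_seg.1 (hT.mem_seg_of_dist_le hxy hp1 hle)
          have e1 := mem_seg.1 hp1
          have e2 := mem_seg.1 hp2
          have e3 := mem_seg.1 hxy
          have e4 := mem_seg.1 hxz
          have e5 := mem_seg.1 hyz
          have e6 := dist_triangle y p z
          rw [dist_comm y p] at e6
          rw [dist_comm y m] at e5
          rw [mem_seg, dist_comm p m]
          linarith
      · intro hp
        exact ⟨(seg_trans hxy hp).1, (seg_trans hxz hp).1⟩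

theorem not_sameDir_iff : ¬ SameDir x y z ↔ x ∈ seg y z := by
  rw [hT.sameDir_iff, mem_seg, dist_comm y x, not_lt]
  have := dist_triangle y x z
  rw [dist_comm y x] at this
  constructor <;> intro h <;> linarith

theorem sameDir_symm (h : SameDir x y z) : SameDir x z y := by
  rw [hT.sameDir_iff] at *
  rw [dist_comm z y]
  linarith

theorem sameDir_trans (h : SameDir x y z) (h' : SameDir x z w) : SameDir x y w := by
  rw [hT.sameDir_iff] at *
  have := hT.hyperbolic y w x z
  rw [dist_comm y x, dist_comm w x, dist_comm w z] at this
  rcases le_max_iff.1 this with h1 | h1 <;> linarith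

/-- A common nondegenerate initial segment forces the same direction. -/
theorem sameDir_of_mem (hw : w ≠ x) (h1 : w ∈ seg x y) (h2 : w ∈ seg x z) : SameDir x y z := by
  rw [hT.sameDir_iff]
  have h3 := dist_triangle y w z
  have h4 := dist_pos.2 hw
  rw [mem_seg] at h1 h2
  rw [dist_comm w x] at h4
  rw [dist_comm y w] at h3
  linarith

end IsRTree

/-- A connected metric space satisfying the four point condition contains all points of the
segments between its points: the point at distance `t` from `x` on `[x, y]` would otherwise
separate the space. -/
theorem exists_dist_eq_of_connected [PreconnectedSpace T]
    (hyp : ∀ x y z w : T, dist x y + dist z w ≤ max (dist x z + dist y w) (dist x w + dist y z))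
    (x y : T) {t : ℝ} (h0 : 0 ≤ t) (h1 : t ≤ dist x y) :
    ∃ z ∈ seg x y, dist x z = t := by
  by_contra hcon
  push Not at hcon
  have hx : t ≠ 0 := fun h => hcon x (left_mem_seg x y) (by simp [h])
  -- the two sides of the missing point
  let A : Set T := {m | dist x m - t < dist y m - (dist x y - t)}
  have hA : IsOpen A := isOpen_lt (by fun_prop) (by fun_prop)
  have hAc : IsClosed A := by
    rw [← isOpen_compl_iff, Metric.isOpen_iff]
    intro m hm
    have hm' : dist y m - (dist x y - t) ≤ dist x m - t := not_lt.1 hm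
    rcases hm'.lt_or_eq with hlt | heq
    · obtain ⟨r, hr, hr'⟩ := Metric.isOpen_iff.1
        (isOpen_lt (f := fun m => dist y m - (dist x y - t)) (g := fun m => dist x m - t)
          (by fun_prop) (by fun_prop)) m hlt
      refine ⟨r, hr, fun p hp => ?_⟩
      intro (h : dist x p - t < dist y p - (dist x y - t))
      have h' : dist y p - (dist x y - t) < dist x p - t := hr' hp
      exact lt_asymm h h'
    · have htri := dist_triangle x m y
      rw [dist_comm m y] at htri
      have hpos : 0 < dist x m - t := by
        rcases (show 0 ≤ dist x m - t by linarith).lt_or_eq with h | h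
        · exact h
        · exact absurd (by linarith) (hcon m (by rw [mem_seg, dist_comm m y]; linarith))
      refine ⟨dist x m - t, hpos, fun p hp => ?_⟩
      rw [Metric.mem_ball, dist_comm] at hp
      intro (h' : dist x p - t < dist y p - (dist x y - t))
      have h4 := hyp x m y p
      have h5 := dist_triangle y p m
      rw [dist_comm p m] at h5
      rw [dist_comm m y] at h4
      rcases le_max_iff.1 h4 with h | h <;> linarith
  have huniv := IsClopen.eq_univ ⟨hAc, hA⟩ ⟨x, by
    have := lt_of_le_of_ne h0 hx.symm
    simp only [A, Set.mem_ofPred_eq, dist_self, dist_comm y x]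
    linarith⟩
  have hy : y ∈ A := huniv ▸ Set.mem_univ y
  simp only [A, Set.mem_ofPred_eq, dist_self] at hy
  linarith

theorem isRTree_of_connected [Nonempty T] [PreconnectedSpace T]
    (hyp : ∀ x y z w : T, dist x y + dist z w ≤ max (dist x z + dist y w) (dist x w + dist y z)) :
    IsRTree T where
  nonempty := inferInstance
  hyperbolic := hyp
  geodesic x y := by
    have key : ∀ t : ℝ, ∃ z, t ∈ Set.Icc 0 (dist x y) → z ∈ seg x y ∧ dist x z = t := fun t => by
      by_cases ht : t ∈ Set.Icc 0 (dist x y)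
      · obtain ⟨z, hz, hz'⟩ := exists_dist_eq_of_connected hyp x y ht.1 ht.2
        exact ⟨z, fun _ => ⟨hz, hz'⟩⟩
      · exact ⟨x, fun h => absurd h ht⟩
    choose γ hγ using key
    refine ⟨γ, ?_, ?_, fun s hs t ht => ?_⟩
    · exact (dist_eq_zero.1 (hγ 0 ⟨le_rfl, dist_nonneg⟩).2).symm
    · obtain ⟨h1, h2⟩ := hγ (dist x y) ⟨dist_nonneg, le_rfl⟩
      exact dist_le_zero.1 (by rw [mem_seg] at h1; linarith)
    · obtain ⟨s1, s2⟩ := hγ s hs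
      obtain ⟨t1, t2⟩ := hγ t ht
      have h := hyp x y (γ s) (γ t)
      have e1 := dist_triangle x (γ s) (γ t)
      have e2 := dist_triangle x (γ t) (γ s)
      rw [mem_seg] at s1 t1
      rw [dist_comm (γ t) (γ s)] at e2
      rw [dist_comm y, dist_comm y] at h
      refine le_antisymm ?_ (abs_le.2 ⟨by linarith, by linarith⟩)
      rcases le_max_iff.1 h with h | h
      · linarith [le_abs_self (s - t)]
      · linarith [neg_abs_le (s - t)]

theorem IsRTree.preconnectedSpace (hT : IsRTree T) : PreconnectedSpace T := by
  have := hT.nonempty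
  obtain ⟨o⟩ := hT.nonempty
  refine ⟨isPreconnected_of_forall o fun y _ => ?_⟩
  obtain ⟨γ, hx, hy, hγ⟩ := hT.geodesic o y
  have hc : ContinuousOn γ (Set.Icc 0 (dist o y)) := by
    refine LipschitzOnWith.continuousOn (K := 1) (LipschitzOnWith.of_dist_le_mul fun s hs t ht => ?_)
    rw [hγ s hs t ht, NNReal.coe_one, one_mul, Real.dist_eq]
  exact ⟨γ '' Set.Icc 0 (dist o y), Set.subset_univ _,
    ⟨0, ⟨le_rfl, dist_nonneg⟩, hx⟩, ⟨_, ⟨dist_nonneg, le_rfl⟩, hy⟩,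
    isPreconnected_Icc.image γ hc⟩

/-- In an `ℝ`-tree connected subsets are convex. -/
theorem IsRTree.seg_subset_of_isPreconnected (hT : IsRTree T) {C : Set T} (hC : IsPreconnected C)
    (hx : x ∈ C) (hy : y ∈ C) : seg x y ⊆ C := by
  intro z hz
  have : PreconnectedSpace C := Subtype.preconnectedSpace hC
  have hz' := mem_seg.1 hz
  obtain ⟨w, hw, hw'⟩ := exists_dist_eq_of_connected (T := C)
    (fun a b c d => hT.hyperbolic a.1 b.1 c.1 d.1) ⟨x, hx⟩ ⟨y, hy⟩ (t := dist x z) dist_nonneg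
    (by rw [Subtype.dist_eq]; linarith [dist_nonneg (x := z) (y := y)])
  have : z = w.1 := hT.eq_of_mem_seg hz hw hw'.symm
  rw [this]
  exact w.2

end Segments

/-! ### Vertex sets and edges -/

section Vertices

variable {T : Type*} [MetricSpace T] {V : Set T} {a b c d m w x y z : T}

/-- Every point `t` of the space, in `Z` or not, has a neighbourhood which contains no point of `Z`
except possibly `t`.  This is the same as being closed and discrete, in a form which passes
visibly to subsets and finite unions. -/
def LocFin (Z : Set T) : Prop := ∀ t, ∃ r > 0, ∀ z ∈ Z, dist z t < r → z = t

theorem LocFin.mono {Z Z' : Set T} (h : LocFin Z) (hZ : Z' ⊆ Z) : LocFin Z' := fun t => by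
  obtain ⟨r, hr, h⟩ := h t
  exact ⟨r, hr, fun z hz => h z (hZ hz)⟩

theorem LocFin.union {Z Z' : Set T} (h : LocFin Z) (h' : LocFin Z') : LocFin (Z ∪ Z') := by
  intro t
  obtain ⟨r, hr, h⟩ := h t
  obtain ⟨r', hr', h'⟩ := h' t
  refine ⟨min r r', lt_min hr hr', fun z hz hd => ?_⟩
  rcases hz with hz | hz
  · exact h z hz (hd.trans_le (min_le_left _ _))
  · exact h' z hz (hd.trans_le (min_le_right _ _))

theorem LocFin.biUnion {ι : Type*} {s : Set ι} (hs : s.Finite) {Z : ι → Set T}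
    (h : ∀ i ∈ s, LocFin (Z i)) : LocFin (⋃ i ∈ s, Z i) := by
  induction s, hs using Set.Finite.induction_on with
  | empty => exact fun t => ⟨1, one_pos, by simp⟩
  | insert _ _ ih =>
    rw [Set.biUnion_insert]
    exact (h _ (Set.mem_insert _ _)).union (ih fun i hi => h i (Set.mem_insert_of_mem _ hi))

theorem LocFin.isClosed {Z : Set T} (h : LocFin Z) : IsClosed Z := by
  rw [← isOpen_compl_iff, Metric.isOpen_iff]
  intro t ht
  obtain ⟨r, hr, h⟩ := h t
  exact ⟨r, hr, fun z hz hzZ => ht (h z hzZ hz ▸ hzZ)⟩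

theorem LocFin.discreteTopology {Z : Set T} (h : LocFin Z) : DiscreteTopology Z := by
  refine discreteTopology_subtype_iff.2 fun t _ => ?_
  obtain ⟨r, hr, h⟩ := h t
  rw [← disjoint_iff, Filter.disjoint_principal_right, mem_nhdsWithin]
  refine ⟨Metric.ball t r, Metric.isOpen_ball, Metric.mem_ball_self hr, ?_⟩
  rintro z ⟨hz, hzt⟩ hzZ
  exact hzt (h z hzZ hz)

theorem locFin_of_isClosed {Z : Set T} (h : IsClosed Z) (h' : DiscreteTopology Z) : LocFin Z := by
  intro t
  have hd : Disjoint (nhdsWithin t {t}ᶜ) (Filter.principal Z) := by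
    by_cases ht : t ∈ Z
    · exact disjoint_iff.2 (discreteTopology_subtype_iff.1 h' t ht)
    · exact Filter.disjoint_principal_right.2 (mem_nhdsWithin_of_mem_nhds (h.isOpen_compl.mem_nhds ht))
  rw [Filter.disjoint_principal_right, Metric.mem_nhdsWithin_iff] at hd
  obtain ⟨r, hr, h⟩ := hd
  refine ⟨r, hr, fun z hz hzt => by_contra fun hne => h ⟨hzt, hne⟩ hz⟩

theorem locFin_of_separated {Z : Set T} {δ : ℝ} (hδ : 0 < δ)
    (h : ∀ x ∈ Z, ∀ y ∈ Z, dist x y < δ → x = y) : LocFin Z := by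
  intro t
  by_cases hz : ∃ z ∈ Z, z ≠ t ∧ dist z t < δ / 2
  · obtain ⟨z, hz, hne, hd⟩ := hz
    refine ⟨dist z t, dist_pos.2 hne, fun w hw hwt => ?_⟩
    have : w = z := h w hw z hz (by linarith [dist_triangle_right w z t])
    exact absurd hwt (this ▸ lt_irrefl _)
  · push Not at hz
    exact ⟨δ / 2, by positivity, fun z hzZ hd => by_contra fun hne => (hz z hzZ hne).not_gt hd⟩

theorem LocFin.finite_inter {Z K : Set T} (h : LocFin Z) (hK : IsCompact K) : (Z ∩ K).Finite :=
  (hK.inter_left h.isClosed).finite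
    ((h.mono Set.inter_subset_left).discreteTopology.isDiscrete)

/-- Outside `V` the tree looks like a line: there are exactly two directions. -/
def TwoDirs (V : Set T) : Prop := ∀ x ∉ V, ∃ y z, AreTheTwoDirs x y z

theorem IsEdge.symm (h : IsEdge V a b) : IsEdge V b a := by
  obtain ⟨h1, h2, h3, h4⟩ := h
  refine ⟨h2, h1, h3.symm, ?_⟩
  rw [Set.pair_comm, ← h4]
  ext
  simp only [Set.mem_inter_iff, mem_seg_comm]

theorem IsEdge.eq_or_eq (h : IsEdge V a b) (hz : z ∈ V) (hz' : z ∈ seg a b) : z = a ∨ z = b := by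
  have : z ∈ seg a b ∩ V := ⟨hz', hz⟩
  rw [h.2.2.2] at this
  simpa using this

theorem IsEdge.dist_pos (h : IsEdge V a b) : 0 < dist a b := _root_.dist_pos.2 h.2.2.1

theorem seg_of_ends (hm : m ∈ seg a b) (h : a ∈ seg y b) : a ∈ seg y m := by
  have h1 := mem_seg.1 hm
  have h2 := mem_seg.1 h
  have h3 := dist_triangle y m b
  have h4 := dist_triangle y a m
  rw [mem_seg]
  linarith

namespace IsRTree

variable (hT : IsRTree T)
include hT

theorem isCompact_seg (x y : T) : IsCompact (seg x y) := by
  obtain ⟨γ, hx, hy, hγ⟩ := hT.geodesic x y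
  have hc : ContinuousOn γ (Set.Icc 0 (dist x y)) := by
    refine LipschitzOnWith.continuousOn (K := 1) (LipschitzOnWith.of_dist_le_mul fun s hs t ht => ?_)
    rw [hγ s hs t ht, NNReal.coe_one, one_mul, Real.dist_eq]
  have h0 : (0 : ℝ) ∈ Set.Icc 0 (dist x y) := ⟨le_rfl, dist_nonneg⟩
  have h1 : dist x y ∈ Set.Icc 0 (dist x y) := ⟨dist_nonneg, le_rfl⟩
  have hk : ∀ t ∈ Set.Icc 0 (dist x y), γ t ∈ seg x y ∧ dist x (γ t) = t := fun t ht => by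
    have e1 := hγ 0 h0 t ht
    have e2 := hγ t ht _ h1
    rw [hx, zero_sub, abs_neg, abs_of_nonneg ht.1] at e1
    rw [hy, abs_sub_comm, abs_of_nonneg (by linarith [ht.2])] at e2
    exact ⟨by rw [mem_seg]; linarith, e1⟩
  have : seg x y = γ '' Set.Icc 0 (dist x y) := by
    ext z
    constructor
    · intro hz
      have hz' := mem_seg.1 hz
      have hm : dist x z ∈ Set.Icc 0 (dist x y) :=
        ⟨dist_nonneg, by linarith [dist_nonneg (x := z) (y := y)]⟩
      exact ⟨_, hm, hT.eq_of_mem_seg (hk _ hm).1 hz (hk _ hm).2⟩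
    · rintro ⟨t, ht, rfl⟩
      exact (hk t ht).1
  rw [this]
  exact isCompact_Icc.image_of_continuousOn hc

theorem mem_seg_split (hz : z ∈ seg x y) (hw : w ∈ seg x y) : w ∈ seg x z ∨ w ∈ seg z y := by
  rcases le_total (dist x w) (dist x z) with h | h
  · exact Or.inl (hT.mem_seg_of_dist_le hw hz h)
  · exact Or.inr (seg_trans hw (hT.mem_seg_of_dist_le hz hw h)).2

theorem seg_subset (hz : z ∈ seg x y) (hw : w ∈ seg x y) : seg z w ⊆ seg x y := by
  intro p hp
  rcases hT.mem_seg_split hz hw with h | h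
  · exact (seg_trans hz (seg_trans_right h (mem_seg_comm.1 hp)).1).1
  · exact (seg_trans_right hz (seg_trans h hp).1).1

/-- Exactly two directions at an interior point of `[a, b]` have to be those of `a` and `b`. -/
theorem sameDir_or_of_twoDirs (hm : m ∈ seg a b) (ha : a ≠ m) (hb : b ≠ m)
    (h : ∃ y z, AreTheTwoDirs m y z) (hx : x ≠ m) : SameDir m x a ∨ SameDir m x b := by
  obtain ⟨y, z, -, -, -, h⟩ := h
  have hab := hT.not_sameDir_iff.2 hm
  rcases h a ha with h1 | h1 <;> rcases h b hb with h2 | h2 <;> rcases h x hx with h3 | h3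
  · exact absurd (hT.sameDir_trans h1 (hT.sameDir_symm h2)) hab
  · exact absurd (hT.sameDir_trans h1 (hT.sameDir_symm h2)) hab
  · exact Or.inl (hT.sameDir_trans h3 (hT.sameDir_symm h1))
  · exact Or.inr (hT.sameDir_trans h3 (hT.sameDir_symm h2))
  · exact Or.inr (hT.sameDir_trans h3 (hT.sameDir_symm h2))
  · exact Or.inl (hT.sameDir_trans h3 (hT.sameDir_symm h1))
  · exact absurd (hT.sameDir_trans h1 (hT.sameDir_symm h2)) hab
  · exact absurd (hT.sameDir_trans h1 (hT.sameDir_symm h2)) hab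

theorem exists_mid (hab : a ≠ b) : ∃ m ∈ seg a b, dist a m = dist m b ∧ m ≠ a ∧ m ≠ b := by
  have h0 := dist_pos.2 hab
  obtain ⟨m, hm, hd⟩ := hT.exists_mem_seg a b (t := dist a b / 2) (by positivity) (by linarith)
  have hm' := mem_seg.1 hm
  refine ⟨m, hm, by linarith, ?_, ?_⟩
  · rintro rfl
    simp at hd
    linarith
  · rintro rfl
    simp at hm'
    linarith

variable (hV : TwoDirs V)
include hV

/-- A point outside an edge is separated from it by one of the end points. -/
theorem edge_trichotomy (h : IsEdge V a b) (y : T) :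
    y ∈ seg a b ∨ a ∈ seg y b ∨ b ∈ seg y a := by
  obtain ⟨m, hm, hby, hay⟩ := hT.exists_center a b y
  by_cases hmV : m ∈ V
  · rcases h.eq_or_eq hmV hm with rfl | rfl
    · exact Or.inr (Or.inl (mem_seg_comm.1 hby))
    · exact Or.inr (Or.inr (mem_seg_comm.1 hay))
  · have ha : a ≠ m := fun e => hmV (e ▸ h.1)
    have hb : b ≠ m := fun e => hmV (e ▸ h.2.1)
    by_cases hy : y = m
    · exact Or.inl (hy ▸ hm)
    · rcases hT.sameDir_or_of_twoDirs hm ha hb (hV m hmV) hy with h1 | h1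
      · exact absurd (hT.sameDir_symm h1) (hT.not_sameDir_iff.2 hay)
      · exact absurd (hT.sameDir_symm h1) (hT.not_sameDir_iff.2 hby)

theorem edge_gate (h : IsEdge V a b) (hm : m ∈ seg a b) (y : T) :
    y ∈ seg a b ∨ a ∈ seg y m ∨ b ∈ seg y m := by
  rcases hT.edge_trichotomy hV h y with h1 | h1 | h1
  · exact Or.inl h1
  · exact Or.inr (Or.inl (seg_of_ends hm h1))
  · exact Or.inr (Or.inr (seg_of_ends (mem_seg_comm.1 hm) h1))

theorem edge_unique (h : IsEdge V a b) (h' : IsEdge V c d) (hm : m ∉ V) (h1 : m ∈ seg a b)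
    (h2 : m ∈ seg c d) : (c = a ∧ d = b) ∨ (c = b ∧ d = a) := by
  have key : ∀ {c d : T}, IsEdge V c d → m ∈ seg c d → c = a ∨ c = b := by
    intro c d h' h2
    have key' : ∀ {a : T}, a ∈ V → a ∈ seg c m → c = a := fun {a} ha hac => by
      obtain ⟨h3, h4⟩ := seg_trans h2 hac
      rcases h'.eq_or_eq ha h3 with h5 | h5
      · exact h5.symm
      · subst h5
        have : m = a := by simpa [mem_seg, dist_comm m a, eq_comm] using h4
        exact absurd ha (this ▸ hm)
    rcases hT.edge_gate hV h h1 c with h3 | h3 | h3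
    · exact h.eq_or_eq h'.1 h3
    · exact Or.inl (key' h.1 h3)
    · exact Or.inr (key' h.2.1 h3)
  have hne := h'.2.2.1
  rcases key h' h2 with rfl | rfl <;> rcases key h'.symm (mem_seg_comm.1 h2) with rfl | rfl <;>
    simp_all

/-- Two edges with a common initial direction coincide. -/
theorem edge_eq_of_sameDir (h : IsEdge V a b) (h' : IsEdge V a c) (hd : SameDir a b c) :
    b = c := by
  obtain ⟨w, hw, heq⟩ := hd
  have hwm : w ∈ seg a b ∩ seg a c := heq ▸ right_mem_seg a w
  by_cases hwV : w ∈ V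
  · have h1 := (h.eq_or_eq hwV hwm.1).resolve_left hw
    have h2 := (h'.eq_or_eq hwV hwm.2).resolve_left hw
    exact h1.symm.trans h2
  · rcases hT.edge_unique hV h h' hwV hwm.1 hwm.2 with h1 | h1
    · exact h1.2.symm
    · exact absurd h1.1 h.2.2.1

variable (hL : LocFin V) (hE : ∀ x, x ∉ V → ∃ a b, IsEdge V a b ∧ x ∈ seg a b)
include hL hE

/-- Every nondegenerate segment starts inside an edge. -/
theorem exists_edge_initial (hxy : x ≠ y) :
    ∃ a b w, IsEdge V a b ∧ x ∈ seg a b ∧ w ∈ seg a b ∧ w ∈ seg x y ∧ w ≠ x := by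
  obtain ⟨r, hr, h⟩ := hL x
  have h0 := dist_pos.2 hxy
  obtain ⟨w, hw, hd⟩ := hT.exists_mem_seg x y (t := min (r / 2) (dist x y))
    (by positivity) (min_le_right _ _)
  have hwr : dist w x < r := by
    rw [dist_comm, hd]
    exact (min_le_left _ _).trans_lt (by linarith)
  have hwx : w ≠ x := by
    rintro rfl
    rw [dist_self] at hd
    have : 0 < min (r / 2) (dist w y) := by positivity
    linarith
  have hwV : w ∉ V := fun hwV => hwx (h w hwV hwr)
  obtain ⟨a, b, hab, hwab⟩ := hE w hwV
  refine ⟨a, b, w, hab, ?_, hwab, hw, hwx⟩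
  have key : ∀ {a : T}, a ∈ V → a ∈ seg x w → a = x := fun {a} ha haw => by
    refine h a ha ?_
    rw [mem_seg, dist_comm x w, dist_comm x a] at haw
    linarith [dist_nonneg (x := a) (y := w)]
  rcases hT.edge_gate hV hab hwab x with h1 | h1 | h1
  · exact h1
  · rw [← key hab.1 h1]; exact left_mem_seg _ _
  · rw [← key hab.2.1 h1]; exact right_mem_seg _ _

theorem exists_next_vertex (hx : x ∈ V) (hy : y ∈ V) (hxy : x ≠ y) :
    ∃ b, IsEdge V x b ∧ b ∈ seg x y := by
  obtain ⟨a, b, w, hab, hxab, hwab, hwxy, hwx⟩ := hT.exists_edge_initial hV hL hE hxy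
  wlog hxa : x = a generalizing a b
  · have hxb := (hab.eq_or_eq hx hxab).resolve_left hxa
    exact this b a hab.symm (mem_seg_comm.1 hxab) (mem_seg_comm.1 hwab) hxb
  subst hxa
  refine ⟨b, hab, ?_⟩
  rcases hT.edge_trichotomy hV hab y with h | h | h
  · rw [(hab.eq_or_eq hy h).resolve_left hxy.symm]
    exact right_mem_seg _ _
  · exact absurd (hT.sameDir_of_mem hwx hwxy hwab) (hT.not_sameDir_iff.2 h)
  · exact mem_seg_comm.1 h

end IsRTree

end Vertices

section Actions

variable {G : Type*} [Group G] {T : Type*} [MetricSpace T] [MulAction G T]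
  {V : Set T} {a b c d m w x y z : T}

namespace IsGTree

variable (hT : IsGTree G T)
include hT

theorem smul_mem_seg (g : G) : g • z ∈ seg (g • x) (g • y) ↔ z ∈ seg x y := by
  simp only [mem_seg, hT.dist_smul]

theorem isEdge_smul (hV : ∀ (g : G), ∀ x ∈ V, g • x ∈ V) (g : G) (h : IsEdge V a b) :
    IsEdge V (g • a) (g • b) := by
  refine ⟨hV g a h.1, hV g b h.2.1, fun e => h.2.2.1 (MulAction.injective g e), ?_⟩
  ext z
  constructor
  · rintro ⟨h1, h2⟩
    have h3 : g⁻¹ • z ∈ seg a b := by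
      rw [← hT.smul_mem_seg g, smul_inv_smul]
      exact h1
    rcases h.eq_or_eq (hV g⁻¹ z h2) h3 with h4 | h4
    · left; rw [← h4, smul_inv_smul]
    · right; rw [Set.mem_singleton_iff, ← h4, smul_inv_smul]
  · rintro (rfl | rfl)
    · exact ⟨left_mem_seg _ _, hV g _ h.1⟩
    · exact ⟨right_mem_seg _ _, hV g _ h.2.1⟩

/-- An invariant closed discrete set with two directions at every point outside it is a
vertex set as soon as no group element can invert an edge. -/
theorem isVertexSet_of (hne : V.Nonempty) (hV : ∀ (g : G), ∀ x ∈ V, g • x ∈ V)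
    (hL : LocFin V) (hD : TwoDirs V) (hE : ∀ x, x ∉ V → ∃ a b, IsEdge V a b ∧ x ∈ seg a b)
    (hO : ∀ a b, IsEdge V a b → b ∉ MulAction.orbit G a) : IsVertexSet G V where
  nonempty := hne
  smul_mem := hV
  isClosed := hL.isClosed
  isDiscrete := hL.discreteTopology
  exists_edge := hE
  mem_of_not_ordinary x hx := by
    by_contra hxV
    refine hx ⟨hD x hxV, ?_⟩
    rintro ⟨y, z, ⟨hy, hz, hyz, hall⟩, g, hgx, hgy, hgz⟩
    obtain ⟨a, b, hab, hxab⟩ := hE x hxV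
    have hR := hT.isRTree
    have ha : a ≠ x := fun e => hxV (e ▸ hab.1)
    have hb : b ≠ x := fun e => hxV (e ▸ hab.2.1)
    have hga : ¬ SameDir x a b := hR.not_sameDir_iff.2 hxab
    have hg := hT.isEdge_smul hV g hab
    have hsmul : ∀ {p q}, SameDir x p q → SameDir x (g • p) (g • q) := fun {p q} h => by
      rw [hR.sameDir_iff] at h ⊢
      have e1 := hT.dist_smul g x p
      have e2 := hT.dist_smul g x q
      rw [hgx] at e1 e2
      rwa [hT.dist_smul, e1, e2]
    have hxg : x ∈ seg (g • a) (g • b) := by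
      have := (hT.smul_mem_seg g).2 hxab
      rwa [hgx] at this
    rcases hR.edge_unique hD hab hg hxV hxab hxg with ⟨h1, -⟩ | ⟨h1, -⟩
    · -- the direction of `a` is preserved, so it is neither that of `y` nor that of `z`
      have haa : ∀ {p q}, SameDir x a p → SameDir x (g • p) q → SameDir x p q := fun {p q} h h' => by
        have := hsmul h
        rw [h1] at this
        exact hR.sameDir_trans (hR.sameDir_symm h) (hR.sameDir_trans this h')
      rcases hall a ha with h | h
      · exact hyz (haa h hgy)
      · exact hyz (hR.sameDir_symm (haa h hgz))
    · exact hO a b hab ⟨g, h1⟩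

end IsGTree

namespace IsVertexSet

variable (hV : IsVertexSet G V)

section
include hV

theorem locFin : LocFin V := locFin_of_isClosed hV.isClosed hV.isDiscrete

theorem twoDirs : TwoDirs V := fun x hx => by
  by_contra h
  exact hx (hV.mem_of_not_ordinary x fun h' => h h'.1)

theorem smul_mem_iff (g : G) : g • x ∈ V ↔ x ∈ V :=
  ⟨fun h => by simpa using hV.smul_mem g⁻¹ _ h, hV.smul_mem g x⟩

end

variable (hT : IsGTree G T)
include hV hT

/-- Group elements do not invert edges: the midpoint would be a point of reflection. -/
theorem no_inversion (h : IsEdge V a b) (g : G) (h1 : g • a = b) (h2 : g • b = a) : False := by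
  have hR := hT.isRTree
  obtain ⟨m, hm, hd, hma, hmb⟩ := hR.exists_mid h.2.2.1
  have hmV : m ∉ V := fun hmV => (h.eq_or_eq hmV hm).elim hma hmb
  have hgm : g • m = m := by
    have h3 := (hT.smul_mem_seg g).2 hm
    rw [h1, h2, mem_seg_comm] at h3
    refine hR.eq_of_mem_seg h3 hm ?_
    rw [← h2, hT.dist_smul, h2, hd, dist_comm]
  refine hmV (hV.mem_of_not_ordinary m fun hord => hord.2 ⟨a, b, ⟨hma.symm, hmb.symm,
    hR.not_sameDir_iff.2 hm, fun w hw => ?_⟩, g, hgm, ?_, ?_⟩)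
  · exact hR.sameDir_or_of_twoDirs hm hma.symm hmb.symm (hV.twoDirs m hmV) hw
  · rw [h1]; exact hR.sameDir_of_mem hmb.symm (right_mem_seg _ _) (right_mem_seg _ _)
  · rw [h2]; exact hR.sameDir_of_mem hma.symm (right_mem_seg _ _) (right_mem_seg _ _)

/-- The orbit of a point is closed and discrete. -/
theorem locFin_orbit (hz : z ∉ V) : LocFin (MulAction.orbit G z) := by
  have hR := hT.isRTree
  obtain ⟨δ, hδ, h⟩ := hV.locFin z
  refine locFin_of_separated hδ ?_
  rintro _ ⟨g, rfl⟩ _ ⟨k, rfl⟩ hd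
  simp only at hd ⊢
  obtain ⟨a, b, hab, hgz⟩ := hV.exists_edge (g • z) (by rwa [hV.smul_mem_iff])
  have hkz : k • z ∈ seg a b := by
    have key : ∀ {a}, a ∈ V → a ∉ seg (k • z) (g • z) := fun {a} ha hm => by
      refine hz ?_
      rw [← h (g⁻¹ • a) (hV.smul_mem _ _ ha) ?_]
      · exact hV.smul_mem _ _ ha
      · rw [← hT.dist_smul g, smul_inv_smul]
        rw [mem_seg, dist_comm (k • z) (g • z)] at hm
        linarith [dist_nonneg (x := k • z) (y := a)]
    rcases hR.edge_gate hV.twoDirs hab hgz (k • z) with h1 | h1 | h1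
    · exact h1
    · exact absurd h1 (key hab.1)
    · exact absurd h1 (key hab.2.1)
  have he := hT.isEdge_smul hV.smul_mem (k * g⁻¹) hab
  have hm := (hT.smul_mem_seg (k * g⁻¹)).2 hgz
  have hmul : (k * g⁻¹) • g • z = k • z := by rw [smul_smul, inv_mul_cancel_right]
  rw [hmul] at hm
  rcases hR.edge_unique hV.twoDirs hab he (by rwa [hV.smul_mem_iff]) hkz hm with ⟨h1, -⟩ | ⟨h1, h2⟩
  · refine hR.eq_of_mem_seg hgz hkz ?_
    rw [← hT.dist_smul (k * g⁻¹), h1, hmul]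
  · exact (hV.no_inversion hT hab _ h1 h2).elim

/-- Adding an invariant set of points to the vertices, so that the result is still locally finite,
only subdivides the edges. -/
theorem refine {V' : Set T} (hsub : V ⊆ V') (hinv : ∀ (g : G), ∀ x ∈ V', g • x ∈ V')
    (hL : LocFin V') : IsVertexSet G V' where
  nonempty := hV.nonempty.mono hsub
  smul_mem := hinv
  isClosed := hL.isClosed
  isDiscrete := hL.discreteTopology
  mem_of_not_ordinary x hx := hsub (hV.mem_of_not_ordinary x hx)
  exists_edge x hx := by
    have hR := hT.isRTree
    obtain ⟨a, b, hab, hxab⟩ := hV.exists_edge x fun h => hx (hsub h)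
    -- the points of the finer vertex set next to `x` on the two sides
    have key : ∀ a ∈ V, ∃ c ∈ V', c ∈ seg x a ∧ ∀ z ∈ V', z ∈ seg x c → z = c := fun a ha => by
      obtain ⟨c, ⟨hc, hc'⟩, hmin⟩ := ((hR.isCompact_seg x a).inter_left hL.isClosed).exists_isMinOn
        ⟨a, hsub ha, right_mem_seg _ _⟩ (f := dist x) (by fun_prop)
      refine ⟨c, hc, hc', fun z hz hzc => ?_⟩
      have h1 : dist x c ≤ dist x z := hmin ⟨hz, (seg_trans hc' hzc).1⟩
      rw [mem_seg] at hzc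
      exact dist_le_zero.1 (by linarith)
    obtain ⟨c, hc, hxc, hc'⟩ := key a hab.1
    obtain ⟨d, hd, hxd, hd'⟩ := key b hab.2.1
    have hxcd : x ∈ seg c d := by
      have h1 := (seg_trans hxab (mem_seg_comm.1 hxc)).2
      exact (seg_trans_right h1 hxd).2
    refine ⟨c, d, ⟨hc, hd, ?_, ?_⟩, hxcd⟩
    · rintro rfl
      have : x = c := by simpa [mem_seg, dist_comm c x] using hxcd
      exact hx (this ▸ hc)
    · ext z
      constructor
      · rintro ⟨hz, hzV⟩
        rcases hR.mem_seg_split hxcd hz with h | h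
        · exact Or.inl (hc' z hzV (mem_seg_comm.1 h))
        · exact Or.inr (hd' z hzV h)
      · rintro (rfl | rfl)
        · exact ⟨left_mem_seg _ _, hc⟩
        · exact ⟨right_mem_seg _ _, hd⟩

/-- An edge of a finer vertex set lies in an edge of the coarser one. -/
theorem exists_edge_supset {V' : Set T} (hsub : V ⊆ V') (h : IsEdge V' c d) :
    ∃ a b, IsEdge V a b ∧ c ∈ seg a b ∧ d ∈ seg a b := by
  have hR := hT.isRTree
  obtain ⟨m, hm, -, hmc, hmd⟩ := hR.exists_mid h.2.2.1
  have hmV : m ∉ V' := fun hmV => (h.eq_or_eq hmV hm).elim hmc hmd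
  obtain ⟨a, b, hab, hmab⟩ := hV.exists_edge m fun h => hmV (hsub h)
  refine ⟨a, b, hab, ?_⟩
  have key : ∀ {c d}, IsEdge V' c d → m ∈ seg c d → c ∈ seg a b := fun {c d} h hm => by
    have key' : ∀ {a}, a ∈ V → a ∈ seg c m → c = a := fun {a} ha hac => by
      obtain ⟨h3, h4⟩ := seg_trans hm hac
      rcases h.eq_or_eq (hsub ha) h3 with h5 | h5
      · exact h5.symm
      · subst h5
        have : m = a := by simpa [mem_seg, dist_comm m a, eq_comm] using h4
        exact absurd (hsub ha) (this ▸ hmV)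
    rcases hR.edge_gate hV.twoDirs hab hmab c with h1 | h1 | h1
    · exact h1
    · rw [key' hab.1 h1]; exact left_mem_seg _ _
    · rw [key' hab.2.1 h1]; exact right_mem_seg _ _
  exact ⟨key h hm, key h.symm (mem_seg_comm.1 hm)⟩

theorem exists_finset_edges {V' : Set T} (hsub : V ⊆ V') (hL : LocFin V')
    (hinv : ∀ (g : G), ∀ x ∈ V', g • x ∈ V') {F : Set (T × T)} (hF : F.Finite)
    (h : ∀ a b, IsEdge V a b → ∃ g : G, (g • a, g • b) ∈ F) :
    ∃ F' : Finset (T × T), ∀ a b, IsEdge V' a b → ∃ g : G, (g • a, g • b) ∈ F' := by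
  classical
  have hR := hT.isRTree
  have hfin : (⋃ p ∈ F, (V' ∩ seg p.1 p.2) ×ˢ (V' ∩ seg p.1 p.2)).Finite :=
    hF.biUnion fun p _ => (hL.finite_inter (hR.isCompact_seg _ _)).prod
      (hL.finite_inter (hR.isCompact_seg _ _))
  refine ⟨hfin.toFinset, fun c d hcd => ?_⟩
  obtain ⟨a, b, hab, hc, hd⟩ := hV.exists_edge_supset hT hsub hcd
  obtain ⟨g, hg⟩ := h a b hab
  refine ⟨g, ?_⟩
  rw [Set.Finite.mem_toFinset]
  refine Set.mem_biUnion hg ⟨⟨hinv g c hcd.1, ?_⟩, hinv g d hcd.2.1, ?_⟩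
  · exact (hT.smul_mem_seg g).2 hc
  · exact (hT.smul_mem_seg g).2 hd

/-- Refining the vertex set does not change the edge stabilizers: an element which fixes two
points of an edge fixes the edge. -/
theorem edgeStabilizer_eq (hab : IsEdge V a b) (hc : c ∈ seg a b) (hd : d ∈ seg a b)
    {m : T} (hm : m ∈ seg a b) (hmV : m ∉ V) (hmcd : m ∈ seg c d) :
    edgeStabilizer G c d = edgeStabilizer G a b := by
  have hR := hT.isRTree
  ext g
  simp only [edgeStabilizer, Subgroup.mem_inf, MulAction.mem_stabilizer_iff]
  constructor
  · rintro ⟨hgc, hgd⟩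
    have hgm : g • m = m := by
      have h3 := (hT.smul_mem_seg g).2 hmcd
      rw [hgc, hgd] at h3
      refine hR.eq_of_mem_seg h3 hmcd ?_
      conv_lhs => rw [← hgc]
      rw [hT.dist_smul]
    have h3 := (hT.smul_mem_seg g).2 hm
    rw [hgm] at h3
    rcases hR.edge_unique hV.twoDirs hab (hT.isEdge_smul hV.smul_mem g hab) hmV hm h3 with h | h
    · exact h
    · exact (hV.no_inversion hT hab g h.1 h.2).elim
  · rintro ⟨hga, hgb⟩
    have key : ∀ {p}, p ∈ seg a b → g • p = p := fun {p} hp => by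
      have h3 := (hT.smul_mem_seg g).2 hp
      rw [hga, hgb] at h3
      refine hR.eq_of_mem_seg h3 hp ?_
      conv_lhs => rw [← hga]
      rw [hT.dist_smul]
    exact ⟨key hc, key hd⟩

end IsVertexSet

end Actions

/-! ### Morphisms and folded points -/

section Morphisms

variable {S T : Type*} [MetricSpace S] [MetricSpace T] {p q x y z w : S}

/-- Induction along a segment, for a property which is preserved by limits from the left and
spreads to the right. -/
theorem IsRTree.seg_induction (hS : IsRTree S) (P : S → Prop) (x y : S) (h0 : P x)
    (hlim : ∀ z ∈ seg x y, z ≠ x → (∀ ε > 0, ∃ p ∈ seg x z, dist p z < ε ∧ P p) → P z)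
    (hstep : ∀ z ∈ seg x y, z ≠ y → P z → ∃ w ∈ seg z y, w ≠ z ∧ P w) : P y := by
  let A : Set ℝ := {t | ∃ z ∈ seg x y, dist x z = t ∧ P z}
  have hA0 : A.Nonempty := ⟨0, x, left_mem_seg _ _, dist_self x, h0⟩
  have hAb : BddAbove A := ⟨dist x y, by
    rintro _ ⟨z, hz, rfl, -⟩
    rw [mem_seg] at hz
    linarith [dist_nonneg (x := z) (y := y)]⟩
  have hs0 : 0 ≤ sSup A := le_csSup hAb ⟨x, left_mem_seg _ _, dist_self x, h0⟩
  have hs1 : sSup A ≤ dist x y := csSup_le hA0 (by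
    rintro _ ⟨z, hz, rfl, -⟩
    rw [mem_seg] at hz
    linarith [dist_nonneg (x := z) (y := y)])
  obtain ⟨z, hz, hd⟩ := hS.exists_mem_seg x y hs0 hs1
  have hPz : P z := by
    by_cases hzx : z = x
    · exact hzx ▸ h0
    · refine hlim z hz hzx fun ε hε => ?_
      obtain ⟨_, ⟨p, hp, rfl, hP⟩, hlt⟩ := exists_lt_of_lt_csSup hA0 (sub_lt_self (sSup A) hε)
      have hle : dist x p ≤ dist x z := hd ▸ le_csSup hAb ⟨p, hp, rfl, hP⟩
      have hpz := hS.mem_seg_of_dist_le hp hz hle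
      refine ⟨p, hpz, ?_, hP⟩
      rw [mem_seg] at hpz
      linarith
  by_contra hPy
  obtain ⟨w, hw, hwz, hPw⟩ := hstep z hz (fun h => hPy (h ▸ hPz)) hPz
  obtain ⟨h1, h2⟩ := seg_trans_right hz hw
  have h3 : dist x w ≤ sSup A := le_csSup hAb ⟨w, h1, rfl, hPw⟩
  rw [mem_seg] at h2
  linarith [dist_pos.2 hwz.symm]

variable {f : S → T}

/-- The metric half of the definition of a morphism. -/
def LocallyIsometric (f : S → T) : Prop := ∀ x y : S, x ≠ y → ∃ w ∈ seg x y, w ≠ x ∧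
  ∀ a ∈ seg x w, ∀ b ∈ seg x w, dist (f a) (f b) = dist a b

variable (hS : IsRTree S) (hf : LocallyIsometric f)
include hS hf

theorem LocallyIsometric.dist_le (x y : S) : dist (f x) (f y) ≤ dist x y := by
  refine hS.seg_induction (fun z => dist (f x) (f z) ≤ dist x z) x y (by simp) ?_ ?_
  · intro z hz hzx h
    obtain ⟨w, hw, hwz, hiso⟩ := hf z x hzx
    obtain ⟨p, hp, hpz, hP⟩ := h (dist w z) (dist_pos.2 hwz)
    have hpw : p ∈ seg z w := by
      refine hS.mem_seg_of_dist_le (mem_seg_comm.1 hp) hw ?_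
      rw [dist_comm z p, dist_comm z w]
      exact hpz.le
    have h1 := hiso p hpw z (left_mem_seg _ _)
    rw [mem_seg] at hp
    linarith [dist_triangle (f x) (f p) (f z)]
  · intro z hz hzy hP
    obtain ⟨w, hw, hwz, hiso⟩ := hf z y hzy
    refine ⟨w, hw, hwz, ?_⟩
    have h1 := hiso z (left_mem_seg _ _) w (right_mem_seg _ _)
    have h2 := (seg_trans_right hz hw).2
    rw [mem_seg] at h2
    linarith [dist_triangle (f x) (f z) (f w)]

/-- If the end points of a segment keep their distance, the whole segment is embedded. -/
theorem LocallyIsometric.dist_eq_of_mem (h : dist (f x) (f y) = dist x y) (hz : z ∈ seg x y) :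
    dist (f x) (f z) = dist x z ∧ dist (f z) (f y) = dist z y := by
  have h1 := hf.dist_le hS x z
  have h2 := hf.dist_le hS z y
  have h3 := dist_triangle (f x) (f z) (f y)
  rw [mem_seg] at hz
  constructor <;> linarith

/-- A segment which is not mapped isometrically contains an interior point `m` at which it is
folded. -/
theorem LocallyIsometric.exists_fold (hT : IsRTree T) (h : dist (f p) (f q) ≠ dist p q) :
    ∃ m ∈ seg p q, m ≠ p ∧ m ≠ q ∧ dist (f p) (f m) = dist p m ∧
      ∀ w ∈ seg m p, w ≠ m → ∀ w' ∈ seg m q, w' ≠ m → dist (f w) (f w') ≠ dist w w' := by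
  by_contra hcon
  push Not at hcon
  refine h (hS.seg_induction (fun z => dist (f p) (f z) = dist p z) p q (by simp) ?_ ?_)
  · intro z hz hzx h
    refine le_antisymm (hf.dist_le hS p z) (le_of_forall_pos_le_add fun ε hε => ?_)
    obtain ⟨r, hr, hrz, hP⟩ := h (ε / 2) (by positivity)
    have h1 := hf.dist_le hS r z
    rw [mem_seg] at hr
    linarith [dist_triangle_right (f p) (f r) (f z)]
  · intro z hz hzq hP
    by_cases hzp : z = p
    · subst hzp
      obtain ⟨w, hw, hwz, hiso⟩ := hf z q hzq
      exact ⟨w, hw, hwz, hiso z (left_mem_seg _ _) w (right_mem_seg _ _)⟩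
    · obtain ⟨w, hw, hwz, w', hw', hwz', hd⟩ := hcon z hz hzp hzq hP
      refine ⟨w', hw', hwz', ?_⟩
      rw [mem_seg_comm] at hw
      have hzw : z ∈ seg w w' := (seg_trans_right (seg_trans hz hw).2 hw').2
      obtain ⟨h1, h2⟩ := hf.dist_eq_of_mem hS hd hzw
      obtain ⟨h3, h4⟩ := hf.dist_eq_of_mem hS hP hw
      have h5 : f w ∈ seg (f p) (f z) := by
        rw [mem_seg] at hw ⊢
        linarith
      have h6 : f z ∈ seg (f w) (f w') := by
        rw [mem_seg] at hzw ⊢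
        linarith
      have h7 : f w ≠ f z := by
        rw [← dist_pos, h1]
        exact dist_pos.2 hwz
      have h8 := (hT.seg_concat h5 h6 h7).2
      have h9 := (seg_trans_right hz hw').2
      rw [mem_seg] at h8 h9
      linarith

end Morphisms

section Simplicial

variable {G : Type*} [Group G] {S : Type*} [MetricSpace S] [MulAction G S]
variable {H : Type*} [Group H] {T : Type*} [MetricSpace T] [MulAction H T]

/-- An equivariant simplicial map from the `G`-tree `S` with vertex set `V` to the `H`-tree `T` with
vertex set `W`, which is isometric on edges.  The end points of an edge of `T` are required to lie
in different orbits; this holds after passing to a barycentric subdivision. -/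
structure IsSimplicialMap (V : Set S) (W : Set T) (fhom : G →* H) (f : S → T) : Prop where
  source : IsGTree G S
  target : IsGTree H T
  vertices : IsVertexSet G V
  target_vertices : IsVertexSet H W
  map_smul : ∀ (g : G) (x : S), f (g • x) = fhom g • f x
  mem_iff : ∀ x, f x ∈ W ↔ x ∈ V
  map_edge : ∀ a b, IsEdge V a b → IsEdge W (f a) (f b)
  isometric : ∀ a b, IsEdge V a b → ∀ p ∈ seg a b, ∀ q ∈ seg a b, dist (f p) (f q) = dist p q
  not_mem_orbit : ∀ c d, IsEdge W c d → d ∉ MulAction.orbit H c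

namespace IsSimplicialMap

variable {V : Set S} {W : Set T} {fhom : G →* H} {f : S → T} (D : IsSimplicialMap V W fhom f)
include D

theorem locallyIsometric : LocallyIsometric f := fun x y hxy => by
  obtain ⟨a, b, w, hab, hx, hw, hwy, hwx⟩ := D.source.isRTree.exists_edge_initial
    D.vertices.twoDirs D.vertices.locFin D.vertices.exists_edge hxy
  have hsub := D.source.isRTree.seg_subset hx hw
  exact ⟨w, hwy, hwx, fun p hp q hq => D.isometric a b hab p (hsub hp) q (hsub hq)⟩

theorem dist_le (x y : S) : dist (f x) (f y) ≤ dist x y :=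
  D.locallyIsometric.dist_le D.source.isRTree x y

theorem dist_edge {a b : S} (h : IsEdge V a b) : dist (f a) (f b) = dist a b :=
  D.isometric a b h a (left_mem_seg _ _) b (right_mem_seg _ _)

theorem map_mem_seg {a b x : S} (h : IsEdge V a b) (hx : x ∈ seg a b) : f x ∈ seg (f a) (f b) := by
  rw [mem_seg, D.isometric a b h a (left_mem_seg _ _) x hx, D.dist_edge h,
    D.isometric a b h x hx b (right_mem_seg _ _)]
  exact hx

theorem exists_of_mem_seg {a b : S} {z : T} (h : IsEdge V a b) (hz : z ∈ seg (f a) (f b)) :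
    ∃ c ∈ seg a b, f c = z := by
  have h1 : dist (f a) z ≤ dist a b := by
    rw [← D.dist_edge h, ← mem_seg.1 hz]
    linarith [dist_nonneg (x := z) (y := f b)]
  obtain ⟨c, hc, hd⟩ := D.source.isRTree.exists_mem_seg a b dist_nonneg h1
  refine ⟨c, hc, D.target.isRTree.eq_of_mem_seg (D.map_mem_seg h hc) hz ?_⟩
  rw [← hd]
  exact D.isometric a b h a (left_mem_seg _ _) c hc

theorem not_mem_orbit_source {a b : S} (h : IsEdge V a b) : b ∉ MulAction.orbit G a := by
  rintro ⟨g, rfl⟩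
  refine D.not_mem_orbit _ _ (D.map_edge _ _ h) ⟨fhom g, ?_⟩
  exact (D.map_smul g a).symm

theorem eq_of_map_eq {a b x y : S} (h : IsEdge V a b) (hx : x ∈ seg a b) (hy : y ∈ seg a b)
    (hxy : f x = f y) : x = y := by
  rw [← dist_eq_zero, ← D.isometric a b h x hx y hy, hxy, dist_self]

/-- A segment which is not mapped isometrically is folded at a vertex: it passes there through
two different edges with the same image. -/
theorem exists_fold {p q : S} (h : dist (f p) (f q) ≠ dist p q) :
    ∃ m ∈ V, m ∈ seg p q ∧ m ≠ p ∧ m ≠ q ∧ dist (f p) (f m) = dist p m ∧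
      ∃ b b', IsEdge V m b ∧ IsEdge V m b' ∧ b ≠ b' ∧ f b = f b' ∧
        SameDir m b p ∧ SameDir m b' q := by
  have hS := D.source.isRTree
  have hT := D.target.isRTree
  obtain ⟨m, hm, hmp, hmq, hd, hfold⟩ := D.locallyIsometric.exists_fold hS hT h
  obtain ⟨a, b, w, hab, hmab, hw, hwp, hwm⟩ := hS.exists_edge_initial
    D.vertices.twoDirs D.vertices.locFin D.vertices.exists_edge hmp
  obtain ⟨a', b', w', hab', hmab', hw', hwq, hwm'⟩ := hS.exists_edge_initial
    D.vertices.twoDirs D.vertices.locFin D.vertices.exists_edge hmq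
  have hne := hfold w hwp hwm w' hwq hwm'
  have hmV : m ∈ V := by
    by_contra hmV
    have hw'' : w' ∈ seg a b := by
      rcases hS.edge_unique D.vertices.twoDirs hab hab' hmV hmab hmab' with ⟨rfl, rfl⟩ | ⟨rfl, rfl⟩
      · exact hw'
      · exact mem_seg_comm.1 hw'
    exact hne (D.isometric a b hab w hw w' hw'')
  refine ⟨m, hmV, hm, hmp, hmq, hd, ?_⟩
  wlog hma : m = a generalizing a b
  · exact this b a hab.symm (mem_seg_comm.1 hmab) (mem_seg_comm.1 hw)
      ((hab.eq_or_eq hmV hmab).resolve_left hma)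
  subst hma
  wlog hma' : m = a' generalizing a' b'
  · exact this b' a' hab'.symm (mem_seg_comm.1 hmab') (mem_seg_comm.1 hw')
      ((hab'.eq_or_eq hmV hmab').resolve_left hma')
  subst hma'
  refine ⟨b, b', hab, hab', ?_, ?_, hS.sameDir_of_mem hwm hw hwp, hS.sameDir_of_mem hwm' hw' hwq⟩
  · rintro rfl
    exact hne (D.isometric m b hab w hw w' hw')
  · by_contra hbb
    have h1 : f m ∈ seg (f b) (f b') := hT.not_sameDir_iff.1 fun hs =>
      hbb (hT.edge_eq_of_sameDir D.target_vertices.twoDirs (D.map_edge _ _ hab)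
        (D.map_edge _ _ hab') hs)
    have h2 := D.map_mem_seg hab hw
    have h3 := D.map_mem_seg hab' hw'
    have h4 := (seg_trans_right (seg_trans h1 (mem_seg_comm.1 h2)).2 h3).2
    have hmw : m ∈ seg w w' := by
      have h5 := (seg_trans hm (mem_seg_comm.1 hwp)).2
      exact (seg_trans_right h5 hwq).2
    refine hne ?_
    rw [← mem_seg.1 h4, ← mem_seg.1 hmw,
      D.isometric m b hab w hw m (left_mem_seg _ _), D.isometric m b' hab' m (left_mem_seg _ _) w' hw']

/-- A segment between two different vertices with the same image contains two consecutive
edges with the same image. -/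
theorem exists_backtrack {p q : S} (hp : p ∈ V) (hq : q ∈ V) (hpq : p ≠ q) (h : f p = f q) :
    ∃ m b b', IsEdge V m b ∧ IsEdge V m b' ∧ b ≠ b' ∧ f b = f b' ∧
      dist p q = dist p b + dist b m + dist m b' + dist b' q := by
  have hS := D.source.isRTree
  have hne : dist (f p) (f q) ≠ dist p q := by
    rw [h, dist_self]
    exact (dist_pos.2 hpq).ne
  obtain ⟨m, hmV, hm, hmp, hmq, -, b, b', hb, hb', hbb, hf, hbp, hbq⟩ := D.exists_fold hne
  have key : ∀ {b p}, IsEdge V m b → p ∈ V → m ≠ p → SameDir m b p → b ∈ seg m p := by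
    intro b p hb hp hmp hs
    obtain ⟨c, hc, hc'⟩ := hS.exists_next_vertex D.vertices.twoDirs D.vertices.locFin
      D.vertices.exists_edge hmV hp hmp
    have : SameDir m b c := hS.sameDir_trans hs (hS.sameDir_symm (hS.sameDir_of_mem
      hc.2.2.1.symm (right_mem_seg _ _) hc'))
    rw [hS.edge_eq_of_sameDir D.vertices.twoDirs hb hc this]
    exact hc'
  refine ⟨m, b, b', hb, hb', hbb, hf, ?_⟩
  have h1 := mem_seg.1 (key hb hp hmp hbp)
  have h2 := mem_seg.1 (key hb' hq hmq hbq)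
  have h3 := mem_seg.1 hm
  rw [dist_comm p m] at h3
  rw [dist_comm p b, dist_comm b m]
  linarith

/-- Near the fibre over `z`, every point `x` has a unique nearest point in the fibre, and
different points of the fibre are far from each other. -/
theorem exists_radius (z : T) : ∃ δ > 0,
    (∀ x, dist (f x) z < δ → ∃ c, f c = z ∧ dist x c = dist (f x) z ∧ (x ∈ V → c = x) ∧
      ∀ a b, IsEdge V a b → x ∈ seg a b → x ∉ V → c ∈ seg a b) ∧
    ∀ c c', f c = z → f c' = z → dist c c' < 3 * δ → c = c' := by
  have hS := D.source.isRTree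
  have hT := D.target.isRTree
  obtain ⟨r, hr, hL⟩ := D.target_vertices.locFin z
  refine ⟨r / 4, by positivity, fun x hx => ?_, fun c c' hc hc' hd => ?_⟩
  · by_cases hxV : x ∈ V
    · have hxz := hL _ ((D.mem_iff x).2 hxV) (by linarith)
      exact ⟨x, hxz, by rw [hxz, dist_self, dist_self], fun _ => rfl,
        fun a b _ _ h => absurd hxV h⟩
    · have key : ∀ a b, IsEdge V a b → x ∈ seg a b →
          ∃ c ∈ seg a b, f c = z ∧ dist x c = dist (f x) z := by
        intro a b hab hxab
        have key' : ∀ a, a ∈ V → f a ∈ seg z (f x) → f a = z := fun a ha h => by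
          refine hL _ ((D.mem_iff a).2 ha) ?_
          rw [mem_seg, dist_comm z, dist_comm z] at h
          linarith [dist_nonneg (x := f a) (y := f x)]
        obtain ⟨c, hc, hcz⟩ : ∃ c ∈ seg a b, f c = z := by
          rcases hT.edge_gate D.target_vertices.twoDirs (D.map_edge a b hab)
            (D.map_mem_seg hab hxab) z with h | h | h
          · exact D.exists_of_mem_seg hab h
          · exact ⟨a, left_mem_seg _ _, key' a hab.1 h⟩
          · exact ⟨b, right_mem_seg _ _, key' b hab.2.1 h⟩
        exact ⟨c, hc, hcz, by rw [← hcz, D.isometric a b hab x hxab c hc]⟩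
      obtain ⟨a, b, hab, hxab⟩ := D.vertices.exists_edge x hxV
      obtain ⟨c, hc, hcz, hd⟩ := key a b hab hxab
      refine ⟨c, hcz, hd, fun h => absurd h hxV, fun a' b' hab' hxab' _ => ?_⟩
      rcases hS.edge_unique D.vertices.twoDirs hab hab' hxV hxab hxab' with ⟨rfl, rfl⟩ | ⟨rfl, rfl⟩
      · exact hc
      · exact mem_seg_comm.1 hc
  · by_contra hne
    have hdd : dist (f c) (f c') ≠ dist c c' := by
      rw [hc, hc', dist_self]
      exact (dist_pos.2 hne).ne
    obtain ⟨m, hmV, hm, hmc, -, hcm, -⟩ := D.exists_fold hdd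
    have h1 : f m = z := by
      refine hL _ ((D.mem_iff m).2 hmV) ?_
      rw [dist_comm, ← hc, hcm]
      rw [mem_seg] at hm
      linarith [dist_nonneg (x := m) (y := c')]
    rw [h1, hc, dist_self] at hcm
    exact hmc (dist_eq_zero.1 hcm.symm).symm

end IsSimplicialMap

/-- A simplicial map which folds no two edges is an isomorphism. -/
theorem IsSimplicialMap.isFoldVertexProduct_of_no_fold {G : Type u} [Group G] {S : Type v}
    [MetricSpace S] [MulAction G S] {H : Type u'} [Group H] {T : Type v'} [MetricSpace T]
    [MulAction H T] {V : Set S} {W : Set T} {fhom : G →* H} {f : S → T}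
    (D : IsSimplicialMap V W fhom f) (hf : Function.Surjective f)
    (hsurj : Function.Surjective fhom)
    (hinj : ∀ a ∈ V, ∀ g : G, g • a = a → fhom g = 1 → g = 1)
    (hno : ∀ v x y, IsEdge V v x → IsEdge V v y → f x = f y → x = y) :
    IsFoldVertexProduct fhom f := by
  have hiso : Isometry f := Isometry.of_dist_eq fun p q => by
    by_contra h
    obtain ⟨m, -, -, -, -, -, b, b', hb, hb', hne, he, -⟩ := D.exists_fold h
    exact hne (hno m b b' hb hb' he)
  have hfi : Function.Injective fhom := by
    rw [injective_iff_map_eq_one]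
    intro g hg
    obtain ⟨a, ha⟩ := D.vertices.nonempty
    refine hinj a ha g (hiso.injective ?_) hg
    rw [D.map_smul, hg, one_smul]
  exact IsFoldVertexProduct.iso (MulEquiv.ofBijective fhom ⟨hfi, hsurj⟩)
    (IsometryEquiv.mk (Equiv.ofBijective f ⟨hiso.injective, hf⟩) hiso) D.map_smul

end Simplicial

/-! ### Tree-like pseudometrics and their folds -/

section TreeDist

variable {S : Type*}

/-- A pseudometric, given as a plain function, which satisfies the four point condition. -/
structure IsTreeDist (d : S → S → ℝ) : Prop where
  self : ∀ x, d x x = 0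
  comm : ∀ x y, d x y = d y x
  triangle : ∀ x y z, d x z ≤ d x y + d y z
  hyperbolic : ∀ x y z w, d x y + d z w ≤ max (d x z + d y w) (d x w + d y z)

/-- A symmetric kernel `k` with the ultrametric property `min (k x y) (k y z) ≤ k x z` is the
Gromov product (at a base point) of a tree-like pseudometric. -/
theorem isTreeDist_of_product {k : S → S → ℝ} (hk : ∀ x y, k x y = k y x)
    (hu : ∀ x y z, min (k x y) (k y z) ≤ k x z) :
    IsTreeDist fun x y => k x x + k y y - 2 * k x y where
  self x := by ring
  comm x y := by rw [hk x y]; ring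
  triangle x y z := by
    have h1 := hu y x y
    have h2 := hu y z y
    rw [hk y x, min_self] at h1
    rw [hk z y, min_self] at h2
    rcases min_le_iff.1 (hu x y z) with h | h <;> linarith
  hyperbolic x y z w := by
    have h1 := min_le_iff.1 (hu x z y)
    have h2 := min_le_iff.1 (hu x w y)
    have h3 := min_le_iff.1 (hu z x w)
    have h4 := min_le_iff.1 (hu z y w)
    rw [hk z y] at h1 h4
    rw [hk w y] at h2
    rw [hk z x] at h3
    rw [le_max_iff]
    by_contra hcon
    push Not at hcon
    obtain ⟨c1, c2⟩ := hcon
    rcases h1 with h1 | h1 <;> rcases h2 with h2 | h2 <;> rcases h3 with h3 | h3 <;>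
      rcases h4 with h4 | h4 <;> linarith

/-- Folding a tree-like pseudometric.  If `x` and `y` have the same distance `l` from `v`, then the
Gromov product at `v` can be enlarged to the smallest one for which the product of `x` and `y` is
`l`.  The new pseudometric `d'` identifies `x` with `y`, and it still dominates every pseudometric
`ρ` below `d` for which the segments from `v` to `x` and to `y` are already identified. -/
theorem IsTreeDist.exists_fold {d ρ : S → S → ℝ} (hd : IsTreeDist d)
    (hρc : ∀ x y, ρ x y = ρ y x) (hρt : ∀ x y z, ρ x z ≤ ρ x y + ρ y z)
    (hle : ∀ x y, ρ x y ≤ d x y) {v x y : S} {l : ℝ} (hx : d v x = l) (hy : d v y = l)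
    (h : ∀ s, 0 ≤ s → s ≤ l → ∃ a b, d v a = s ∧ d a x = l - s ∧ d v b = s ∧ d b y = l - s ∧
      ρ a b = 0) :
    ∃ d', IsTreeDist d' ∧ (∀ p q, d' p q ≤ d p q) ∧ (∀ p q, ρ p q ≤ d' p q) ∧ d' x y = 0 := by
  obtain ⟨g, hg⟩ : ∃ g : S → S → ℝ, ∀ p q, g p q = (d v p + d v q - d p q) / 2 := ⟨_, fun _ _ => rfl⟩
  have gc : ∀ p q, g p q = g q p := fun p q => by rw [hg, hg, hd.comm p q]; ring
  have gu : ∀ p q r, min (g p q) (g q r) ≤ g p r := fun p q r => by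
    rw [hg, hg, hg, min_le_iff]
    have := hd.hyperbolic v q p r
    rw [hd.comm q r, hd.comm q p] at this
    rw [hd.comm q r]
    rcases le_max_iff.1 this with h | h
    · right; linarith
    · left; linarith
  have gs : ∀ p, g p p = d v p := fun p => by rw [hg, hd.self]; ring
  have gl : ∀ p q, g p q ≤ d v p := fun p q => by
    have := hd.triangle v p q
    rw [hg]; linarith
  have g0 : ∀ p q, 0 ≤ g p q := fun p q => by
    have := hd.triangle p v q
    rw [hd.comm p v] at this
    rw [hg]; linarith
  -- the folded Gromov product
  obtain ⟨k, hk⟩ : ∃ k : S → S → ℝ, ∀ p q, k p q =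
    max (g p q) (max (min (g p x) (g y q)) (min (g p y) (g x q))) := ⟨_, fun _ _ => rfl⟩
  have kc : ∀ p q, k p q = k q p := fun p q => by
    rw [hk, hk, gc p q, gc p x, gc y q, gc p y, gc x q, max_comm (min (g x p) _),
      min_comm (g y p), min_comm (g x p)]
  have ks : ∀ p, k p p = d v p := fun p => by
    rw [hk, gs]
    exact max_eq_left (max_le ((min_le_left _ _).trans (gl _ _)) ((min_le_left _ _).trans (gl _ _)))
  have ku : ∀ p q r, min (k p q) (k q r) ≤ k p r := by
    intro p q r
    have h1 : g p r ≤ k p r := (le_max_left _ _).trans (hk p r).ge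
    have h2 : min (g p x) (g y r) ≤ k p r :=
      ((le_max_left _ _).trans (le_max_right _ _)).trans (hk p r).ge
    have h3 : min (g p y) (g x r) ≤ k p r :=
      ((le_max_right _ _).trans (le_max_right _ _)).trans (hk p r).ge
    by_contra hcon
    rw [not_le, lt_min_iff, hk p q, hk q r] at hcon
    simp only [lt_max_iff, lt_min_iff] at hcon
    have n1 : ¬ k p r < g p r := h1.not_gt
    have n2 : k p r < g p x → k p r < g y r → False := fun a b => h2.not_gt (lt_min a b)
    have n3 : k p r < g p y → k p r < g x r → False := fun a b => h3.not_gt (lt_min a b)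
    have U : ∀ {a b c}, k p r < g a b → k p r < g b c → k p r < g a c :=
      fun h h' => (lt_min h h').trans_le (gu _ _ _)
    rcases hcon with ⟨h | ⟨h, h'⟩ | ⟨h, h'⟩, i | ⟨i, i'⟩ | ⟨i, i'⟩⟩
    · exact n1 (U h i)
    · exact n2 (U h i) i'
    · exact n3 (U h i) i'
    · exact n2 h (U h' i)
    · exact n2 h i'
    · exact n1 (U h i')
    · exact n3 h (U h' i)
    · exact n1 (U h i')
    · exact n3 h i'
  have hdk : ∀ p q, d p q = k p p + k q q - 2 * g p q := fun p q => by rw [ks, ks, hg]; ring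
  refine ⟨_, isTreeDist_of_product kc ku, fun p q => ?_, fun p q => ?_, ?_⟩
  · have : g p q ≤ k p q := (le_max_left _ _).trans (hk p q).ge
    linarith [hdk p q]
  · have near : ∀ {a x p s}, d v x = l → d v a = s → d a x = l - s → s ≤ g p x →
        d p a ≤ d v p - s := by
      intro a x p s hx ha hax hs
      rw [hg] at hs
      have := hd.hyperbolic p a v x
      rw [hd.comm p v, hd.comm a v] at this
      rcases le_max_iff.1 this with h | h <;> linarith
    have key : ∀ {p q}, ρ p q ≤ d v p + d v q - 2 * min (g p x) (g y q) := by
      intro p q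
      obtain ⟨a, b, ha, hax, hb, hby, hab⟩ := h (min (g p x) (g y q)) (le_min (g0 _ _) (g0 _ _))
        ((min_le_left _ _).trans (by rw [gc]; exact (gl _ _).trans hx.le))
      have h1 := near hx ha hax (min_le_left _ _)
      have h2 := near (p := q) hy hb hby ((min_le_right _ _).trans (gc _ _).le)
      have h3 := hρt p a q
      have h4 := hρt a b q
      have h5 := hle p a
      have h6 := hle b q
      rw [hd.comm b q] at h6
      linarith
    rw [ks, ks, hk]
    rcases max_cases (g p q) (max (min (g p x) (g y q)) (min (g p y) (g x q))) with ⟨h1, -⟩ | ⟨h1, -⟩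
    · rw [h1, hg]
      linarith [hle p q]
    · rcases max_cases (min (g p x) (g y q)) (min (g p y) (g x q)) with ⟨h2, -⟩ | ⟨h2, -⟩
      · rw [h1, h2]; exact key
      · rw [h1, h2, hρc, min_comm, gc p y, gc x q]
        linarith [key (p := q) (q := p)]
  · have h1 : l ≤ k x y := by
      refine le_trans ?_ (hk x y).ge
      rw [gs, gs, hx, hy, min_self]
      exact (le_max_left _ _).trans (le_max_right _ _)
    have h2 := ku x y x
    rw [kc y x, min_self, ks, hx] at h2
    rw [ks, ks, hx, hy]
    linarith

end TreeDist

/-! ### The quotient pseudometric -/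

section QuotDist

variable {S : Type*} [MetricSpace S]

/-- `RelChain R x y r`: a path of total length `r` from `x` to `y`, which may jump for free between
related points. -/
inductive RelChain (R : S → S → Prop) : S → S → ℝ → Prop
  | refl (x : S) : RelChain R x x 0
  | rel {x y z : S} {r : ℝ} : R x y → RelChain R y z r → RelChain R x z r
  | step (x : S) {y z : S} {r : ℝ} : RelChain R y z r → RelChain R x z (dist x y + r)

/-- The largest pseudometric below the metric of `S` for which related points have distance zero. -/
noncomputable def quotDist (R : S → S → Prop) (x y : S) : ℝ := sInf {r | RelChain R x y r}

variable {R : S → S → Prop} {x y z : S} {r s : ℝ}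

namespace RelChain

theorem nonneg (h : RelChain R x y r) : 0 ≤ r := by
  induction h with
  | refl => rfl
  | rel _ _ ih => exact ih
  | step _ _ ih => positivity

theorem trans (h : RelChain R x y r) (h' : RelChain R y z s) : RelChain R x z (r + s) := by
  induction h with
  | refl => simpa using h'
  | rel h _ ih => exact rel h (ih h')
  | step x _ ih => rw [add_assoc]; exact step x (ih h')

theorem of_rel (h : R x y) : RelChain R x y 0 := rel h (refl y)

theorem of_dist (R : S → S → Prop) (x y : S) : RelChain R x y (dist x y) := by
  simpa using step x (refl (R := R) y)

theorem symm (hR : ∀ {x y}, R x y → R y x) (h : RelChain R x y r) : RelChain R y x r := by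
  induction h with
  | refl => exact refl _
  | rel h _ ih => simpa using ih.trans (of_rel (hR h))
  | step x _ ih =>
    rw [add_comm, dist_comm]
    exact ih.trans (of_dist R _ _)

theorem le {ρ : S → S → ℝ} (h0 : ∀ x, ρ x x = 0) (ht : ∀ x y z, ρ x z ≤ ρ x y + ρ y z)
    (hR : ∀ x y, R x y → ρ x y = 0) (hd : ∀ x y, ρ x y ≤ dist x y) (h : RelChain R x y r) :
    ρ x y ≤ r := by
  induction h with
  | refl => exact (h0 _).le
  | rel h _ ih => exact (ht _ _ _).trans (by rw [hR _ _ h, zero_add]; exact ih)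
  | step x _ ih => exact (ht _ _ _).trans (add_le_add (hd _ _) ih)

end RelChain

theorem quotDist_le (h : RelChain R x y r) : quotDist R x y ≤ r :=
  csInf_le ⟨0, fun _ h => RelChain.nonneg h⟩ h

theorem quotDist_le_dist (R : S → S → Prop) (x y : S) : quotDist R x y ≤ dist x y :=
  quotDist_le (RelChain.of_dist R x y)

theorem le_quotDist (h : ∀ r, RelChain R x y r → s ≤ r) : s ≤ quotDist R x y :=
  le_csInf ⟨_, RelChain.of_dist R x y⟩ h

theorem quotDist_nonneg (R : S → S → Prop) (x y : S) : 0 ≤ quotDist R x y :=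
  le_quotDist fun _ h => h.nonneg

theorem quotDist_eq_zero (h : R x y) : quotDist R x y = 0 :=
  le_antisymm (quotDist_le (RelChain.of_rel h)) (quotDist_nonneg R x y)

theorem quotDist_self (R : S → S → Prop) (x : S) : quotDist R x x = 0 :=
  le_antisymm (quotDist_le (RelChain.refl x)) (quotDist_nonneg R x x)

theorem exists_relChain_lt (h : quotDist R x y < s) : ∃ r < s, RelChain R x y r := by
  obtain ⟨r, hr, hrs⟩ := exists_lt_of_csInf_lt ⟨_, RelChain.of_dist R x y⟩ h
  exact ⟨r, hrs, hr⟩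

theorem quotDist_triangle (R : S → S → Prop) (x y z : S) :
    quotDist R x z ≤ quotDist R x y + quotDist R y z := by
  refine le_of_forall_pos_le_add fun ε hε => ?_
  obtain ⟨r, hr, h⟩ := exists_relChain_lt (lt_add_of_pos_right (quotDist R x y) (half_pos hε))
  obtain ⟨s, hs, h'⟩ := exists_relChain_lt (lt_add_of_pos_right (quotDist R y z) (half_pos hε))
  linarith [quotDist_le (h.trans h')]

theorem quotDist_comm (hR : Equivalence R) (x y : S) : quotDist R x y = quotDist R y x :=
  le_antisymm (le_quotDist fun _ h => quotDist_le (h.symm hR.symm))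
    (le_quotDist fun _ h => quotDist_le (h.symm hR.symm))

/-- The pair `x, y` can be identified by folds: below every tree-like pseudometric between the
quotient pseudometric and the metric there is another one for which `x` and `y` have
distance zero. -/
def Foldable (R : S → S → Prop) (x y : S) : Prop :=
  ∀ d : S → S → ℝ, IsTreeDist d → (∀ p q, quotDist R p q ≤ d p q) → (∀ p q, d p q ≤ dist p q) →
    ∃ d' : S → S → ℝ, IsTreeDist d' ∧ (∀ p q, quotDist R p q ≤ d' p q) ∧
      (∀ p q, d' p q ≤ d p q) ∧ d' x y = 0

theorem Foldable.refl (R : S → S → Prop) (x : S) : Foldable R x x :=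
  fun d hd h1 _ => ⟨d, hd, h1, fun _ _ => le_rfl, hd.self x⟩

theorem Foldable.symm (h : Foldable R x y) : Foldable R y x := fun d hd h1 h2 => by
  obtain ⟨d', h3, h4, h5, h6⟩ := h d hd h1 h2
  exact ⟨d', h3, h4, h5, by rw [h3.comm, h6]⟩

theorem Foldable.trans (h : Foldable R x y) (h' : Foldable R y z) : Foldable R x z :=
  fun d hd h1 h2 => by
    obtain ⟨d', h3, h4, h5, h6⟩ := h d hd h1 h2
    obtain ⟨d'', h3', h4', h5', h6'⟩ := h' d' h3 h4 fun p q => (h5 p q).trans (h2 p q)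
    refine ⟨d'', h3', h4', fun p q => (h5' p q).trans (h5 p q), le_antisymm ?_ ?_⟩
    · linarith [h3'.triangle x y z, h5' x y]
    · exact (quotDist_nonneg R x z).trans (h4' x z)

/-- If all related pairs can be identified by folds, the quotient pseudometric is a limit of
tree-like pseudometrics, hence tree-like itself. -/
theorem isTreeDist_quotDist (hS : IsRTree S) (hR : Equivalence R)
    (hF : ∀ x y, R x y → Foldable R x y) : IsTreeDist (quotDist R) where
  self := quotDist_self R
  comm := quotDist_comm hR
  triangle := quotDist_triangle R
  hyperbolic x y z w := by
    have approx : ∀ {ε x y}, 0 < ε → ∀ d : S → S → ℝ, IsTreeDist d →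
        (∀ p q, quotDist R p q ≤ d p q) → (∀ p q, d p q ≤ dist p q) →
        ∃ d' : S → S → ℝ, IsTreeDist d' ∧ (∀ p q, quotDist R p q ≤ d' p q) ∧
          (∀ p q, d' p q ≤ d p q) ∧ d' x y ≤ quotDist R x y + ε := by
      intro ε x y hε d hd h1 h2
      obtain ⟨r, hr, h⟩ := exists_relChain_lt (lt_add_of_pos_right (quotDist R x y) hε)
      have key : ∀ d : S → S → ℝ, IsTreeDist d →
        (∀ p q, quotDist R p q ≤ d p q) → (∀ p q, d p q ≤ dist p q) →
        ∃ d' : S → S → ℝ, IsTreeDist d' ∧ (∀ p q, quotDist R p q ≤ d' p q) ∧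
          (∀ p q, d' p q ≤ d p q) ∧ d' x y ≤ r := by
        clear hr h1 h2 hd d
        induction h with
        | refl => exact fun d hd h1 h2 => ⟨d, hd, h1, fun _ _ => le_rfl, (hd.self _).le⟩
        | @rel x y z r h _ ih =>
          intro d hd h1 h2
          obtain ⟨d', h3, h4, h5, h6⟩ := hF _ _ h d hd h1 h2
          obtain ⟨d'', h3', h4', h5', h6'⟩ := ih d' h3 h4 fun p q => (h5 p q).trans (h2 p q)
          refine ⟨d'', h3', h4', fun p q => (h5' p q).trans (h5 p q), ?_⟩
          linarith [h3'.triangle x y z, h5' x y]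
        | @step x y z r _ ih =>
          intro d hd h1 h2
          obtain ⟨d', h3, h4, h5, h6⟩ := ih d hd h1 h2
          refine ⟨d', h3, h4, h5, ?_⟩
          linarith [h3.triangle x y z, h5 x y, h2 x y]
      obtain ⟨d', h3, h4, h5, h6⟩ := key d hd h1 h2
      exact ⟨d', h3, h4, h5, h6.trans hr.le⟩
    refine le_of_forall_pos_le_add fun ε hε => ?_
    have hε2 := half_pos hε
    have h0 : IsTreeDist fun x y : S => dist x y :=
      ⟨dist_self, dist_comm, dist_triangle, hS.hyperbolic⟩
    obtain ⟨d1, t1, l1, u1, e1⟩ := approx (x := x) (y := z) hε2 _ h0 (quotDist_le_dist R)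
      fun _ _ => le_rfl
    obtain ⟨d2, t2, l2, u2, e2⟩ := approx (x := y) (y := w) hε2 d1 t1 l1 u1
    obtain ⟨d3, t3, l3, u3, e3⟩ := approx (x := x) (y := w) hε2 d2 t2 l2
      fun p q => (u2 p q).trans (u1 p q)
    obtain ⟨d4, t4, l4, u4, e4⟩ := approx (x := y) (y := z) hε2 d3 t3 l3
      fun p q => (u3 p q).trans ((u2 p q).trans (u1 p q))
    have hh := t4.hyperbolic x y z w
    have a1 := l4 x y
    have a2 := l4 z w
    have b1 := (u4 x z).trans ((u3 x z).trans (u2 x z))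
    have b2 := (u4 y w).trans (u3 y w)
    have b3 := u4 x w
    rcases le_max_iff.1 hh with h | h
    · linarith [le_max_left (quotDist R x z + quotDist R y w) (quotDist R x w + quotDist R y z)]
    · linarith [le_max_right (quotDist R x z + quotDist R y w) (quotDist R x w + quotDist R y z)]

/-- Segments which are related pointwise, and on which the quotient pseudometric agrees with the
metric, can be identified by a fold once their initial points can. -/
theorem Foldable.of_seg (hS : IsRTree S) {v x v' y : S} (h0 : Foldable R v v')
    (hd : dist v x = dist v' y) (hx : dist v x ≤ quotDist R v x) (hy : dist v' y ≤ quotDist R v' y)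
    (hR : Equivalence R)
    (h : ∀ a ∈ seg v x, ∀ b ∈ seg v' y, dist v a = dist v' b → R a b) :
    ∀ a ∈ seg v x, ∀ b ∈ seg v' y, dist v a = dist v' b → Foldable R a b := by
  intro a ha b hb hab d hd0 h1 h2
  obtain ⟨d1, t1, l1, u1, e1⟩ := h0 d hd0 h1 h2
  -- all pseudometrics in between agree with the metric on the two segments
  have hseg : ∀ {v x : S} {d1 : S → S → ℝ}, IsTreeDist d1 → (∀ p q, quotDist R p q ≤ d1 p q) →
      (∀ p q, d1 p q ≤ dist p q) → dist v x ≤ quotDist R v x → ∀ a ∈ seg v x,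
      d1 v a = dist v a ∧ d1 a x = dist v x - dist v a := by
    intro v x d1 t1 l1 u1 hx a ha
    have i1 := t1.triangle v a x
    have i2 := l1 v x
    have i3 := u1 v a
    have i4 := u1 a x
    rw [mem_seg] at ha
    constructor <;> linarith
  have u1' : ∀ p q, d1 p q ≤ dist p q := fun p q => (u1 p q).trans (h2 p q)
  have hv : ∀ p, d1 v p = d1 v' p := fun p => by
    have i1 := t1.triangle v v' p
    have i2 := t1.triangle v' v p
    rw [t1.comm v' v] at i2
    linarith
  obtain ⟨d2, t2, u2, l2, e2⟩ := t1.exists_fold (quotDist_comm hR) (quotDist_triangle R) l1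
    (v := v) (x := x) (y := y) (l := dist v x)
    (hseg t1 l1 u1' hx x (right_mem_seg _ _)).1
    (by rw [hv, (hseg t1 l1 u1' hy y (right_mem_seg _ _)).1, hd]) (by
      intro s hs0 hs1
      obtain ⟨a, ha, has⟩ := hS.exists_mem_seg v x hs0 hs1
      obtain ⟨b, hb, hbs⟩ := hS.exists_mem_seg v' y hs0 (hd ▸ hs1)
      obtain ⟨i1, i2⟩ := hseg t1 l1 u1' hx a ha
      obtain ⟨i3, i4⟩ := hseg t1 l1 u1' hy b hb
      refine ⟨a, b, by rw [i1, has], by rw [i2, has], by rw [hv, i3, hbs], by rw [i4, hbs, hd],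
        quotDist_eq_zero (h a ha b hb (has.trans hbs.symm))⟩)
  have u2' : ∀ p q, d2 p q ≤ dist p q := fun p q => (u2 p q).trans (u1' p q)
  refine ⟨d2, t2, l2, fun p q => (u2 p q).trans (u1 p q), le_antisymm ?_
    ((quotDist_nonneg R a b).trans (l2 a b))⟩
  obtain ⟨i1, i2⟩ := hseg t2 l2 u2' hx a ha
  obtain ⟨i3, i4⟩ := hseg t2 l2 u2' hy b hb
  obtain ⟨i5, -⟩ := hseg t2 l2 u2' hx x (right_mem_seg _ _)
  have i6 := t2.hyperbolic a b v x
  have i7 := t2.triangle b y x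
  have i8 := t2.triangle v v' b
  have i9 := u2 v v'
  rw [t2.comm y x] at i7
  rw [t2.comm a v, t2.comm b v] at i6
  rcases le_max_iff.1 i6 with h | h <;> linarith

theorem exists_quotient_metric {S : Type v} [MetricSpace S] {R : S → S → Prop}
    (hR : Equivalence R) (h0 : ∀ x y, quotDist R x y = 0 → R x y) :
    ∃ (S' : Type v) (_ : MetricSpace S') (p : S → S'), Function.Surjective p ∧
      ∀ x y, dist (p x) (p y) = quotDist R x y := by
  have hz : ∀ a b a' b' : S, R a a' → R b b' → quotDist R a b = quotDist R a' b' := by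
    have key : ∀ a b a' b' : S, R a a' → R b b' → quotDist R a b ≤ quotDist R a' b' := by
      intro a b a' b' ha hb
      have h1 := quotDist_triangle R a a' b
      have h2 := quotDist_triangle R a' b' b
      rw [quotDist_eq_zero ha] at h1
      rw [quotDist_eq_zero (hR.symm hb)] at h2
      linarith
    exact fun a b a' b' ha hb => le_antisymm (key _ _ _ _ ha hb)
      (key _ _ _ _ (hR.symm ha) (hR.symm hb))
  let st : Setoid S := ⟨R, hR⟩
  let m : MetricSpace (Quotient st) :=
    { dist := Quotient.lift₂ (quotDist R) hz
      dist_self := by rintro ⟨x⟩; exact quotDist_self R x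
      dist_comm := by rintro ⟨x⟩ ⟨y⟩; exact quotDist_comm hR x y
      dist_triangle := by rintro ⟨x⟩ ⟨y⟩ ⟨z⟩; exact quotDist_triangle R x y z
      eq_of_dist_eq_zero := by
        rintro ⟨x⟩ ⟨y⟩ h
        exact Quotient.sound (h0 x y h) }
  exact ⟨Quotient st, m, Quotient.mk st, Quotient.mk_surjective, fun _ _ => rfl⟩

end QuotDist

theorem exists_quotient_action {G G' S S' : Type*} [Group G] [Group G'] [MulAction G S]
    {π : G →* G'} (hπ : Function.Surjective π) {p : S → S'} (hp : Function.Surjective p)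
    (hG : ∀ (g : G) (x y : S), p x = p y → p (g • x) = p (g • y))
    (hker : ∀ n : G, π n = 1 → ∀ x : S, p (n • x) = p x) :
    ∃ _ : MulAction G' S', ∀ (g : G) (x : S), p (g • x) = π g • p x := by
  have hgen : ∀ (g h : G) (x y : S), π g = π h → p x = p y → p (g • x) = p (h • y) := by
    intro g h x y hgh hxy
    rw [hG g x y hxy]
    have h1 := hker (g * h⁻¹) (by rw [map_mul, map_inv, hgh, mul_inv_cancel]) (h • y)
    rwa [smul_smul, inv_mul_cancel_right] at h1
  obtain ⟨act, hact⟩ : ∃ act : G' → S' → S', ∀ (g : G) (x : S), p (g • x) = act (π g) (p x) :=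
    ⟨fun g' s => p (Function.surjInv hπ g' • Function.surjInv hp s), fun g x =>
      hgen _ _ _ _ (Function.surjInv_eq hπ _).symm (Function.surjInv_eq hp _).symm⟩
  let A : MulAction G' S' :=
    { smul := act
      one_smul := fun s => by
        obtain ⟨x, rfl⟩ := hp s
        change act 1 (p x) = p x
        rw [← map_one π, ← hact, one_smul]
      mul_smul := fun g h s => by
        obtain ⟨x, rfl⟩ := hp s
        obtain ⟨g, rfl⟩ := hπ g
        obtain ⟨h, rfl⟩ := hπ h
        change act _ _ = act _ (act _ _)
        rw [← map_mul, ← hact, ← hact, ← hact, mul_smul] }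
  exact ⟨A, hact⟩

/-! ### Quotients of simplicial trees -/

namespace IsSimplicialMap

variable {G : Type*} [Group G] {S : Type*} [MetricSpace S] [MulAction G S]
variable {H : Type*} [Group H] {T : Type*} [MetricSpace T] [MulAction H T]
variable {V : Set S} {W : Set T} {fhom : G →* H} {f : S → T} (D : IsSimplicialMap V W fhom f)
include D

section Factor

variable {S' : Type*} [MetricSpace S'] {p : S → S'} {f' : S' → T}
  (hpf : ∀ x, f' (p x) = f x) (hp : ∀ x y, dist (p x) (p y) ≤ dist x y)
  (hf' : ∀ x y, dist (f' x) (f' y) ≤ dist x y)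
include hpf hp hf'

theorem isometric_factor {a b : S} (h : IsEdge V a b) :
    ∀ x ∈ seg a b, ∀ y ∈ seg a b, dist (p x) (p y) = dist x y := fun x hx y hy => by
  refine le_antisymm (hp x y) ?_
  rw [← D.isometric a b h x hx y hy, ← hpf x, ← hpf y]
  exact hf' _ _

theorem map_mem_seg_factor {a b x : S} (h : IsEdge V a b) (hx : x ∈ seg a b) :
    p x ∈ seg (p a) (p b) := by
  have hiso := D.isometric_factor hpf hp hf' h
  rw [mem_seg, hiso a (left_mem_seg _ _) x hx, hiso x hx b (right_mem_seg _ _),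
    hiso a (left_mem_seg _ _) b (right_mem_seg _ _)]
  exact hx

theorem map_edge_factor {a b : S} (h : IsEdge V a b) : IsEdge (f' ⁻¹' W) (p a) (p b) := by
  have hW := D.map_edge a b h
  have hd : dist (p a) (p b) = dist (f a) (f b) := by
    rw [D.dist_edge h]
    exact D.isometric_factor hpf hp hf' h a (left_mem_seg _ _) b (right_mem_seg _ _)
  have ha : p a ∈ f' ⁻¹' W := by rw [Set.mem_preimage, hpf]; exact hW.1
  have hb : p b ∈ f' ⁻¹' W := by rw [Set.mem_preimage, hpf]; exact hW.2.1
  refine ⟨ha, hb, fun he => hW.2.2.1 (by rw [← hpf, he, hpf]), ?_⟩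
  ext z
  constructor
  · rintro ⟨hz, hzW⟩
    rw [mem_seg] at hz
    have h1 := hf' (p a) z
    have h2 := hf' z (p b)
    have h3 := dist_triangle (f a) (f' z) (f b)
    rw [hpf] at h1 h2
    have hz' : f' z ∈ seg (f a) (f b) := by rw [mem_seg]; linarith
    rcases hW.eq_or_eq hzW hz' with h | h
    · rw [h, dist_self] at h1 h3
      rw [h] at h2
      exact Or.inl (dist_le_zero.1 (by rw [dist_comm]; linarith))
    · rw [h, dist_self] at h2 h3
      rw [h] at h1
      exact Or.inr (dist_le_zero.1 (by linarith))
  · rintro (rfl | rfl)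
    · exact ⟨left_mem_seg _ _, ha⟩
    · exact ⟨right_mem_seg _ _, hb⟩

theorem exists_edge_factor (hS' : IsRTree S') (hV' : TwoDirs (f' ⁻¹' W))
    (hsurj : Function.Surjective p) {a' b' : S'} (h : IsEdge (f' ⁻¹' W) a' b') :
    ∃ a b, IsEdge V a b ∧ p a = a' ∧ p b = b' := by
  obtain ⟨m, hm, -, hma, hmb⟩ := hS'.exists_mid h.2.2.1
  have hmV : m ∉ f' ⁻¹' W := fun hmV => (h.eq_or_eq hmV hm).elim hma hmb
  obtain ⟨x, rfl⟩ := hsurj m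
  have hx : x ∉ V := by
    rwa [Set.mem_preimage, hpf, D.mem_iff] at hmV
  obtain ⟨a, b, hab, hxab⟩ := D.vertices.exists_edge x hx
  rcases hS'.edge_unique hV' h (D.map_edge_factor hpf hp hf' hab) hmV hm
    (D.map_mem_seg_factor hpf hp hf' hab hxab) with ⟨h1, h2⟩ | ⟨h1, h2⟩
  · exact ⟨a, b, hab, h1, h2⟩
  · exact ⟨b, a, hab.symm, h2, h1⟩

theorem isTreeMorphism_factor {G' : Type*} [Group G'] [MulAction G' S'] {π : G →* G'}
    (hπ : ∀ (g : G) (x : S), p (g • x) = π g • p x) : IsTreeMorphism π p :=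
  ⟨hπ, fun x y hxy => by
    obtain ⟨a, b, w, hab, hx, hw, hwy, hwx⟩ := D.source.isRTree.exists_edge_initial
      D.vertices.twoDirs D.vertices.locFin D.vertices.exists_edge hxy
    have hsub := D.source.isRTree.seg_subset hx hw
    exact ⟨w, hwy, hwx, fun q hq r hr => D.isometric_factor hpf hp hf' hab q (hsub hq) r (hsub hr)⟩⟩

end Factor

/-- Two edges whose images in `T` meet in a point which is not a vertex have the same image;
one of them may have to be reversed. -/
theorem exists_oriented_edge {x y a b : S} (hy : y ∉ V) (hab : IsEdge V a b)
    (hx : f y ∈ seg (f a) (f b)) (hxy : f x = f y) :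
    ∃ a' b', IsEdge V a' b' ∧ x ∈ seg a' b' ∧ f a' = f a ∧ f b' = f b := by
  have hyW : f y ∉ W := fun h => hy ((D.mem_iff y).1 h)
  have hxV : x ∉ V := fun h => hyW (hxy ▸ (D.mem_iff x).2 h)
  obtain ⟨a', b', hab', hx'⟩ := D.vertices.exists_edge x hxV
  have h1 := D.map_mem_seg hab' hx'
  rw [hxy] at h1
  rcases D.target.isRTree.edge_unique D.target_vertices.twoDirs (D.map_edge _ _ hab)
    (D.map_edge _ _ hab') hyW hx h1 with ⟨h2, h3⟩ | ⟨h2, h3⟩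
  · exact ⟨a', b', hab', hx', h2, h3⟩
  · exact ⟨b', a', hab'.symm, mem_seg_comm.1 hx', h3, h2⟩

/-- An equivalence relation on `S` is edge compatible if it relates only points with the same image,
and relates edges pointwise, end points included, once it relates two of their interior points. -/
def EdgeCompatible (V : Set S) (f : S → T) (R : S → S → Prop) : Prop :=
  (∀ x y, R x y → f x = f y) ∧
  ∀ x y a b a' b', R x y → x ∉ V → IsEdge V a b → IsEdge V a' b' → x ∈ seg a b → y ∈ seg a' b' →
    f a = f a' → f b = f b' → ∀ m ∈ seg a b, ∀ m' ∈ seg a' b', f m = f m' → R m m'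

variable {R : S → S → Prop} (hR : Equivalence R) (hE : EdgeCompatible V f R)
include hE

omit D in
theorem EdgeCompatible.dist_le_quotDist (hf : ∀ x y, dist (f x) (f y) ≤ dist x y) (x y : S) :
    dist (f x) (f y) ≤ quotDist R x y :=
  le_quotDist fun _ h => h.le (ρ := fun x y => dist (f x) (f y)) (fun _ => dist_self _)
    (fun _ _ _ => dist_triangle _ _ _) (fun x y h => by rw [hE.1 x y h, dist_self]) hf

include hR

/-- Points of a fibre which are close to each other in the quotient are related. -/
theorem exists_rel_of_quotDist_lt (z : T) :
    ∃ δ > 0, (∀ x y, f x = z → f y = z → quotDist R x y < δ → R x y) ∧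
      ∀ x, dist (f x) z < δ → ∃ c, f c = z ∧ dist x c = dist (f x) z ∧ (x ∈ V → c = x) ∧
        ∀ a b, IsEdge V a b → x ∈ seg a b → x ∉ V → c ∈ seg a b := by
  obtain ⟨δ, hδ, hnear, hsep⟩ := D.exists_radius z
  -- a short chain in the neighbourhood of the fibre is retracted to a chain in the fibre
  have key : ∀ {x y r}, RelChain R x y r → ∀ c, f c = z → dist x c = dist (f x) z →
      (x ∈ V → c = x) → (∀ a b, IsEdge V a b → x ∈ seg a b → x ∉ V → c ∈ seg a b) →
      dist (f x) z + r < δ → f y = z → R c y := by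
    intro x y r h
    induction h with
    | refl x =>
      intro c _ hc _ _ _ hx
      rw [hx, dist_self] at hc
      rw [dist_eq_zero.1 hc]
      exact hR.refl c
    | @rel x y w r hxy h ih =>
      intro c hcz hc hcV hcE hlt hw
      have hf := hE.1 x y hxy
      have hlt' : dist (f y) z < δ := by
        rw [← hf]
        linarith [h.nonneg]
      obtain ⟨c', hcz', hc', hcV', hcE'⟩ := hnear y hlt'
      refine hR.trans ?_ (ih c' hcz' hc' hcV' hcE' (hf ▸ hlt) hw)
      by_cases hx : x ∈ V
      · have hy : y ∈ V := by rwa [← D.mem_iff, ← hf, D.mem_iff]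
        rw [hcV hx, hcV' hy]
        exact hxy
      · have hy : y ∉ V := by rwa [← D.mem_iff, ← hf, D.mem_iff]
        obtain ⟨a, b, hab, hxab⟩ := D.vertices.exists_edge x hx
        obtain ⟨a', b', hab', hyab', ha, hb⟩ := D.exists_oriented_edge hx hab
          (D.map_mem_seg hab hxab) hf.symm
        exact hE.2 x y a b a' b' hxy hx hab hab' hxab hyab' ha.symm hb.symm c
          (hcE a b hab hxab hx) c' (hcE' a' b' hab' hyab' hy) (hcz.trans hcz'.symm)
    | @step x y w r h ih =>
      intro c hcz hc hcV hcE hlt hw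
      have h1 := D.dist_le x y
      have h2 := dist_triangle_left (f y) z (f x)
      have h3 := h.nonneg
      obtain ⟨c', hcz', hc', hcV', hcE'⟩ := hnear y (by linarith)
      have hcc : c = c' := by
        refine hsep c c' hcz hcz' ?_
        have h4 := dist_triangle4 c x y c'
        rw [dist_comm c x] at h4
        linarith [dist_nonneg (x := x) (y := y), dist_nonneg (x := f x) (y := z)]
      rw [hcc]
      exact ih c' hcz' hc' hcV' hcE' (by linarith) hw
  refine ⟨δ, hδ, fun x y hx hy hlt => ?_, hnear⟩
  obtain ⟨r, hr, h⟩ := exists_relChain_lt hlt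
  exact key h x hx (by rw [hx, dist_self, dist_self]) (fun _ => rfl) (fun _ _ _ h _ => h)
    (by rwa [hx, dist_self, zero_add]) hy

/-- In the quotient, a neighbourhood of a point which is not a vertex lies in an edge. -/
theorem exists_ball_subset {x a b : S} (hx : x ∉ V) (hab : IsEdge V a b) (hxab : x ∈ seg a b) :
    ∃ δ > 0, ∀ y, quotDist R x y < δ → ∃ y' ∈ seg a b, R y y' := by
  obtain ⟨δ, hδ, hrel, hnear⟩ := D.exists_rel_of_quotDist_lt hR hE (f x)
  refine ⟨δ / 2, by positivity, fun y hy => ?_⟩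
  have hfy : dist (f y) (f x) ≤ quotDist R x y := by
    rw [dist_comm]
    exact hE.dist_le_quotDist D.dist_le x y
  obtain ⟨c, hcz, hc, hcV, hcE⟩ := hnear y (by linarith)
  have hcx : R c x := by
    refine hrel c x hcz rfl ?_
    have h1 := quotDist_triangle R c y x
    have h2 := quotDist_le_dist R c y
    rw [quotDist_comm hR y x] at h1
    rw [dist_comm, hc] at h2
    linarith
  have hcV' : c ∉ V := by rwa [← D.mem_iff, hcz, D.mem_iff]
  have hyV : y ∉ V := fun h => hcV' (hcV h ▸ h)
  obtain ⟨a', b', hab', hyab'⟩ := D.vertices.exists_edge y hyV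
  have hcab' := hcE a' b' hab' hyab' hyV
  obtain ⟨a'', b'', hab'', hxab'', ha, hb⟩ := D.exists_oriented_edge hcV' hab'
    (D.map_mem_seg hab' hcab') hcz.symm
  have hy2 : f y ∈ seg (f a'') (f b'') := by
    rw [ha, hb]
    exact D.map_mem_seg hab' hyab'
  obtain ⟨y', hy', hfy'⟩ := D.exists_of_mem_seg hab'' hy2
  have hyy' : R y y' := hE.2 c x a' b' a'' b'' hcx hcV' hab' hab'' hcab' hxab'' ha.symm hb.symm
    y hyab' y' hy' hfy'.symm
  rcases D.source.isRTree.edge_unique D.vertices.twoDirs hab hab'' hx hxab hxab'' with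
    ⟨rfl, rfl⟩ | ⟨rfl, rfl⟩
  · exact ⟨y', hy', hyy'⟩
  · exact ⟨y', mem_seg_comm.1 hy', hyy'⟩

end IsSimplicialMap

theorem IsRTree.areTheTwoDirs {T : Type*} [MetricSpace T] (hT : IsRTree T) {x a b : T} {r : ℝ}
    (hx : x ∈ seg a b) (hxa : a ≠ x) (hxb : b ≠ x) (hr : 0 < r)
    (hball : ∀ y, dist x y < r → y ∈ seg a b) : AreTheTwoDirs x a b := by
  refine ⟨hxa, hxb, hT.not_sameDir_iff.2 hx, fun w hw => ?_⟩
  have h0 := dist_pos.2 hw.symm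
  obtain ⟨y, hy, hd⟩ := hT.exists_mem_seg x w (t := min (r / 2) (dist x w))
    (by positivity) (min_le_right _ _)
  have hpos : 0 < min (r / 2) (dist x w) := by positivity
  have hyx : y ≠ x := by
    rintro rfl
    rw [dist_self] at hd
    linarith
  have hyr : dist x y < r := by
    rw [hd]
    exact (min_le_left _ _).trans_lt (by linarith)
  rcases hT.mem_seg_split hx (hball y hyr) with h | h
  · exact Or.inl (hT.sameDir_of_mem hyx hy (mem_seg_comm.1 h))
  · exact Or.inr (hT.sameDir_of_mem hyx hy h)

/-- The quotient of a simplicial tree by an edge compatible equivalence relation all of whose pairs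
can be identified by folds is again a simplicial tree, through which the simplicial map factors. -/
theorem IsSimplicialMap.exists_quotient {G : Type*} [Group G] {S : Type v} [MetricSpace S]
    [MulAction G S] {H : Type*} [Group H] {T : Type*} [MetricSpace T] [MulAction H T]
    {V : Set S} {W : Set T} {fhom : G →* H} {f : S → T} (D : IsSimplicialMap V W fhom f)
    {R : S → S → Prop} (hR : Equivalence R) (hE : EdgeCompatible V f R)
    (hF : ∀ x y, R x y → Foldable R x y)
    (hG : ∀ (g : G) (x y : S), R x y → R (g • x) (g • y))
    {G' : Type*} [Group G'] {π : G →* G'} (hπ : Function.Surjective π)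
    (hker : ∀ n : G, π n = 1 → ∀ x : S, R (n • x) x)
    {fhom' : G' →* H} (hcomp : ∀ g, fhom' (π g) = fhom g) :
    ∃ (S' : Type v) (_ : MetricSpace S') (_ : MulAction G' S') (p : S → S') (f' : S' → T),
      Function.Surjective p ∧ (∀ x y, p x = p y ↔ R x y) ∧
      (∀ (g : G) (x : S), p (g • x) = π g • p x) ∧ (∀ x, f' (p x) = f x) ∧
      (∀ x y, dist (p x) (p y) ≤ dist x y) ∧ IsSimplicialMap (f' ⁻¹' W) W fhom' f' := by
  have h0 : ∀ x y, quotDist R x y = 0 → R x y := fun x y h => by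
    have hf : f y = f x := by
      have := hE.dist_le_quotDist D.dist_le x y
      rw [h] at this
      exact (dist_le_zero.1 this).symm
    obtain ⟨δ, hδ, hrel, -⟩ := D.exists_rel_of_quotDist_lt hR hE (f x)
    exact hrel x y rfl hf (h ▸ hδ)
  obtain ⟨S', instM, p, hp, hd⟩ := exists_quotient_metric hR h0
  have hpR : ∀ x y, p x = p y ↔ R x y := fun x y => by
    rw [← dist_eq_zero, hd]
    exact ⟨h0 x y, quotDist_eq_zero⟩
  obtain ⟨instA, hA⟩ := exists_quotient_action hπ hp
    (fun g x y h => (hpR _ _).2 (hG g x y ((hpR _ _).1 h)))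
    (fun n hn x => (hpR _ _).2 (hker n hn x))
  obtain ⟨f', hf'⟩ : ∃ f' : S' → T, ∀ x, f' (p x) = f x :=
    ⟨fun s => f (Function.surjInv hp s), fun x =>
      hE.1 _ _ ((hpR _ _).1 (Function.surjInv_eq hp (p x)))⟩
  refine ⟨S', instM, instA, p, f', hp, hpR, hA, hf', fun x y => hd x y ▸ quotDist_le_dist R x y, ?_⟩
  have hple : ∀ x y, dist (p x) (p y) ≤ dist x y := fun x y => hd x y ▸ quotDist_le_dist R x y
  have hf'le : ∀ x y, dist (f' x) (f' y) ≤ dist x y := fun x y => by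
    obtain ⟨x, rfl⟩ := hp x
    obtain ⟨y, rfl⟩ := hp y
    rw [hf', hf', hd]
    exact hE.dist_le_quotDist D.dist_le x y
  have hS' : IsRTree S' := by
    have := D.source.isRTree.preconnectedSpace
    have hc : Continuous p := LipschitzWith.continuous (K := 1)
      (LipschitzWith.of_dist_le_mul fun x y => by simpa using hple x y)
    have := hp.denseRange.preconnectedSpace hc
    have := D.source.isRTree.nonempty.map p
    refine isRTree_of_connected fun x y z w => ?_
    obtain ⟨x, rfl⟩ := hp x
    obtain ⟨y, rfl⟩ := hp y
    obtain ⟨z, rfl⟩ := hp z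
    obtain ⟨w, rfl⟩ := hp w
    simp only [hd]
    exact (isTreeDist_quotDist D.source.isRTree hR hF).hyperbolic x y z w
  have hGT : IsGTree G' S' := ⟨hS', fun g x y => by
    have key : ∀ (g : G') (x y : S'), dist (g • x) (g • y) ≤ dist x y := fun g x y => by
      obtain ⟨x, rfl⟩ := hp x
      obtain ⟨y, rfl⟩ := hp y
      obtain ⟨g, rfl⟩ := hπ g
      rw [← hA, ← hA, hd, hd]
      refine le_quotDist fun r hr => hr.le (ρ := fun x y => quotDist R (g • x) (g • y))
        (fun _ => quotDist_self _ _) (fun _ _ _ => quotDist_triangle _ _ _ _)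
        (fun x y h => quotDist_eq_zero (hG g x y h)) (fun x y => ?_)
      rw [← D.source.dist_smul g x y]
      exact quotDist_le_dist R _ _
    refine le_antisymm (key g x y) ?_
    simpa using key g⁻¹ (g • x) (g • y)⟩
  have hsmul : ∀ (g : G') (x : S'), f' (g • x) = fhom' g • f' x := fun g x => by
    obtain ⟨x, rfl⟩ := hp x
    obtain ⟨g, rfl⟩ := hπ g
    rw [← hA, hf', hf', D.map_smul, hcomp]
  have hinv : ∀ (g : G'), ∀ x ∈ f' ⁻¹' W, g • x ∈ f' ⁻¹' W := fun g x hx => by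
    rw [Set.mem_preimage, hsmul]
    exact D.target_vertices.smul_mem _ _ hx
  have hV : ∀ x, p x ∈ f' ⁻¹' W ↔ x ∈ V := fun x => by
    rw [Set.mem_preimage, hf', D.mem_iff]
  have hE' : ∀ x, x ∉ f' ⁻¹' W → ∃ a b, IsEdge (f' ⁻¹' W) a b ∧ x ∈ seg a b := fun x hx => by
    obtain ⟨x, rfl⟩ := hp x
    obtain ⟨a, b, hab, hxab⟩ := D.vertices.exists_edge x fun h => hx ((hV x).2 h)
    exact ⟨p a, p b, D.map_edge_factor hf' hple hf'le hab,
      D.map_mem_seg_factor hf' hple hf'le hab hxab⟩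
  have hTD : TwoDirs (f' ⁻¹' W) := fun x hx => by
    obtain ⟨x, rfl⟩ := hp x
    have hxV : x ∉ V := fun h => hx ((hV x).2 h)
    obtain ⟨a, b, hab, hxab⟩ := D.vertices.exists_edge x hxV
    have hab' := D.map_edge_factor hf' hple hf'le hab
    obtain ⟨δ, hδ, hball⟩ := D.exists_ball_subset hR hE hxV hab hxab
    refine ⟨p a, p b, hS'.areTheTwoDirs (D.map_mem_seg_factor hf' hple hf'le hab hxab)
      (fun e => hx (e ▸ hab'.1)) (fun e => hx (e ▸ hab'.2.1)) hδ fun y hy => ?_⟩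
    obtain ⟨y, rfl⟩ := hp y
    obtain ⟨y', hy', hyy'⟩ := hball y (hd x y ▸ hy)
    rw [(hpR _ _).2 hyy']
    exact D.map_mem_seg_factor hf' hple hf'le hab hy'
  have hL : LocFin (f' ⁻¹' W) := fun t => by
    obtain ⟨t, rfl⟩ := hp t
    obtain ⟨δ, hδ, hrel, -⟩ := D.exists_rel_of_quotDist_lt hR hE (f t)
    obtain ⟨r, hr, hW⟩ := D.target_vertices.locFin (f t)
    refine ⟨min δ r, lt_min hδ hr, fun z hz hzt => ?_⟩
    obtain ⟨z, rfl⟩ := hp z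
    have h1 := hf'le (p z) (p t)
    rw [hf', hf'] at h1
    have h2 := hW (f z) (hf' z ▸ hz) (h1.trans_lt (hzt.trans_le (min_le_right _ _)))
    rw [hd] at hzt
    exact (hpR _ _).2 (hrel z t h2 rfl (hzt.trans_le (min_le_left _ _)))
  have hedge : ∀ a' b', IsEdge (f' ⁻¹' W) a' b' → ∃ a b, IsEdge V a b ∧ p a = a' ∧ p b = b' :=
    fun a' b' h => D.exists_edge_factor hf' hple hf'le hS' hTD hp h
  have hmap : ∀ a' b', IsEdge (f' ⁻¹' W) a' b' → IsEdge W (f' a') (f' b') := fun a' b' h => by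
    obtain ⟨a, b, hab, rfl, rfl⟩ := hedge a' b' h
    rw [hf', hf']
    exact D.map_edge a b hab
  refine ⟨hGT, D.target, ?_, D.target_vertices, hsmul, fun x => Iff.rfl, hmap, ?_, D.not_mem_orbit⟩
  · refine hGT.isVertexSet_of ?_ hinv hL hTD hE' ?_
    · obtain ⟨a, ha⟩ := D.vertices.nonempty
      exact ⟨p a, (hV a).2 ha⟩
    · rintro a _ h ⟨g, rfl⟩
      exact D.not_mem_orbit _ _ (hmap _ _ h) ⟨fhom' g, (hsmul g a).symm⟩
  · intro a' b' h q hq r hr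
    obtain ⟨a, b, hab, rfl, rfl⟩ := hedge a' b' h
    have hiso := D.isometric_factor hf' hple hf'le hab
    have hlift : ∀ q ∈ seg (p a) (p b), ∃ x ∈ seg a b, p x = q := fun q hq => by
      have h1 : dist (p a) q ≤ dist a b := by
        have h2 := hple a b
        rw [mem_seg] at hq
        linarith [dist_nonneg (x := q) (y := p b)]
      obtain ⟨x, hx, hxd⟩ := D.source.isRTree.exists_mem_seg a b dist_nonneg h1
      refine ⟨x, hx, hS'.eq_of_mem_seg (D.map_mem_seg_factor hf' hple hf'le hab hx) hq ?_⟩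
      rw [hiso a (left_mem_seg _ _) x hx, hxd]
    obtain ⟨x, hx, rfl⟩ := hlift q hq
    obtain ⟨y, hy, rfl⟩ := hlift r hr
    rw [hf', hf', hiso x hx y hy, D.isometric a b hab x hx y hy]

/-! ### Folding two edges -/

namespace IsSimplicialMap

section Fold

variable {G : Type*} [Group G] {S : Type*} [MetricSpace S] [MulAction G S]
variable {H : Type*} [Group H] {T : Type*} [MetricSpace T] [MulAction H T]
variable {V : Set S} {W : Set T} {fhom : G →* H} {f : S → T} (D : IsSimplicialMap V W fhom f)
include D

/-- Edge compatibility only has to be checked on generators of an equivalence relation. -/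
theorem edgeCompatible_eqvGen {r : S → S → Prop} (h1 : ∀ x y, r x y → f x = f y)
    (h2 : ∀ x y a b a' b', r x y → x ∉ V → IsEdge V a b → IsEdge V a' b' → x ∈ seg a b →
      y ∈ seg a' b' → f a = f a' → f b = f b' → ∀ m ∈ seg a b, ∀ m' ∈ seg a' b', f m = f m' →
        Relation.EqvGen r m m') :
    EdgeCompatible V f (Relation.EqvGen r) := by
  have h1' : ∀ x y, Relation.EqvGen r x y → f x = f y := fun x y h => by
    induction h with
    | rel x y h => exact h1 x y h
    | refl => rfl
    | symm _ _ _ ih => exact ih.symm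
    | trans _ _ _ _ _ ih ih' => exact ih.trans ih'
  refine ⟨h1', fun x y a b a' b' h => ?_⟩
  induction h generalizing a b a' b' with
  | rel x y h => exact h2 x y a b a' b' h
  | refl x =>
    intro hx hab hab' hxab hxab' ha hb m hm m' hm' hmm
    rcases D.source.isRTree.edge_unique D.vertices.twoDirs hab hab' hx hxab hxab' with
      ⟨rfl, rfl⟩ | ⟨rfl, rfl⟩
    · rw [D.eq_of_map_eq hab hm hm' hmm]
      exact Relation.EqvGen.refl _
    · exact absurd ha (D.map_edge _ _ hab).2.2.1
  | symm x y h ih =>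
    intro hy hab hab' hyab hxab' ha hb m hm m' hm' hmm
    have hx : x ∉ V := by rwa [← D.mem_iff, h1' _ _ h, D.mem_iff]
    exact (ih a' b' a b hx hab' hab hxab' hyab ha.symm hb.symm m' hm' m hm hmm.symm).symm
  | trans x y z h h' ih ih' =>
    intro hx hab hab' hxab hzab' ha hb m hm m' hm' hmm
    have hf := h1' _ _ h
    have hy : y ∉ V := by rwa [← D.mem_iff, ← hf, D.mem_iff]
    obtain ⟨a'', b'', hab'', hyab'', ha'', hb''⟩ := D.exists_oriented_edge hx hab
      (D.map_mem_seg hab hxab) hf.symm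
    have hm2 := D.map_mem_seg hab hm
    rw [← ha'', ← hb''] at hm2
    obtain ⟨m'', hm'', hmf⟩ := D.exists_of_mem_seg hab'' hm2
    exact (ih a b a'' b'' hx hab hab'' hxab hyab'' ha''.symm hb''.symm m hm m'' hm'' hmf.symm).trans
      _ _ _ (ih' a'' b'' a' b' hy hab'' hab' hyab'' hzab' (ha''.trans ha) (hb''.trans hb) m'' hm''
        m' hm' (hmf.trans hmm))

variable {v x y : S} (hx : IsEdge V v x) (hy : IsEdge V v y) (hxy : f x = f y)
include hx hy hxy

theorem dist_eq_of_map_eq : dist v x = dist v y := by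
  rw [← D.dist_edge hx, ← D.dist_edge hy, hxy]

theorem map_eq_iff_dist {a b : S} (ha : a ∈ seg v x) (hb : b ∈ seg v y) :
    f a = f b ↔ dist v a = dist v b := by
  rw [← D.isometric v x hx v (left_mem_seg _ _) a ha, ← D.isometric v y hy v (left_mem_seg _ _) b hb]
  refine ⟨fun h => by rw [h], fun h => ?_⟩
  have h1 := D.map_mem_seg hx ha
  have h2 := D.map_mem_seg hy hb
  rw [← hxy] at h2
  exact D.target.isRTree.eq_of_mem_seg h1 h2 h

theorem edgeCompatible_foldRel : EdgeCompatible V f (FoldRel G v x y) := by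
  refine D.edgeCompatible_eqvGen ?_ ?_
  · rintro _ _ ⟨g, a, ha, b, hb, hd, rfl, rfl⟩
    rw [D.map_smul, D.map_smul, (D.map_eq_iff_dist hx hy hxy ha hb).2 hd]
  · rintro _ _ a b a' b' ⟨g, p, hp, q, hq, hd, rfl, rfl⟩ hpV hab hab' hpab hqab' ha hb
    have hS := D.source.isRTree
    have hgx := D.source.isEdge_smul D.vertices.smul_mem g hx
    have hgy := D.source.isEdge_smul D.vertices.smul_mem g hy
    have hqV : g • q ∉ V := by
      rwa [← D.mem_iff, D.map_smul, ← (D.map_eq_iff_dist hx hy hxy hp hq).2 hd, ← D.map_smul,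
        D.mem_iff]
    have hlift : ∀ {p x}, p ∈ seg (g • v) (g • x) → ∃ p' ∈ seg v x, p = g • p' := fun {p x} h =>
      ⟨g⁻¹ • p, by rwa [← D.source.smul_mem_seg g, smul_inv_smul], (smul_inv_smul _ _).symm⟩
    have key : ∀ m ∈ seg (g • v) (g • x), ∀ m' ∈ seg (g • v) (g • y), f m = f m' →
        FoldRel G v x y m m' := by
      intro m hm m' hm' hmm
      obtain ⟨n, hn, rfl⟩ := hlift hm
      obtain ⟨n', hn', rfl⟩ := hlift hm'
      rw [D.map_smul, D.map_smul] at hmm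
      exact Relation.EqvGen.rel _ _ ⟨g, n, hn, n', hn', (D.map_eq_iff_dist hx hy hxy hn hn').1
        (MulAction.injective _ hmm), rfl, rfl⟩
    rcases hS.edge_unique D.vertices.twoDirs hgx hab hpV ((D.source.smul_mem_seg g).2 hp) hpab with
      ⟨rfl, rfl⟩ | ⟨rfl, rfl⟩ <;>
    rcases hS.edge_unique D.vertices.twoDirs hgy hab' hqV ((D.source.smul_mem_seg g).2 hq) hqab' with
      ⟨rfl, rfl⟩ | ⟨rfl, rfl⟩
    · exact key
    · exact absurd ha (D.map_edge _ _ hgy).2.2.1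
    · exact absurd hb (D.map_edge _ _ hgy).2.2.1
    · intro m hm m' hm' hmm
      exact key m (mem_seg_comm.1 hm) m' (mem_seg_comm.1 hm') hmm

theorem foldable_foldRel {p q : S} (h : FoldRel G v x y p q) : Foldable (FoldRel G v x y) p q := by
  have hE := D.edgeCompatible_foldRel hx hy hxy
  induction h with
  | refl p => exact Foldable.refl _ p
  | symm _ _ _ ih => exact ih.symm
  | trans _ _ _ _ _ ih ih' => exact ih.trans ih'
  | rel p q h =>
    obtain ⟨g, a, ha, b, hb, hd, rfl, rfl⟩ := h
    have hgx := D.source.isEdge_smul D.vertices.smul_mem g hx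
    have hgy := D.source.isEdge_smul D.vertices.smul_mem g hy
    have hle : ∀ {z}, IsEdge V (g • v) z → dist (g • v) z ≤ quotDist (FoldRel G v x y) (g • v) z :=
      fun {z} h => by
        rw [← D.dist_edge h]
        exact hE.dist_le_quotDist D.dist_le _ _
    refine Foldable.of_seg D.source.isRTree (Foldable.refl _ (g • v)) ?_ (hle hgx) (hle hgy)
      (Relation.EqvGen.is_equivalence _) ?_ _ ((D.source.smul_mem_seg g).2 ha) _
      ((D.source.smul_mem_seg g).2 hb) ?_
    · rw [D.source.dist_smul, D.source.dist_smul, D.dist_eq_of_map_eq hx hy hxy]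
    · intro m hm m' hm' hmm
      refine Relation.EqvGen.rel _ _ ⟨g, g⁻¹ • m, ?_, g⁻¹ • m', ?_, ?_,
        (smul_inv_smul _ _).symm, (smul_inv_smul _ _).symm⟩
      · rwa [← D.source.smul_mem_seg g, smul_inv_smul]
      · rwa [← D.source.smul_mem_seg g, smul_inv_smul]
      · rwa [← D.source.dist_smul g, smul_inv_smul, ← D.source.dist_smul g v, smul_inv_smul]
    · rw [D.source.dist_smul, D.source.dist_smul, hd]

end Fold

/-- Two different edges `[v, x]` and `[v, y]` with the same image in `T` can be folded by a basic
fold.  The stabilizer of a vertex does not grow, unless the vertex is equivalent to `x`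
in the quotient. -/
theorem exists_basicFold {G : Type*} [Group G] {S : Type v} [MetricSpace S] [MulAction G S]
    {H : Type*} [Group H] {T : Type*} [MetricSpace T] [MulAction H T]
    {V : Set S} {W : Set T} {fhom : G →* H} {f : S → T} (D : IsSimplicialMap V W fhom f)
    {v x y : S} (hx : IsEdge V v x) (hy : IsEdge V v y) (hne : x ≠ y) (hxy : f x = f y) :
    ∃ (S' : Type v) (_ : MetricSpace S') (_ : MulAction G S') (p : S → S') (f' : S' → T),
      IsBasicFold G p ∧ IsSimplicialMap (f' ⁻¹' W) W fhom f' ∧ (∀ z, f' (p z) = f z) ∧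
      (∀ a b, dist (p a) (p b) ≤ dist a b) ∧ p x = p y ∧
      ∀ a ∈ V, p a ∉ MulAction.orbit G (p x) → ∀ g : G, g • p a = p a → g • a = a := by
  have hR : Equivalence (FoldRel G v x y) := Relation.EqvGen.is_equivalence _
  have hE := D.edgeCompatible_foldRel hx hy hxy
  have hG : ∀ (g : G) (a b : S), FoldRel G v x y a b → FoldRel G v x y (g • a) (g • b) := by
    intro g a b h
    induction h with
    | refl => exact hR.refl _
    | symm _ _ _ ih => exact hR.symm ih
    | trans _ _ _ _ _ ih ih' => exact hR.trans ih ih'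
    | rel a b h =>
      obtain ⟨k, p, hp, q, hq, hd, rfl, rfl⟩ := h
      exact Relation.EqvGen.rel _ _ ⟨g * k, p, hp, q, hq, hd, smul_smul _ _ _, smul_smul _ _ _⟩
  obtain ⟨S', i1, i2, p, f', hp, hpR, hpG, hf', hle, D'⟩ := D.exists_quotient hR hE
    (fun _ _ => D.foldable_foldRel hx hy hxy) hG (π := MonoidHom.id G) (fun g => ⟨g, rfl⟩)
    (fun n (hn : n = 1) z => by rw [hn, one_smul]; exact hR.refl z)
    (fhom' := fhom) (fun g => rfl)
  have hpxy : p x = p y := (hpR x y).2 (Relation.EqvGen.rel _ _ ⟨1, x, right_mem_seg _ _, y,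
    right_mem_seg _ _, D.dist_eq_of_map_eq hx hy hxy, (one_smul _ _).symm, (one_smul _ _).symm⟩)
  refine ⟨S', i1, i2, p, f', ⟨D.source, D'.source, ?_, hp, V, v, x, y, D.vertices, hx, hy, hne,
    D.dist_eq_of_map_eq hx hy hxy, ?_, hpR⟩, D', hf', hle, hpxy, ?_⟩
  · exact D.isTreeMorphism_factor hf' hle D'.dist_le hpG
  · have hxv := D.not_mem_orbit_source hx
    by_cases h : ∃ g ∈ MulAction.stabilizer G v, g • x = y
    · exact Or.inr (Or.inl ⟨hxv, h⟩)
    · by_cases h' : y ∈ MulAction.orbit G x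
      · exact Or.inr (Or.inr ⟨hxv, h', h⟩)
      · exact Or.inl ⟨hxv, D.not_mem_orbit_source hy, h'⟩
  · have key : ∀ s t, FoldRel G v x y s t →
        (s ∈ V → p s ∉ MulAction.orbit G (p x) → s = t) ∧
        (t ∈ V → p t ∉ MulAction.orbit G (p x) → s = t) := by
      intro s t h
      induction h with
      | refl => exact ⟨fun _ _ => rfl, fun _ _ => rfl⟩
      | symm _ _ _ ih => exact ⟨fun h h' => (ih.2 h h').symm, fun h h' => (ih.1 h h').symm⟩
      | trans _ _ _ _ _ ih ih' =>
        refine ⟨fun h h' => ?_, fun h h' => ?_⟩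
        · obtain rfl := ih.1 h h'
          exact ih'.1 h h'
        · obtain rfl := ih'.2 h h'
          exact ih.2 h h'
      | rel _ _ h =>
        obtain ⟨g, a, ha, b, hb, hd, rfl, rfl⟩ := h
        refine ⟨fun h h' => ?_, fun h h' => ?_⟩
        · rw [D.vertices.smul_mem_iff] at h
          rcases hx.eq_or_eq h ha with rfl | rfl
          · rw [dist_self] at hd
            rw [dist_eq_zero.1 hd.symm]
          · exact absurd ⟨g, (hpG g a).symm⟩ h'
        · rw [D.vertices.smul_mem_iff] at h
          rcases hy.eq_or_eq h hb with rfl | rfl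
          · rw [dist_self] at hd
            rw [dist_eq_zero.1 hd]
          · refine absurd ⟨g, ?_⟩ h'
            rw [hpG, ← hpxy]
            rfl
    intro a ha hao g hg
    refine (key (g • a) a ((hpR _ _).1 ?_)).2 ha hao
    rw [hpG]
    exact hg

end IsSimplicialMap

/-! ### Killing the kernel at a vertex -/

namespace IsSimplicialMap

/-- An element of the kernel which fixes a point `w` identifies points only through folds,
which run along the segments from `w`. -/
theorem foldable_smul {G : Type*} [Group G] {S : Type*} [MetricSpace S] [MulAction G S]
    {H : Type*} [Group H] {T : Type*} [MetricSpace T] [MulAction H T]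
    {V : Set S} {W : Set T} {fhom : G →* H} {f : S → T} (D : IsSimplicialMap V W fhom f)
    {R : S → S → Prop} (hR : Equivalence R) (hE : EdgeCompatible V f R) {n : G}
    (hn : ∀ z : S, R z (n • z)) {w : S} (hw : n • w = w) (q : S) : Foldable R q (n • q) := by
  have hS := D.source.isRTree
  have key : ∀ {z x}, dist (f z) (f x) = dist z x → Foldable R z (n • z) → Foldable R x (n • x) := by
    intro z x hd h
    have hle : dist z x ≤ quotDist R z x := by
      rw [← hd]
      exact hE.dist_le_quotDist D.dist_le _ _
    have hle' : dist (n • z) (n • x) ≤ quotDist R (n • z) (n • x) := by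
      rw [D.source.dist_smul, ← hd, hE.1 _ _ (hn z), hE.1 _ _ (hn x)]
      exact hE.dist_le_quotDist D.dist_le _ _
    refine h.of_seg hS (D.source.dist_smul n z x).symm hle hle' hR ?_ x (right_mem_seg _ _) (n • x)
      (right_mem_seg _ _) (D.source.dist_smul n z x).symm
    intro a ha b hb hab
    have : b = n • a := by
      refine hS.eq_of_mem_seg hb ((D.source.smul_mem_seg n).2 ha) ?_
      rw [D.source.dist_smul, hab]
    rw [this]
    exact hn a
  refine hS.seg_induction (fun z => Foldable R z (n • z)) w q ?_ ?_ ?_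
  · rw [hw]
    exact Foldable.refl R w
  · intro z hz hzw h
    obtain ⟨a, ha, haz, hiso⟩ := D.locallyIsometric z w hzw
    obtain ⟨r, hr, hrz, hP⟩ := h (dist z a) (dist_pos.2 haz.symm)
    refine key ?_ hP
    refine hiso r (hS.mem_seg_of_dist_le (mem_seg_comm.1 hr) ha ?_) z (left_mem_seg _ _)
    rw [dist_comm]
    exact hrz.le
  · intro z hz hzq hP
    obtain ⟨a, ha, haz, hiso⟩ := D.locallyIsometric z q hzq
    exact ⟨a, ha, haz, key (hiso z (left_mem_seg _ _) a (right_mem_seg _ _)) hP⟩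

/-- If `fhom` is injective on the stabilizers of all vertices outside the orbit of `u`, a vertex
morphism makes it injective on all vertex stabilizers: divide `G` by the normal closure `N` of the
kernel of `fhom` on the stabilizer of `u`, and the tree by the action of `N`. -/
theorem exists_vertexMorphism {G : Type u} [Group G] {S : Type v} [MetricSpace S] [MulAction G S]
    {H : Type*} [Group H] {T : Type*} [MetricSpace T] [MulAction H T]
    {V : Set S} {W : Set T} {fhom : G →* H} {f : S → T} (D : IsSimplicialMap V W fhom f)
    {u : S} (hu : u ∈ V)
    (hinj : ∀ a ∈ V, a ∉ MulAction.orbit G u → ∀ g : G, g • a = a → fhom g = 1 → g = 1) :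
    ∃ (G' : Type u) (_ : Group G') (S' : Type v) (_ : MetricSpace S') (_ : MulAction G' S')
      (π : G →* G') (fhom' : G' →* H) (p : S → S') (f' : S' → T),
      IsVertexMorphism π p ∧ IsSimplicialMap (f' ⁻¹' W) W fhom' f' ∧ Function.Surjective π ∧
      Function.Surjective p ∧ (∀ g, fhom' (π g) = fhom g) ∧ (∀ z, f' (p z) = f z) ∧
      (∀ a b, dist (p a) (p b) ≤ dist a b) ∧
      ∀ a ∈ f' ⁻¹' W, ∀ g : G', g • a = a → fhom' g = 1 → g = 1 := by
  have hS := D.source.isRTree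
  let K : Subgroup G := fhom.ker ⊓ MulAction.stabilizer G u
  let N : Subgroup G := Subgroup.normalClosure (K : Set G)
  have hNn : N.Normal := Subgroup.normalClosure_normal
  have hNker : ∀ n ∈ N, fhom n = 1 := by
    have : N ≤ fhom.ker := Subgroup.normalClosure_le_normal fun k hk => hk.1
    exact fun n hn => this hn
  have hKN : ∀ k : G, fhom k = 1 → k • u = u → k ∈ N := fun k h1 h2 =>
    Subgroup.subset_normalClosure (show k ∈ K from ⟨h1, h2⟩)
  have hNf : ∀ n ∈ N, ∀ z : S, f (n • z) = f z := fun n hn z => by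
    rw [D.map_smul, hNker n hn, one_smul]
  let R : S → S → Prop := fun a b => ∃ n ∈ N, n • a = b
  have hR : Equivalence R :=
    ⟨fun z => ⟨1, N.one_mem, one_smul _ _⟩,
      fun ⟨n, hn, h⟩ => ⟨n⁻¹, N.inv_mem hn, by rw [← h, inv_smul_smul]⟩,
      fun ⟨n, hn, h⟩ ⟨k, hk, h'⟩ => ⟨k * n, N.mul_mem hk hn, by rw [mul_smul, h, h']⟩⟩
  -- an element of `N` carries an edge to any other edge with the same image which it meets inside
  have hmatch : ∀ {n a b a' b' z}, n ∈ N → IsEdge V a b → IsEdge V a' b' → z ∈ seg a b → z ∉ V →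
      n • z ∈ seg a' b' → f a = f a' → n • a = a' ∧ n • b = b' := by
    intro n a b a' b' z hn hab hab' hz hzV hnz ha
    have h1 := D.source.isEdge_smul D.vertices.smul_mem n hab
    rcases hS.edge_unique D.vertices.twoDirs h1 hab' (by rwa [D.vertices.smul_mem_iff])
      ((D.source.smul_mem_seg n).2 hz) hnz with ⟨h2, h3⟩ | ⟨h2, h3⟩
    · exact ⟨h2.symm, h3.symm⟩
    · refine absurd ?_ (D.map_edge _ _ hab).2.2.1
      rw [ha, h2, hNf n hn]
  have hE : EdgeCompatible V f R := by
    refine ⟨?_, ?_⟩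
    · rintro a _ ⟨n, hn, rfl⟩
      exact (hNf n hn a).symm
    · rintro z _ a b a' b' ⟨n, hn, rfl⟩ hz hab hab' hzab hnz ha hb m hm m' hm' hmm
      obtain ⟨rfl, rfl⟩ := hmatch hn hab hab' hzab hz hnz ha
      refine ⟨n, hn, D.eq_of_map_eq hab' ((D.source.smul_mem_seg n).2 hm) hm' ?_⟩
      rw [hNf n hn, hmm]
  have hF : ∀ n ∈ N, ∀ z : S, Foldable R z (n • z) := by
    intro n hn
    refine Subgroup.closure_induction (k := Group.conjugatesOfSet (K : Set G))
      (p := fun n _ => ∀ z : S, Foldable R z (n • z)) ?_ ?_ ?_ ?_ hn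
    · intro n hn z
      obtain ⟨k, hk, hkn⟩ := Group.mem_conjugatesOfSet_iff.1 hn
      obtain ⟨c, rfl⟩ := isConj_iff.1 hkn
      refine D.foldable_smul hR hE (fun z => ⟨_, Subgroup.conjugatesOfSet_subset_normalClosure hn,
        rfl⟩) (w := c • u) ?_ z
      have hku : k • u = u := hk.2
      rw [smul_smul, inv_mul_cancel_right, mul_smul, hku]
    · intro z
      rw [one_smul]
      exact Foldable.refl R z
    · intro a b _ _ ha hb z
      rw [mul_smul]
      exact (hb z).trans (ha _)
    · intro a _ ha z
      have := ha (a⁻¹ • z)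
      rw [smul_inv_smul] at this
      exact this.symm
  let π := QuotientGroup.mk' N
  have hπ : Function.Surjective π := QuotientGroup.mk'_surjective N
  have hπN : ∀ g, π g = 1 ↔ g ∈ N := fun g => QuotientGroup.eq_one_iff g
  let fhom' : G ⧸ N →* H := QuotientGroup.lift N fhom fun n hn => hNker n hn
  have hcomp : ∀ g, fhom' (π g) = fhom g := fun g => QuotientGroup.lift_mk' N _ g
  obtain ⟨S', i1, i2, p, f', hp, hpR, hpG, hf', hle, D'⟩ := D.exists_quotient hR hE
    (by rintro a _ ⟨n, hn, rfl⟩; exact hF n hn a)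
    (by
      rintro g a _ ⟨n, hn, rfl⟩
      refine ⟨g * n * g⁻¹, hNn.conj_mem n hn g, ?_⟩
      rw [smul_smul, inv_mul_cancel_right, mul_smul])
    (G' := G ⧸ N) (π := π) hπ
    (fun n hn z => hR.symm ⟨n, (hπN n).1 hn, rfl⟩) (fhom' := fhom') hcomp
  have hpV : ∀ a, p a ∈ f' ⁻¹' W ↔ a ∈ V := fun a => by rw [Set.mem_preimage, hf', D.mem_iff]
  have hpa : ∀ (g : G) (a b : S), π g • p a = p b → ∃ n ∈ N, (n * g) • a = b := by
    intro g a b h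
    rw [← hpG] at h
    obtain ⟨n, hn, h⟩ := (hpR _ _).1 h
    exact ⟨n, hn, by rw [mul_smul, h]⟩
  have hπn : ∀ n ∈ N, ∀ g, π (n * g) = π g := fun n hn g => by
    rw [map_mul, (hπN n).2 hn, one_mul]
  -- `N` acts transitively on the edges over an edge of the quotient, with matching end points
  have hpe : ∀ (g : G) {a b a' b' : S}, IsEdge V a b → IsEdge V a' b' → π g • p a = p a' →
      π g • p b = p b' → ∃ n ∈ N, (n * g) • a = a' ∧ (n * g) • b = b' := by
    intro g a b a' b' hab hab' ha hb
    have hgab := D.source.isEdge_smul D.vertices.smul_mem g hab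
    rw [← hpG] at ha hb
    obtain ⟨m, hm, -, hma, hmb⟩ := hS.exists_mid hgab.2.2.1
    have hmV : m ∉ V := fun h => (hgab.eq_or_eq h hm).elim hma hmb
    have hfa : f (g • a) = f a' := by rw [← hf', ha, hf']
    have hfb : f (g • b) = f b' := by rw [← hf', hb, hf']
    have hfm := D.map_mem_seg hgab hm
    rw [hfa, hfb] at hfm
    obtain ⟨m', hm', hfm'⟩ := D.exists_of_mem_seg hab' hfm
    have h1 := D.map_mem_seg_factor hf' hle D'.dist_le hgab hm
    have h2 := D.map_mem_seg_factor hf' hle D'.dist_le hab' hm'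
    rw [ha, hb] at h1
    have hedge' := D.map_edge_factor hf' hle D'.dist_le hab'
    have hpm : p m = p m' := D'.eq_of_map_eq hedge' h1 h2 (by rw [hf', hf', hfm'])
    obtain ⟨n, hn, hnm⟩ := (hpR _ _).1 hpm
    obtain ⟨h3, h4⟩ := hmatch hn hgab hab' hm hmV (by rw [hnm]; exact hm') hfa
    exact ⟨n, hn, by rw [mul_smul, h3], by rw [mul_smul, h4]⟩
  have hmapsTo : ∀ (g : G) (a : S), g • a = a → π g • p a = p a := fun g a h => by rw [← hpG, h]
  have hinjOn : ∀ a ∈ V, a ∉ MulAction.orbit G u → ∀ s t : G, s • a = a → t • a = a → π s = π t →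
      s = t := by
    intro a ha hao s t hs ht hst
    have h1 : s⁻¹ * t ∈ N := by
      rw [← hπN, map_mul, map_inv, hst, inv_mul_cancel]
    have h2 := hinj a ha hao (s⁻¹ * t) (by rw [mul_smul, ht, inv_smul_eq_iff, hs]) (hNker _ h1)
    exact inv_mul_eq_one.1 h2
  have hsurjOn : ∀ a, Set.SurjOn π (MulAction.stabilizer G a)
      (MulAction.stabilizer (G ⧸ N) (p a)) := by
    intro a g' hg'
    obtain ⟨g, rfl⟩ := hπ g'
    obtain ⟨n, hn, h⟩ := hpa g a a hg'
    exact ⟨n * g, h, hπn n hn g⟩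
  refine ⟨G ⧸ N, inferInstance, S', i1, i2, π, fhom', p, f', ⟨D.source, D'.source,
    D.isTreeMorphism_factor hf' hle D'.dist_le hpG, V, f' ⁻¹' W, D.vertices, D'.vertices,
    fun a ha => (hpV a).2 ha, ?_, ?_, ?_, ?_, ?_, ?_, u, hu, ?_, hsurjOn u⟩, D', hπ, hp, hcomp, hf',
    hle, ?_⟩
  · exact fun a b hab => ⟨D.map_edge_factor hf' hle D'.dist_le hab,
      D.isometric_factor hf' hle D'.dist_le hab a (left_mem_seg _ _) b (right_mem_seg _ _)⟩
  · intro w hw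
    obtain ⟨a, rfl⟩ := hp w
    exact ⟨a, (hpV a).1 hw, 1, one_smul _ _⟩
  · rintro a _ b _ ⟨g', h⟩
    obtain ⟨g, rfl⟩ := hπ g'
    obtain ⟨n, -, h⟩ := hpa g a b h
    exact ⟨n * g, h⟩
  · intro c d hcd
    obtain ⟨a, b, hab, rfl, rfl⟩ := D.exists_edge_factor hf' hle D'.dist_le D'.source.isRTree
      D'.vertices.twoDirs hp hcd
    exact ⟨a, b, hab, 1, one_smul _ _, one_smul _ _⟩
  · rintro a b a' b' hab hab' ⟨g', ha, hb⟩
    obtain ⟨g, rfl⟩ := hπ g'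
    obtain ⟨n, -, h⟩ := hpe g hab hab' ha hb
    exact ⟨n * g, h⟩
  · intro a b hab
    refine ⟨fun g hg => ⟨hmapsTo g a hg.1, hmapsTo g b hg.2⟩, fun s hs t ht hst => ?_, ?_⟩
    · -- the two ends of an edge cannot both lie in the orbit of `u`
      by_cases hau : a ∈ MulAction.orbit G u
      · by_cases hbu : b ∈ MulAction.orbit G u
        · refine absurd ?_ (D.not_mem_orbit_source hab)
          rwa [MulAction.orbit_eq_iff.2 hau]
        · exact hinjOn b hab.2.1 hbu s t hs.2 ht.2 hst
      · exact hinjOn a hab.1 hau s t hs.1 ht.1 hst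
    · intro g' hg'
      obtain ⟨g, rfl⟩ := hπ g'
      obtain ⟨n, hn, h⟩ := hpe g hab hab hg'.1 hg'.2
      exact ⟨n * g, h, hπn n hn g⟩
  · exact fun a ha hau => ⟨fun g hg => hmapsTo g a hg, fun s hs t ht hst =>
      hinjOn a ha hau s t hs ht hst, hsurjOn a⟩
  · intro a' ha' g' hg' h1
    obtain ⟨a, rfl⟩ := hp a'
    obtain ⟨g, rfl⟩ := hπ g'
    obtain ⟨n, hn, h⟩ := hpa g a a hg'
    have hng : fhom (n * g) = 1 := by rw [← hcomp, hπn n hn, h1]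
    rw [← hπn n hn, hπN]
    by_cases hau : a ∈ MulAction.orbit G u
    · obtain ⟨c, rfl⟩ := hau
      have h2 : c⁻¹ * (n * g) * c ∈ N := by
        refine hKN _ (by simp only [map_mul, map_inv] at hng ⊢; rw [hng]; simp) ?_
        simp only at h
        rw [mul_smul, mul_smul, h, inv_smul_smul]
      have h3 := hNn.conj_mem _ h2 c
      simpa [mul_assoc] using h3
    · rw [hinj a ((hpV a).1 ha') hau _ h hng]
      exact N.one_mem

end IsSimplicialMap

/-! ### The folding process terminates -/

namespace IsSimplicialMap

variable {H : Type u'} [Group H] {T : Type v'} [MetricSpace T] [MulAction H T] {W : Set T}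

/-- One step of the folding process: a basic fold, followed by the vertex morphism which
makes the homomorphism injective on vertex stabilizers again. -/
theorem exists_foldStep {G : Type u} [Group G] {S : Type v} [MetricSpace S] [MulAction G S]
    {V : Set S} {fhom : G →* H} {f : S → T} (D : IsSimplicialMap V W fhom f)
    (hinj : ∀ a ∈ V, ∀ g : G, g • a = a → fhom g = 1 → g = 1)
    {v x y : S} (hx : IsEdge V v x) (hy : IsEdge V v y) (hne : x ≠ y) (hxy : f x = f y) :
    ∃ (G' : Type u) (_ : Group G') (S' : Type v) (_ : MetricSpace S') (_ : MulAction G' S')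
      (π : G →* G') (fhom' : G' →* H) (p : S → S') (f' : S' → T),
      IsSimplicialMap (f' ⁻¹' W) W fhom' f' ∧ Function.Surjective π ∧
      Function.Surjective p ∧ (∀ g, fhom' (π g) = fhom g) ∧ (∀ z, f' (p z) = f z) ∧
      (∀ (g : G) (z : S), p (g • z) = π g • p z) ∧
      (∀ a b, dist (p a) (p b) ≤ dist a b) ∧ p x = p y ∧
      (∀ a ∈ f' ⁻¹' W, ∀ g : G', g • a = a → fhom' g = 1 → g = 1) ∧
      (IsFoldVertexProduct.{u, v, u', v'} fhom' f' → IsFoldVertexProduct.{u, v, u', v'} fhom f) := by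
  obtain ⟨S₁, _, _, p₁, f₁, hp₁, D₁, hf₁, hle₁, hpxy, hst⟩ := D.exists_basicFold hx hy hne hxy
  have hV : ∀ z, p₁ z ∈ f₁ ⁻¹' W ↔ z ∈ V := fun z => by rw [Set.mem_preimage, hf₁, D.mem_iff]
  obtain ⟨G', _, S₂, _, _, π, fhom', p₂, f₂, hp₂, D₂, hπ, hs₂, hcomp, hf₂, hle₂, hinj₂⟩ :=
    D₁.exists_vertexMorphism (u := p₁ x) ((hV x).2 hx.2.1) (by
      intro a ha hao g hg h1
      obtain ⟨a, rfl⟩ := hp₁.surjective a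
      exact hinj a ((hV a).1 ha) g (hst a ((hV a).1 ha) hao g hg) h1)
  refine ⟨G', inferInstance, S₂, inferInstance, inferInstance, π, fhom', p₂ ∘ p₁, f₂, D₂, hπ,
    hs₂.comp hp₁.surjective, hcomp, fun z => by rw [Function.comp_apply, hf₂, hf₁], fun g z => ?_,
    fun a b => (hle₂ _ _).trans (hle₁ _ _), by rw [Function.comp_apply, hpxy, Function.comp_apply],
    hinj₂, fun h => ?_⟩
  · have := hp₁.morphism.map_smul g z
    rw [Function.comp_apply, this, MonoidHom.id_apply, hp₂.morphism.map_smul, Function.comp_apply]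
  · have h1 := IsFoldVertexProduct.fold p₁ hp₁ _ _ (IsFoldVertexProduct.vertex π p₂ hp₂ fhom' f₂ h)
    have e1 : fhom'.comp π = fhom := MonoidHom.ext hcomp
    have e2 : (f₂ ∘ p₂) ∘ p₁ = f := funext fun z => by
      rw [Function.comp_apply, Function.comp_apply, hf₂, hf₁]
    rwa [e1, e2] at h1

section Orbits

variable {G : Type*} [Group G] {S : Type*} [MetricSpace S] [MulAction G S]
  {G' : Type*} [Group G'] {S' : Type*} [MetricSpace S'] [MulAction G' S']
  {V : Set S} {fhom : G →* H} {f : S → T} (D : IsSimplicialMap V W fhom f)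
  {fhom' : G' →* H} {f' : S' → T} (D' : IsSimplicialMap (f' ⁻¹' W) W fhom' f')
  {π : G →* G'} {p : S → S'} (hp : Function.Surjective p) (hf' : ∀ z, f' (p z) = f z)
  (hpG : ∀ (g : G) (z : S), p (g • z) = π g • p z) (hle : ∀ a b, dist (p a) (p b) ≤ dist a b)
  {F : Finset (S × S)} (hF : ∀ a b, IsEdge V a b → ∃ g : G, (g • a, g • b) ∈ F)
include D D' hp hf' hpG hle hF

theorem exists_finset_map : ∃ F' : Finset (S' × S'), F'.card ≤ F.card ∧
    ∀ a b, IsEdge (f' ⁻¹' W) a b → ∃ g : G', (g • a, g • b) ∈ F' := by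
  classical
  refine ⟨F.image (Prod.map p p), Finset.card_image_le, fun a' b' h => ?_⟩
  obtain ⟨a, b, hab, rfl, rfl⟩ := D.exists_edge_factor hf' hle D'.dist_le D'.source.isRTree
    D'.vertices.twoDirs hp h
  obtain ⟨g, hg⟩ := hF a b hab
  exact ⟨π g, Finset.mem_image.2 ⟨_, hg, by rw [Prod.map_apply, hpG, hpG]⟩⟩

/-- Identifying edges of different orbits decreases the number of orbits of edges. -/
theorem exists_finset_map_lt {v x y : S} (hx : IsEdge V v x) (hy : IsEdge V v y)
    (hpxy : p x = p y) (hno : ¬ ∃ g : G, g • v = v ∧ g • x = y) :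
    ∃ F' : Finset (S' × S'), F'.card < F.card ∧
    ∀ a b, IsEdge (f' ⁻¹' W) a b → ∃ g : G', (g • a, g • b) ∈ F' := by
  classical
  let F₀ := F.filter fun r => ¬ ∃ g : G, g • v = r.1 ∧ g • y = r.2
  have hcard : F₀.card < F.card := by
    obtain ⟨g, hg⟩ := hF v y hy
    refine Finset.card_lt_card (Finset.filter_ssubset.2 ⟨_, hg, ?_⟩)
    exact not_not.2 ⟨g, rfl, rfl⟩
  refine ⟨F₀.image (Prod.map p p), Finset.card_image_le.trans_lt hcard, fun a' b' h => ?_⟩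
  obtain ⟨a, b, hab, rfl, rfl⟩ := D.exists_edge_factor hf' hle D'.dist_le D'.source.isRTree
    D'.vertices.twoDirs hp h
  by_cases ho : ∃ g : G, g • v = a ∧ g • y = b
  · obtain ⟨g, rfl, rfl⟩ := ho
    obtain ⟨k, hk⟩ := hF v x hx
    refine ⟨π (k * g⁻¹), Finset.mem_image.2 ⟨(k • v, k • x), Finset.mem_filter.2 ⟨hk, ?_⟩, ?_⟩⟩
    · rintro ⟨c, hc1, hc2⟩
      refine hno ⟨c⁻¹ * k, ?_, ?_⟩
      · rw [mul_smul, inv_smul_eq_iff]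
        exact hc1.symm
      · rw [mul_smul, inv_smul_eq_iff]
        exact hc2.symm
    · rw [Prod.map_apply, ← hpG, ← hpG, smul_smul, smul_smul, inv_mul_cancel_right, hpG k y, ← hpxy,
        ← hpG]
  · obtain ⟨g, hg⟩ := hF a b hab
    refine ⟨π g, Finset.mem_image.2 ⟨_, Finset.mem_filter.2 ⟨hg, ?_⟩, by
      rw [Prod.map_apply, hpG, hpG]⟩⟩
    rintro ⟨c, hc1, hc2⟩
    refine ho ⟨g⁻¹ * c, ?_, ?_⟩
    · rw [mul_smul, inv_smul_eq_iff]
      exact hc1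
    · rw [mul_smul, inv_smul_eq_iff]
      exact hc2

end Orbits

/-- A finite list of pairs `(a, g)` of vertices and group elements is a list of edge generators if
the image of `g` fixes the image of `a`, for all pairs, and if the stabilizers of the edges of `T`
are, up to conjugation, generated by elements listed with both ends of an edge of `S`. -/
def IsEdgeGenerators {G : Type*} [Group G] {S : Type*} [MetricSpace S] [MulAction G S]
    (V : Set S) (fhom : G →* H) (f : S → T) (X : List (S × G)) : Prop :=
  (∀ q ∈ X, q.1 ∈ V ∧ fhom q.2 • f q.1 = f q.1) ∧
  ∀ a b, IsEdge V a b → ∃ c : G, edgeStabilizer H (f (c • a)) (f (c • b)) ≤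
    Subgroup.closure (fhom '' {g | (c • a, g) ∈ X ∧ (c • b, g) ∈ X})

theorem exists_edgeGenerators {G : Type*} [Group G] {S : Type*} [MetricSpace S] [MulAction G S]
    {V : Set S} {fhom : G →* H} {f : S → T} (D : IsSimplicialMap V W fhom f)
    (hsurj : Function.Surjective fhom)
    (hfg : ∀ c d, IsEdge W c d → (edgeStabilizer H c d).FG)
    {F : Finset (S × S)} (hF : ∀ a b, IsEdge V a b → ∃ g : G, (g • a, g • b) ∈ F) :
    ∃ X : List (S × G), IsEdgeGenerators V fhom f X := by
  have key : ∀ r : S × S, ∃ L : List G,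
      (∀ g ∈ L, IsEdge V r.1 r.2 ∧ fhom g ∈ edgeStabilizer H (f r.1) (f r.2)) ∧
      (IsEdge V r.1 r.2 → edgeStabilizer H (f r.1) (f r.2) ≤
        Subgroup.closure (fhom '' {g | g ∈ L})) := by
    intro r
    by_cases hr : IsEdge V r.1 r.2
    · obtain ⟨s, hs⟩ := hfg _ _ (D.map_edge _ _ hr)
      refine ⟨s.toList.map (Function.surjInv hsurj), fun g hg => ⟨hr, ?_⟩, fun _ => ?_⟩
      · obtain ⟨h, hh, rfl⟩ := List.mem_map.1 hg
        rw [Function.surjInv_eq hsurj, ← hs]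
        exact Subgroup.subset_closure (Finset.mem_toList.1 hh)
      · rw [← hs]
        refine Subgroup.closure_mono fun h hh => ?_
        exact ⟨_, List.mem_map.2 ⟨h, Finset.mem_toList.2 hh, rfl⟩, Function.surjInv_eq _ _⟩
    · exact ⟨[], by simp, fun h => absurd h hr⟩
  choose L hL1 hL2 using key
  refine ⟨F.toList.flatMap fun r => (L r).flatMap fun g => [(r.1, g), (r.2, g)], fun q hq => ?_,
    fun a b hab => ?_⟩
  · obtain ⟨r, -, hq⟩ := List.mem_flatMap.1 hq
    obtain ⟨g, hg, hq⟩ := List.mem_flatMap.1 hq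
    obtain ⟨h1, h2⟩ := hL1 r g hg
    simp only [List.mem_cons, List.not_mem_nil, or_false] at hq
    rcases hq with rfl | rfl
    · exact ⟨h1.1, h2.1⟩
    · exact ⟨h1.2.1, h2.2⟩
  · obtain ⟨c, hc⟩ := hF a b hab
    refine ⟨c, (hL2 (c • a, c • b) (D.source.isEdge_smul D.vertices.smul_mem c hab)).trans
      (Subgroup.closure_mono (Set.image_mono fun g hg => ?_))⟩
    have : ∀ q ∈ [(c • a, g), (c • b, g)],
        q ∈ F.toList.flatMap fun r => (L r).flatMap fun g => [(r.1, g), (r.2, g)] := fun q hq =>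
      List.mem_flatMap.2 ⟨_, Finset.mem_toList.2 hc, List.mem_flatMap.2 ⟨g, hg, hq⟩⟩
    exact ⟨this _ (by simp), this _ (by simp)⟩

theorem IsEdgeGenerators.map {G : Type*} [Group G] {S : Type*} [MetricSpace S] [MulAction G S]
    {G' : Type*} [Group G'] {S' : Type*} [MetricSpace S'] [MulAction G' S']
    {V : Set S} {fhom : G →* H} {f : S → T} (D : IsSimplicialMap V W fhom f)
    {fhom' : G' →* H} {f' : S' → T} (D' : IsSimplicialMap (f' ⁻¹' W) W fhom' f')
    {π : G →* G'} {p : S → S'} (hp : Function.Surjective p) (hcomp : ∀ g, fhom' (π g) = fhom g)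
    (hf' : ∀ z, f' (p z) = f z) (hpG : ∀ (g : G) (z : S), p (g • z) = π g • p z)
    (hle : ∀ a b, dist (p a) (p b) ≤ dist a b) {X : List (S × G)}
    (hX : IsEdgeGenerators V fhom f X) :
    IsEdgeGenerators (f' ⁻¹' W) fhom' f' (X.map fun q => (p q.1, π q.2)) := by
  refine ⟨fun q hq => ?_, fun a' b' h => ?_⟩
  · obtain ⟨r, hr, rfl⟩ := List.mem_map.1 hq
    obtain ⟨h1, h2⟩ := hX.1 r hr
    refine ⟨?_, ?_⟩
    · rw [Set.mem_preimage, hf', D.mem_iff]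
      exact h1
    · rw [hcomp, hf', h2]
  · obtain ⟨a, b, hab, rfl, rfl⟩ := D.exists_edge_factor hf' hle D'.dist_le D'.source.isRTree
      D'.vertices.twoDirs hp h
    obtain ⟨c, hc⟩ := hX.2 a b hab
    refine ⟨π c, ?_⟩
    rw [← hpG, ← hpG, hf', hf']
    refine hc.trans (Subgroup.closure_mono ?_)
    rintro _ ⟨g, ⟨h1, h2⟩, rfl⟩
    exact ⟨π g, ⟨List.mem_map.2 ⟨_, h1, rfl⟩, List.mem_map.2 ⟨_, h2, rfl⟩⟩, hcomp g⟩

/-- If all edge generators fix their vertices, the edge stabilizers of `S` are as large as those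
of `T`, and no two edges in the same orbit of a vertex stabilizer can be folded. -/
theorem IsEdgeGenerators.eq_of_fixed {G : Type*} [Group G] {S : Type*} [MetricSpace S]
    [MulAction G S] {V : Set S} {fhom : G →* H} {f : S → T} (D : IsSimplicialMap V W fhom f)
    (hinj : ∀ a ∈ V, ∀ g : G, g • a = a → fhom g = 1 → g = 1) {X : List (S × G)}
    (hX : IsEdgeGenerators V fhom f X) (hfix : ∀ q ∈ X, q.2 • q.1 = q.1) {v x : S} (hx : IsEdge V v x)
    {g : G} (hv : g • v = v) (hgx : f (g • x) = f x) : g • x = x := by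
  obtain ⟨c, hc⟩ := hX.2 v x hx
  have h1 : fhom (c * g * c⁻¹) ∈ edgeStabilizer H (f (c • v)) (f (c • x)) := by
    rw [edgeStabilizer, Subgroup.mem_inf]
    constructor
    · rw [MulAction.mem_stabilizer_iff, ← D.map_smul, smul_smul,
        inv_mul_cancel_right, mul_smul, hv]
    · rw [MulAction.mem_stabilizer_iff, ← D.map_smul, smul_smul,
        inv_mul_cancel_right, mul_smul, D.map_smul, hgx, D.map_smul]
  have h2 : Subgroup.closure (fhom '' {g | (c • v, g) ∈ X ∧ (c • x, g) ∈ X}) ≤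
      (edgeStabilizer G (c • v) (c • x)).map fhom := by
    rw [Subgroup.closure_le]
    rintro _ ⟨k, ⟨hk1, hk2⟩, rfl⟩
    exact ⟨k, ⟨hfix _ hk1, hfix _ hk2⟩, rfl⟩
  obtain ⟨k, ⟨hk1, hk2⟩, hk⟩ := h2 (hc h1)
  have hk1' : k • c • v = c • v := hk1
  have hk2' : k • c • x = c • x := hk2
  have h3 : k⁻¹ * (c * g * c⁻¹) = 1 := by
    refine hinj (c • v) (D.vertices.smul_mem c v hx.1) _ ?_ ?_
    · rw [mul_smul, smul_smul (c * g * c⁻¹), inv_mul_cancel_right, mul_smul, hv, inv_smul_eq_iff,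
        hk1']
    · rw [map_mul, map_inv, hk, inv_mul_cancel]
  rw [inv_mul_eq_one] at h3
  rw [h3, smul_smul, inv_mul_cancel_right, mul_smul] at hk2'
  exact MulAction.injective c hk2'

end IsSimplicialMap

theorem list_sum_add_le {α : Type*} {X : List α} {φ ψ : α → ℝ} (h : ∀ q ∈ X, φ q ≤ ψ q) {q : α}
    (hq : q ∈ X) {ε : ℝ} (hε : φ q + ε ≤ ψ q) : (X.map φ).sum + ε ≤ (X.map ψ).sum := by
  induction X with
  | nil => simp at hq
  | cons a X ih =>
    simp only [List.map_cons, List.sum_cons]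
    have h1 : (X.map φ).sum ≤ (X.map ψ).sum :=
      List.sum_le_sum fun q hq => h q (List.mem_cons_of_mem _ hq)
    rcases List.mem_cons.1 hq with rfl | hq
    · linarith
    · linarith [ih (fun q hq => h q (List.mem_cons_of_mem _ hq)) hq, h a List.mem_cons_self]

section Induction

variable {H : Type u'} [Group H] {T : Type v'} [MetricSpace T] [MulAction H T] {W : Set T}

/-- The folding process terminates.  The main induction is on the number `n` of orbits of edges.
As long as some edge generator `(a, g)` moves its vertex, the segment from `a` to `g • a`
contains two edges with the same image; folding these decreases the sum of the displacements of the
generators by a fixed amount.  When all generators fix their vertices, every possible fold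
identifies edges of different orbits. -/
theorem IsSimplicialMap.isFoldVertexProduct
    (hfg : ∀ c d, IsEdge W c d → (edgeStabilizer H c d).FG)
    {ε : ℝ} (hε : 0 < ε) (hW : ∀ c d, IsEdge W c d → ε ≤ dist c d) (n : ℕ) :
    ∀ {G : Type u} [Group G] {S : Type v} [MetricSpace S] [MulAction G S]
      {V : Set S} {fhom : G →* H} {f : S → T}, IsSimplicialMap V W fhom f →
      Function.Surjective f → Function.Surjective fhom →
      (∀ a ∈ V, ∀ g : G, g • a = a → fhom g = 1 → g = 1) →
      ∀ F : Finset (S × S), (∀ a b, IsEdge V a b → ∃ g : G, (g • a, g • b) ∈ F) → F.card ≤ n →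
      IsFoldVertexProduct.{u, v, u', v'} fhom f := by
  induction n using Nat.strong_induction_on with
  | _ n ihn =>
  suffices hmain : ∀ (m : ℕ) {G : Type u} [Group G] {S : Type v} [MetricSpace S] [MulAction G S]
      {V : Set S} {fhom : G →* H} {f : S → T}, IsSimplicialMap V W fhom f →
      Function.Surjective f → Function.Surjective fhom →
      (∀ a ∈ V, ∀ g : G, g • a = a → fhom g = 1 → g = 1) →
      ∀ F : Finset (S × S), (∀ a b, IsEdge V a b → ∃ g : G, (g • a, g • b) ∈ F) → F.card ≤ n →
      ∀ X : List (S × G), IsSimplicialMap.IsEdgeGenerators V fhom f X →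
      (X.map fun q => dist q.1 (q.2 • q.1)).sum ≤ m * ε →
      IsFoldVertexProduct.{u, v, u', v'} fhom f by
    intro G _ S _ _ V fhom f D hf hfhom hinj F hF hn
    obtain ⟨X, hX⟩ := D.exists_edgeGenerators hfhom hfg hF
    obtain ⟨m, hm⟩ := exists_nat_ge ((X.map fun q => dist q.1 (q.2 • q.1)).sum / ε)
    exact hmain m D hf hfhom hinj F hF hn X hX ((div_le_iff₀ hε).1 hm)
  intro m
  induction m with
  | zero =>
    intro G _ S _ _ V fhom f D hf hfhom hinj F hF hn X hX hsum
    have hfix : ∀ q ∈ X, q.2 • q.1 = q.1 := fun q hq => by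
      by_contra hne
      have h1 := list_sum_add_le (X := X) (φ := fun _ => 0) (ψ := fun q => dist q.1 (q.2 • q.1))
        (fun q _ => dist_nonneg) hq (ε := dist q.1 (q.2 • q.1)) (by simp)
      have h2 := dist_pos.2 (Ne.symm hne)
      simp only [List.map_const', List.sum_replicate, smul_zero, Nat.cast_zero, zero_mul] at h1 hsum
      linarith
    by_cases hno : ∀ v x y, IsEdge V v x → IsEdge V v y → f x = f y → x = y
    · exact D.isFoldVertexProduct_of_no_fold hf hfhom hinj hno
    · push Not at hno
      obtain ⟨v, x, y, hx, hy, hxy, hne⟩ := hno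
      obtain ⟨G', _, S', _, _, π, fhom', p, f', D', hπ, hp, hcomp, hf', hpG, hle, hpxy, hinj', hprod⟩ :=
        D.exists_foldStep hinj hx hy hne hxy
      obtain ⟨F', hcard, hF'⟩ := D.exists_finset_map_lt D' hp hf' hpG hle hF hx hy hpxy (by
        rintro ⟨g, hgv, rfl⟩
        exact hne (IsSimplicialMap.IsEdgeGenerators.eq_of_fixed D hinj hX hfix hx hgv hxy.symm).symm)
      exact hprod (ihn _ (hcard.trans_le hn) D' (fun t => (hf t).imp' p fun z hz => by rw [hf', hz])
        (fun h => (hfhom h).imp' π fun g hg => by rw [hcomp, hg]) hinj' F' hF' le_rfl)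
  | succ m ihm =>
    intro G _ S _ _ V fhom f D hf hfhom hinj F hF hn X hX hsum
    by_cases hfix : ∃ q ∈ X, q.2 • q.1 ≠ q.1
    · obtain ⟨q, hq, hne⟩ := hfix
      obtain ⟨hqV, hqf⟩ := hX.1 q hq
      obtain ⟨v, x, y, hx, hy, hxy, hfxy, hd⟩ := D.exists_backtrack hqV
        (D.vertices.smul_mem q.2 _ hqV) (Ne.symm hne) (by rw [D.map_smul, hqf])
      obtain ⟨G', _, S', _, _, π, fhom', p, f', D', hπ, hp, hcomp, hf', hpG, hle, hpxy, hinj', hprod⟩ :=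
        D.exists_foldStep hinj hx hy hxy hfxy
      obtain ⟨F', hcard, hF'⟩ := D.exists_finset_map D' hp hf' hpG hle hF
      refine hprod (ihm D' (fun t => (hf t).imp' p fun z hz => by rw [hf', hz])
        (fun h => (hfhom h).imp' π fun g hg => by rw [hcomp, hg]) hinj' F' hF' (hcard.trans hn)
        _ (hX.map D D' hp hcomp hf' hpG hle) ?_)
      have h1 := list_sum_add_le (X := X) (φ := fun q => dist (p q.1) (π q.2 • p q.1))
        (ψ := fun q => dist q.1 (q.2 • q.1)) (fun q _ => by rw [← hpG]; exact hle _ _) hq (ε := ε) (by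
          have i1 := dist_triangle (p q.1) (p x) (p (q.2 • q.1))
          have i2 := hle q.1 x
          have i3 := hle y (q.2 • q.1)
          have i4 := hW _ _ (D.map_edge _ _ hx)
          rw [D.dist_edge hx, dist_comm] at i4
          rw [← hpxy] at i3
          rw [← hpG]
          linarith [dist_nonneg (x := v) (y := y)])
      rw [List.map_map]
      push_cast at hsum
      have h2 : ((fun q : S' × G' => dist q.1 (q.2 • q.1)) ∘ fun q : S × G => (p q.1, π q.2)) =
        fun q => dist (p q.1) (π q.2 • p q.1) := rfl
      rw [h2]
      linarith
    · push Not at hfix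
      refine ihm D hf hfhom hinj F hF hn X hX ?_
      have : (X.map fun q => dist q.1 (q.2 • q.1)) = X.map fun _ => (0 : ℝ) :=
        List.map_congr_left fun q hq => by rw [hfix q hq, dist_self]
      rw [this]
      simp only [List.map_const', List.sum_replicate, smul_zero]
      positivity

end Induction

/-! ### Subdividing a morphism into a simplicial map -/

section Subdivision

theorem smul_mem_biUnion_orbit {H T : Type*} [Group H] [MulAction H T] {I : Set T} (h : H) {z : T}
    (hz : z ∈ ⋃ i ∈ I, MulAction.orbit H i) : h • z ∈ ⋃ i ∈ I, MulAction.orbit H i := by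
  simp only [Set.mem_iUnion, exists_prop] at hz ⊢
  obtain ⟨i, hi, k, rfl⟩ := hz
  exact ⟨i, hi, h * k, mul_smul _ _ _⟩

/-- An end point of a segment is not an interior point of a subsegment. -/
theorem IsRTree.eq_or_eq_of_mem {T : Type*} [MetricSpace T] (hT : IsRTree T) {a b z w : T}
    (hz : z ∈ seg a b) (hw : w ∈ seg a b) (h : a ∈ seg z w) : a = z ∨ a = w := by
  rcases hT.mem_seg_split hz hw with h1 | h1
  · exact Or.inr (seg_antisymm h (mem_seg_comm.1 h1))
  · have h2 := (seg_trans_right hz h1).2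
    exact Or.inl (seg_antisymm (mem_seg_comm.1 h) (mem_seg_comm.1 h2))

variable {G : Type*} [Group G] {S : Type*} [MetricSpace S] [MulAction G S]
variable {H : Type*} [Group H] {T : Type*} [MetricSpace T] [MulAction H T]

/-- A point near which a map is an isometric embedding. -/
def IsRegularPoint (f : S → T) (m : S) : Prop :=
  ∃ δ > 0, ∀ p q, dist m p < δ → dist m q < δ → dist (f p) (f q) = dist p q

variable {VS : Set S} {VT W : Set T} {fhom : G →* H} {f : S → T}

theorem IsRegularPoint.of_smul (hS : IsGTree G S) (hT : IsGTree H T)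
    (hf : IsTreeMorphism fhom f) {m : S} (g : G) (h : IsRegularPoint f (g • m)) :
    IsRegularPoint f m := by
  obtain ⟨δ, hδ, h⟩ := h
  refine ⟨δ, hδ, fun p q hp hq => ?_⟩
  have := h (g • p) (g • q) (by rwa [hS.dist_smul]) (by rwa [hS.dist_smul])
  rwa [hf.map_smul, hf.map_smul, hT.dist_smul, hS.dist_smul] at this

theorem not_isRegularPoint_of_fold (hS : IsRTree S) {m p q : S} (hmp : m ≠ p)
    (hmq : m ≠ q) (h : ∀ w ∈ seg m p, w ≠ m → ∀ w' ∈ seg m q, w' ≠ m →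
      dist (f w) (f w') ≠ dist w w') : ¬ IsRegularPoint f m := by
  rintro ⟨δ, hδ, hreg⟩
  have key : ∀ p, m ≠ p → ∃ w ∈ seg m p, w ≠ m ∧ dist m w < δ := fun p hmp => by
    have h0 := dist_pos.2 hmp
    have h1 : 0 < min (δ / 2) (dist m p) := by positivity
    obtain ⟨w, hw, hd⟩ := hS.exists_mem_seg m p h1.le (min_le_right _ _)
    refine ⟨w, hw, fun e => ?_, ?_⟩
    · rw [e, dist_self] at hd
      linarith
    · rw [hd]
      exact (min_le_left _ _).trans_lt (by linarith)
  obtain ⟨w, hw, hwm, hwd⟩ := key p hmp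
  obtain ⟨w', hw', hwm', hwd'⟩ := key q hmq
  exact h w hw hwm w' hw' hwm' (hreg w w' hwd hwd')

variable (hS : IsGTree G S) (hT : IsGTree H T) (hVS : IsVertexSet G VS)
  (hf : IsTreeMorphism fhom f)

include hS hVS in
/-- If a part `[z, w]` of an edge is embedded isometrically, its interior points are regular. -/
theorem isRegularPoint_of_isometric {a b z w m : S} (hab : IsEdge VS a b) (hz : z ∈ seg a b)
    (hw : w ∈ seg a b) (hiso : ∀ p ∈ seg z w, ∀ q ∈ seg z w, dist (f p) (f q) = dist p q)
    (hm : m ∈ seg z w) (hmz : m ≠ z) (hmw : m ≠ w) : IsRegularPoint f m := by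
  have hR := hS.isRTree
  have hD : TwoDirs (VS ∪ {z, w}) := fun x hx => hVS.twoDirs x fun h => hx (Or.inl h)
  have hzw : IsEdge (VS ∪ {z, w}) z w := by
    refine ⟨by simp, by simp, ?_, ?_⟩
    · rintro rfl
      have : z = m := by simpa [mem_seg, dist_comm m z] using hm
      exact hmz this.symm
    · ext x
      constructor
      · rintro ⟨hx, hx' | hx'⟩
        · rcases hab.eq_or_eq hx' (hR.seg_subset hz hw hx) with rfl | rfl
          · exact hR.eq_or_eq_of_mem hz hw hx
          · exact hR.eq_or_eq_of_mem (mem_seg_comm.1 hz) (mem_seg_comm.1 hw) hx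
        · exact hx'
      · rintro (rfl | rfl)
        · exact ⟨left_mem_seg _ _, by simp⟩
        · exact ⟨right_mem_seg _ _, by simp⟩
  have hsub : ∀ p, dist m p < min (dist m z) (dist m w) → p ∈ seg z w := fun p hp => by
    obtain ⟨h1, h2⟩ := lt_min_iff.1 hp
    rcases hR.edge_gate hD hzw hm p with h | h | h
    · exact h
    · rw [mem_seg, dist_comm z m, dist_comm p m] at h
      linarith [dist_nonneg (x := p) (y := z)]
    · rw [mem_seg, dist_comm w m, dist_comm p m] at h
      linarith [dist_nonneg (x := p) (y := w)]
  exact ⟨_, lt_min (dist_pos.2 hmz) (dist_pos.2 hmw),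
    fun p q hp hq => hiso p (hsub p hp) q (hsub q hq)⟩

include hS hVS hf in
/-- An edge is folded at finitely many interior points only. -/
theorem finite_not_isRegularPoint {a b : S} (hab : IsEdge VS a b) :
    ({m | m ∉ VS ∧ ¬ IsRegularPoint f m} ∩ seg a b).Finite := by
  have hR := hS.isRTree
  have hL : LocallyIsometric f := hf.locally_isometric
  have key : ∀ {z w}, z ∈ seg a b → w ∈ seg a b →
      (∀ p ∈ seg z w, ∀ q ∈ seg z w, dist (f p) (f q) = dist p q) →
      {m | m ∉ VS ∧ ¬ IsRegularPoint f m} ∩ seg z w ⊆ {z, w} := by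
    rintro z w hz hw hiso m ⟨⟨-, hm⟩, hmzw⟩
    by_contra hne
    rw [Set.mem_insert_iff, Set.mem_singleton_iff, not_or] at hne
    exact hm (isRegularPoint_of_isometric hS hVS hab hz hw hiso hmzw hne.1 hne.2)
  have hsplit : ∀ {z w}, z ∈ seg a w → {m | m ∉ VS ∧ ¬ IsRegularPoint f m} ∩ seg a w ⊆
      ({m | m ∉ VS ∧ ¬ IsRegularPoint f m} ∩ seg a z) ∪
      ({m | m ∉ VS ∧ ¬ IsRegularPoint f m} ∩ seg z w) := by
    rintro z w hz m ⟨hm, hmw⟩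
    rcases hR.mem_seg_split hz hmw with h | h
    · exact Or.inl ⟨hm, h⟩
    · exact Or.inr ⟨hm, h⟩
  refine hR.seg_induction (fun z => ({m | m ∉ VS ∧ ¬ IsRegularPoint f m} ∩ seg a z).Finite) a b
    ?_ ?_ ?_
  · refine (Set.finite_singleton a).subset ?_
    rintro m ⟨-, hm⟩
    have : a = m := by simpa [mem_seg, dist_comm m a] using hm
    exact this.symm
  · intro z hz hza h
    obtain ⟨w, hw, hwz, hiso⟩ := hL z a hza
    obtain ⟨p, hp, hpz, hP⟩ := h (dist z w) (dist_pos.2 hwz.symm)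
    have hpw : p ∈ seg z w := hR.mem_seg_of_dist_le (mem_seg_comm.1 hp) hw
      (by rw [dist_comm]; exact hpz.le)
    refine Set.Finite.subset (hP.union (Set.toFinite {p, z}))
      ((hsplit hp).trans (Set.union_subset_union_right _ (key (seg_trans hz hp).1 hz ?_)))
    have hsub := hR.seg_subset hpw (left_mem_seg z w)
    exact fun q hq r hr => hiso q (hsub hq) r (hsub hr)
  · intro z hz hzb hP
    obtain ⟨w, hw, hwz, hiso⟩ := hL z b hzb
    obtain ⟨h1, h2⟩ := seg_trans_right hz hw
    exact ⟨w, hw, hwz, Set.Finite.subset (hP.union (Set.toFinite {z, w}))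
      ((hsplit h2).trans (Set.union_subset_union_right _ (key hz h1 hiso)))⟩

include hS hT hVS hf in
/-- If a vertex set of `T` contains the images of all vertices and of all folded points, its
preimage is a vertex set of `S`, and edges are mapped isometrically onto edges. -/
theorem isSimplicialMap_of_subset (hW : IsVertexSet H W) (hVW : ∀ x ∈ VS, f x ∈ W)
    (hreg : ∀ x, ¬ IsRegularPoint f x → f x ∈ W) :
    IsVertexSet G (f ⁻¹' W) ∧ LocFin (f ⁻¹' W) ∧
    (∀ a b, IsEdge (f ⁻¹' W) a b → IsEdge W (f a) (f b)) ∧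
    (∀ a b, IsEdge (f ⁻¹' W) a b → ∀ p ∈ seg a b, ∀ q ∈ seg a b, dist (f p) (f q) = dist p q) := by
  have hSR := hS.isRTree
  have hTR := hT.isRTree
  have hL : LocallyIsometric f := hf.locally_isometric
  have hle := hL.dist_le hSR
  have hfin : LocFin (f ⁻¹' W) := fun t => by
    obtain ⟨r, hr, h⟩ := hW.locFin (f t)
    refine ⟨r, hr, fun v hv hvt => ?_⟩
    by_contra hne
    have hfv : f v = f t := h _ hv ((hle v t).trans_lt hvt)
    obtain ⟨m, hm, hmt, hmv, hd, hfold⟩ := hL.exists_fold hSR hTR (p := t) (q := v)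
      (by rw [hfv, dist_self]; exact (dist_pos.2 (Ne.symm hne)).ne)
    have hmW := hreg m (not_isRegularPoint_of_fold hSR hmt hmv hfold)
    have hfm : f m = f t := by
      refine h _ hmW ?_
      rw [dist_comm, hd]
      rw [mem_seg, dist_comm t v] at hm
      linarith [dist_nonneg (x := m) (y := v)]
    rw [hfm, dist_self] at hd
    exact hmt (dist_eq_zero.1 hd.symm).symm
  have hV : IsVertexSet G (f ⁻¹' W) := hVS.refine hS (fun x hx => hVW x hx)
    (fun g x hx => by
      rw [Set.mem_preimage, hf.map_smul]
      exact hW.smul_mem _ _ hx) hfin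
  have hiso : ∀ a b, IsEdge (f ⁻¹' W) a b → ∀ p ∈ seg a b, ∀ q ∈ seg a b,
      dist (f p) (f q) = dist p q := by
    intro a b hab p hp q hq
    by_contra hne
    obtain ⟨m, hm, hmp, hmq, -, hfold⟩ := hL.exists_fold hSR hTR hne
    have hmW := hreg m (not_isRegularPoint_of_fold hSR hmp hmq hfold)
    rcases hab.eq_or_eq hmW (hSR.seg_subset hp hq hm) with rfl | rfl
    · exact (hSR.eq_or_eq_of_mem hp hq hm).elim hmp hmq
    · exact (hSR.eq_or_eq_of_mem (mem_seg_comm.1 hp) (mem_seg_comm.1 hq) hm).elim hmp hmq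
  refine ⟨hV, hfin, fun a b hab => ⟨hab.1, hab.2.1, ?_, ?_⟩, hiso⟩
  · have h := hiso a b hab
    rw [← dist_pos, h a (left_mem_seg _ _) b (right_mem_seg _ _)]
    exact hab.dist_pos
  · have h := hiso a b hab
    have hd := h a (left_mem_seg _ _) b (right_mem_seg _ _)
    ext z
    constructor
    · rintro ⟨hz, hzW⟩
      have h1 : dist (f a) z ≤ dist a b := by
        rw [← hd, ← mem_seg.1 hz]
        linarith [dist_nonneg (x := z) (y := f b)]
      obtain ⟨c, hc, hcd⟩ := hSR.exists_mem_seg a b dist_nonneg h1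
      have hcz : f c = z := by
        refine hTR.eq_of_mem_seg (x := f a) (y := f b) ?_ hz ?_
        · rw [mem_seg, h a (left_mem_seg _ _) c hc, h c hc b (right_mem_seg _ _), hd]
          exact hc
        · rw [h a (left_mem_seg _ _) c hc, hcd]
      rcases hab.eq_or_eq (show f c ∈ W from hcz ▸ hzW) hc with rfl | rfl
      · exact Or.inl hcz.symm
      · exact Or.inr hcz.symm
    · rintro (rfl | rfl)
      · exact ⟨left_mem_seg _ _, hab.1⟩
      · exact ⟨right_mem_seg _ _, hab.2.1⟩

/-- The midpoints of all edges. -/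
def edgeMidpoints (W : Set T) : Set T :=
  {z | ∃ c d, IsEdge W c d ∧ z ∈ seg c d ∧ dist c z = dist z d}

include hS hT hVS hf in
/-- There is a vertex set of `T` which contains the images of all vertices and folded points: the
folded points form finitely many orbits. -/
theorem exists_vertexSet_supset (hfin : HasFiniteQuotient G VS) (hVT : IsVertexSet H VT) :
    ∃ W, IsVertexSet H W ∧ VT ⊆ W ∧ (∀ x ∈ VS, f x ∈ W) ∧
      ∀ x, ¬ IsRegularPoint f x → f x ∈ W := by
  obtain ⟨⟨F, hF, hFV⟩, E, hE, hEV⟩ := hfin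
  let I : Set S := F ∪ ⋃ r ∈ {r ∈ E | IsEdge VS r.1 r.2},
    {m | m ∉ VS ∧ ¬ IsRegularPoint f m} ∩ seg r.1 r.2
  have hI : I.Finite := hF.union ((hE.subset (Set.sep_subset _ _)).biUnion fun r hr =>
    finite_not_isRegularPoint hS hVS hf hr.2)
  let J : Set T := {z ∈ f '' I | z ∉ VT}
  have hJ : J.Finite := (hI.image f).subset (Set.sep_subset _ _)
  have hL : LocFin (⋃ z ∈ J, MulAction.orbit H z) :=
    LocFin.biUnion hJ fun z hz => hVT.locFin_orbit hT hz.2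
  have hIW : ∀ (g : G) (x : S), g • x ∈ I → f x ∈ VT ∪ ⋃ z ∈ J, MulAction.orbit H z := by
    intro g x hx
    by_cases h : f (g • x) ∈ VT
    · rw [hf.map_smul, hVT.smul_mem_iff] at h
      exact Or.inl h
    · refine Or.inr (Set.mem_biUnion (x := f (g • x)) ⟨⟨_, hx, rfl⟩, h⟩ ⟨(fhom g)⁻¹, ?_⟩)
      simp only [hf.map_smul, inv_smul_smul]
  have hVW : ∀ x ∈ VS, f x ∈ VT ∪ ⋃ z ∈ J, MulAction.orbit H z := fun x hx => by
    obtain ⟨g, hg⟩ := hFV x hx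
    exact hIW g x (Or.inl hg)
  refine ⟨_, hVT.refine hT Set.subset_union_left ?_ (hVT.locFin.union hL), Set.subset_union_left,
    hVW, fun x hx => ?_⟩
  · rintro h z (hz | hz)
    · exact Or.inl (hVT.smul_mem h z hz)
    · exact Or.inr (smul_mem_biUnion_orbit h hz)
  · by_cases hxV : x ∈ VS
    · exact hVW x hxV
    · obtain ⟨a, b, hab, hxab⟩ := hVS.exists_edge x hxV
      obtain ⟨g, hg⟩ := hEV a b hab
      refine hIW g x (Or.inr (Set.mem_biUnion ⟨hg, hS.isEdge_smul hVS.smul_mem g hab⟩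
        ⟨⟨by rwa [hVS.smul_mem_iff], fun h => hx (h.of_smul hS hT hf g)⟩,
          (hS.smul_mem_seg g).2 hxab⟩))

include hT in
/-- After adding the midpoints of all edges, every edge has exactly one end among the
old vertices. -/
theorem not_mem_orbit_of_midpoints (hW : IsVertexSet H W) {c d : T}
    (hcd : IsEdge (W ∪ edgeMidpoints W) c d) : d ∉ MulAction.orbit H c := by
  have hR := hT.isRTree
  have hA : ¬ (c ∈ W ∧ d ∈ W) := by
    rintro ⟨hc, hd⟩
    have hcd' : IsEdge W c d := by
      refine ⟨hc, hd, hcd.2.2.1, ?_⟩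
      ext z
      constructor
      · rintro ⟨hz, hzW⟩
        exact hcd.eq_or_eq (Or.inl hzW) hz
      · rintro (rfl | rfl)
        · exact ⟨left_mem_seg _ _, hc⟩
        · exact ⟨right_mem_seg _ _, hd⟩
    obtain ⟨m, hm, hd, hmc, hmd⟩ := hR.exists_mid hcd.2.2.1
    exact (hcd.eq_or_eq (Or.inr ⟨c, d, hcd', hm, hd⟩) hm).elim hmc hmd
  have hB : ¬ (c ∉ W ∧ d ∉ W) := by
    rintro ⟨hc, hd⟩
    obtain ⟨a, b, hab, hcab, hcm⟩ := hcd.1.resolve_left hc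
    obtain ⟨a', b', hab', hdab, hdm⟩ := hcd.2.1.resolve_left hd
    have key : ∀ {a}, a ∈ W → a ∉ seg d c := fun {a} ha h => by
      rcases hcd.eq_or_eq (Or.inl ha) (mem_seg_comm.1 h) with rfl | rfl
      · exact hc ha
      · exact hd ha
    rcases hR.edge_gate hW.twoDirs hab hcab d with h | h | h
    · refine hcd.2.2.1 (hR.eq_of_mem_seg hcab h ?_)
      have h1 := mem_seg.1 hcab
      have h2 := mem_seg.1 h
      rcases hR.edge_unique hW.twoDirs hab hab' hd h hdab with ⟨rfl, rfl⟩ | ⟨rfl, rfl⟩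
      · linarith
      · rw [dist_comm d] at hdm h2
        rw [dist_comm _ d] at hdm
        linarith [dist_comm a' d, dist_comm d b']
    · exact key hab.1 h
    · exact key hab.2.1 h
  rintro ⟨h, rfl⟩
  simp only [hW.smul_mem_iff] at hA hB
  tauto

include hS hT hVS hf in
/-- A surjective morphism becomes a simplicial map after suitable subdivisions. -/
theorem exists_isSimplicialMap (hfin : HasFiniteQuotient G VS) (hVT : IsVertexSet H VT)
    (hsurj : Function.Surjective f) :
    ∃ W, VT ⊆ W ∧ IsSimplicialMap (f ⁻¹' W) W fhom f ∧
      ∃ F : Finset (S × S), ∀ a b, IsEdge (f ⁻¹' W) a b → ∃ g : G, (g • a, g • b) ∈ F := by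
  obtain ⟨W, hW, hVTW, hVSW, hreg⟩ := exists_vertexSet_supset hS hT hVS hf hfin hVT
  obtain ⟨hV, hVfin, hedge, hiso⟩ := isSimplicialMap_of_subset hS hT hVS hf hW hVSW hreg
  obtain ⟨E, hE, hEV⟩ := hfin.2
  have hSR := hS.isRTree
  have hTR := hT.isRTree
  obtain ⟨F, hF⟩ := hVS.exists_finset_edges hS (V' := f ⁻¹' W) (fun x hx => hVSW x hx) hVfin
    hV.smul_mem hE hEV
  -- the midpoints of edges form finitely many orbits
  let J : Set T := ⋃ r ∈ (F : Set (S × S)),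
    f '' {x | x ∈ seg r.1 r.2 ∧ dist r.1 x = dist x r.2 ∧ f x ∉ W}
  have hJ : J.Finite := F.finite_toSet.biUnion fun r _ => by
    refine Set.Finite.image f (Set.Subsingleton.finite ?_)
    rintro x ⟨hx, hx', -⟩ y ⟨hy, hy', -⟩
    refine hSR.eq_of_mem_seg hx hy ?_
    rw [mem_seg] at hx hy
    linarith
  have hJW : ∀ z ∈ J, z ∉ W := by
    intro z hz
    simp only [J, Set.mem_iUnion] at hz
    obtain ⟨r, -, x, ⟨-, -, hx⟩, rfl⟩ := hz
    exact hx
  have hmid : edgeMidpoints W ⊆ ⋃ z ∈ J, MulAction.orbit H z := by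
    rintro z ⟨c, d, hcd, hz, hd⟩
    have hzW : z ∉ W := fun h => by
      have hpos := hcd.dist_pos
      rw [mem_seg] at hz
      rcases hcd.eq_or_eq h hz with rfl | rfl <;> simp at hd <;> simp [hd] at hpos
    obtain ⟨x, rfl⟩ := hsurj z
    obtain ⟨a, b, hab, hxab⟩ := hV.exists_edge x hzW
    have ha := hiso a b hab a (left_mem_seg _ _) x hxab
    have hb := hiso a b hab x hxab b (right_mem_seg _ _)
    have hxf : f x ∈ seg (f a) (f b) := by
      rw [mem_seg, ha, hb, hiso a b hab a (left_mem_seg _ _) b (right_mem_seg _ _)]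
      exact hxab
    have hax : dist a x = dist x b := by
      rw [← ha, ← hb]
      rcases hTR.edge_unique hW.twoDirs hcd (hedge a b hab) hzW hz hxf with ⟨h1, h2⟩ | ⟨h1, h2⟩
      · rw [h1, h2, hd]
      · rw [h1, h2, dist_comm d, ← hd, dist_comm]
    obtain ⟨g, hg⟩ := hF a b hab
    have hgx : f (g • x) ∈ J := by
      refine Set.mem_biUnion (Finset.mem_coe.2 hg) ⟨g • x, ⟨(hS.smul_mem_seg g).2 hxab, ?_, ?_⟩, rfl⟩
      · rw [hS.dist_smul, hS.dist_smul, hax]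
      · rwa [hf.map_smul, hW.smul_mem_iff]
    refine Set.mem_biUnion hgx ⟨(fhom g)⁻¹, ?_⟩
    simp only [hf.map_smul, inv_smul_smul]
  have hW' : IsVertexSet H (W ∪ edgeMidpoints W) := by
    refine hW.refine hT Set.subset_union_left ?_ (hW.locFin.union
      ((LocFin.biUnion hJ fun z hz => hW.locFin_orbit hT (hJW z hz)).mono hmid))
    rintro h z (hz | ⟨c, d, hcd, hz, hd⟩)
    · exact Or.inl (hW.smul_mem h z hz)
    · exact Or.inr ⟨h • c, h • d, hT.isEdge_smul hW.smul_mem h hcd, (hT.smul_mem_seg h).2 hz, by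
        rw [hT.dist_smul, hT.dist_smul, hd]⟩
  have hVSW' : ∀ x ∈ VS, f x ∈ W ∪ edgeMidpoints W := fun x hx => Or.inl (hVSW x hx)
  obtain ⟨hV', hVfin', hedge', hiso'⟩ := isSimplicialMap_of_subset hS hT hVS hf hW' hVSW'
    fun x hx => Or.inl (hreg x hx)
  refine ⟨W ∪ edgeMidpoints W, hVTW.trans Set.subset_union_left, ⟨hS, hT, hV', hW', hf.map_smul,
    fun x => Iff.rfl, hedge', hiso', fun c d hcd => not_mem_orbit_of_midpoints hT hW hcd⟩,
    hVS.exists_finset_edges hS hVSW' hVfin' hV'.smul_mem hE hEV⟩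

include hS hT hf in
/-- A morphism to a minimal tree is surjective if the homomorphism is. -/
theorem IsTreeMorphism.surjective_of_isMinimalTree (hmin : IsMinimalTree H T)
    (hsurj : Function.Surjective fhom) : Function.Surjective f := by
  rw [← Set.range_eq_univ]
  have hL : LocallyIsometric f := hf.locally_isometric
  have := hS.isRTree.preconnectedSpace
  have := hS.isRTree.nonempty
  have hc : Continuous f := LipschitzWith.continuous (K := 1)
    (LipschitzWith.of_dist_le_mul fun x y => by simpa using hL.dist_le hS.isRTree x y)
  refine hmin _ (Set.range_nonempty f)
    (fun x hx y hy => hT.isRTree.seg_subset_of_isPreconnected (isPreconnected_range hc) hx hy) ?_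
  rintro h _ ⟨x, rfl⟩
  obtain ⟨g, rfl⟩ := hsurj h
  exact ⟨g • x, hf.map_smul g x⟩

end Subdivision

end TreeFolding

theorem theorem2p1 {G : Type u} {S : Type v} {H : Type u'} {T : Type v'}
    [Group G] [MetricSpace S] [MulAction G S]
    [Group H] [MetricSpace T] [MulAction H T]
    (hS : TreeFolding.IsGTree G S) (hT : TreeFolding.IsGTree H T)
    (VS : Set S) (hVS : TreeFolding.IsVertexSet G VS)
    (hfin : TreeFolding.HasFiniteQuotient G VS)
    (VT : Set T) (hVT : TreeFolding.IsVertexSet H VT)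
    (hfg : ∀ a b : T, TreeFolding.IsEdge VT a b → (TreeFolding.edgeStabilizer H a b).FG)
    (hmin : TreeFolding.IsMinimalTree H T)
    (φhom : G →* H) (φ : S → T) (hφ : TreeFolding.IsTreeMorphism φhom φ)
    (hsurj : Function.Surjective φhom)
    (hinj : ∀ x : S, Set.InjOn φhom (MulAction.stabilizer G x)) :
    TreeFolding.IsFoldVertexProduct.{u, v, u', v'} φhom φ := by
  open TreeFolding in
  have hφs := hφ.surjective_of_isMinimalTree hS hT hmin hsurj
  obtain ⟨W, hVTW, D, F, hF⟩ := exists_isSimplicialMap hS hT hVS hφ hfin hVT hφs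
  have hTR := hT.isRTree
  have hfgW : ∀ c d, IsEdge W c d → (edgeStabilizer H c d).FG := by
    intro c d hcd
    obtain ⟨a, b, hab, hc, hd⟩ := hVT.exists_edge_supset hT hVTW hcd
    obtain ⟨m, hm, -, hmc, hmd⟩ := hTR.exists_mid hcd.2.2.1
    have hmV : m ∉ VT := fun h => (hcd.eq_or_eq (hVTW h) hm).elim hmc hmd
    rw [hVT.edgeStabilizer_eq hT hab hc hd (hTR.seg_subset hc hd hm) hmV hm]
    exact hfg a b hab
  obtain ⟨ε, hε, hεF⟩ : ∃ ε > 0, ∀ r ∈ F, r.1 ≠ r.2 → ε ≤ dist r.1 r.2 := by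
    clear hF
    induction F using Finset.cons_induction with
    | empty => exact ⟨1, one_pos, by simp⟩
    | cons r F _ ih =>
      obtain ⟨ε, hε, h⟩ := ih
      by_cases hr : r.1 = r.2
      · refine ⟨ε, hε, fun s hs hne => ?_⟩
        rcases Finset.mem_cons.1 hs with rfl | hs
        · exact absurd hr hne
        · exact h s hs hne
      · refine ⟨min ε (dist r.1 r.2), lt_min hε (dist_pos.2 hr), fun s hs hne => ?_⟩
        rcases Finset.mem_cons.1 hs with rfl | hs
        · exact min_le_right _ _
        · exact (min_le_left _ _).trans (h s hs hne)
  have hW : ∀ c d, IsEdge W c d → ε ≤ dist c d := by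
    intro c d hcd
    obtain ⟨a, b, hab, rfl, rfl⟩ := D.exists_edge_factor (p := φ) (f' := id) (fun _ => rfl) D.dist_le
      (fun _ _ => le_rfl) hTR D.target_vertices.twoDirs hφs hcd
    obtain ⟨g, hg⟩ := hF a b hab
    rw [D.dist_edge hab, ← hS.dist_smul g]
    exact hεF _ hg fun h => hab.2.2.1 (MulAction.injective g h)
  refine IsSimplicialMap.isFoldVertexProduct hfgW hε hW F.card D hφs hsurj ?_ F hF le_rfl
  intro a _ g hg h1
  exact hinj a hg (Subgroup.one_mem _) (by rw [h1, map_one])
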